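/- **Setting.** Let $V$ be a set of $n$ vertices. A directed acyclic graph (the *starting graph*) with edge set $E_0$ and a topological order $T:V\to\{1,\dots,n\}$ of it (a bijection with $T(x)<T(y)$ for every edge $x\to y$) are given. Then edges $e_1,\dots,e_m$ are inserted one after the other; they are pairwise distinct, not in $E_0$, and $E_0\cup\{e_1,\dots,e_m\}$ is acyclic. Write $u<v$ for $T(u)<T(v)$ and $d(u,v)=|T(u)-T(v)|$ (with the current $T$). Let $p\ge 0$ be an integer with $p=O(\log n)$ and let $t_0,\dots,t_{p+1}$ be real parameters with $n^{0.5}<t_0<t_1<\dots<t_p<t_{p+1}=n$. **Algorithm.** Let $\hat A_i=\{w: u\to w,\ d(u,w)\le t_i,\ w<v\}$ and $\hat B_i=\{w: w\to v,\ d(w,v)\le t_i,\ w>u\}$ for the current graph and order. - $\mathrm{Insert}(u,v)$: if $v\le u$, call $\mathrm{Reorder}(v,u,0,0)$; then insert the edge $u\to v$ into the graph. - $\mathrm{Reorder}(u,v,f_1,f_2)$: if $v\le u$, exit. If $d(u,v)\le t_0$, put $A=\hat A_0$ and $B=\hat B_0$. If $t_i<d(u,v)\le t_{i+1}$ with $0\le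 i\le p$, compute $\hat A_i$ and $\hat B_i$; put $A=\hat A_i$ if $\hat A_i\ne\emptyset$ or $f_1=1$, and otherwise compute $\hat A_{i+1}$ and put $A=\hat A_{i+1}$; likewise put $B=\hat B_i$ if $\hat B_i\neq\emptyset$ or $f_2=1$, and otherwise compute $\hat B_{i+1}$ and put $B=\hat B_{i+1}$. If $A=B=\emptyset$, exchange the positions of $u$ and $v$ in $T$. Otherwise, with respect to the order at the start of this call, for every $u'\in A\cup\{u\}$ in decreasing order, and for every $v'\in B\cup\{v\}$ with $v'>u'$ in increasing order, call $\mathrm{Reorder}(u',v',f_1',f_2')$, where $f_1'=1$ iff $u'=u$ and $A=\emptyset$, and $f_2'=1$ iff $v'=v$ and $B=\emptyset$. **Data structures and cost.** Time is the number of steps of a unit-cost RAM. $T$ and $T^{-1}$ are arrays; for each vertex the in- and out-neighbours are stored in $n$-bit arrays. For each vertex $u$ and each $0\le i\le p+1$ there are two *pails*, holding the $w$ with $u\to w$ and $0<d(u,w)\le t_i$, respectively the $w$ with $w\to u$ and $0<d(w,u)\le t_i$; pails are balanced binary search trees (AVL trees) keyed by the vertex index. Inserting an edge updates the bit arrays and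 the pails of its two ends. The sets $\hat A_i,\hat B_i$ are obtained by reading out a pail and sorting its content by $T$, by a comparison sort (insertion into a balanced search tree) if $d(u,v)>t_i$ and by counting sort with $O(t_i)$ buckets if $d(u,v)\le t_i$. Exchanging $u<v$ updates $T$, $T^{-1}$ and, for each $i$, the pails affected: it runs through the ranges of positions $T(u)-t_i\le T(w)<\min\{T(u),T(u)-t_i+d\}$ and $\max\{T(v)+t_i-d,T(v)\}<T(w)\le T(v)+t_i$ and deletes, then through $\max\{T(v),T(u)+t_i\}<T(w)\le T(u)+t_i+d$ and $T(v)-t_i-d\le T(w)<\min\{T(u),T(v)-t_i+d\}$ and inserts the neighbours found there, where $d=d(u,v)$. **Theorem.** The algorithm terminates, and the total time required for inserting the sequence of edges is $$\tilde O\!\left(\sum_{i=1}^{p+1}\frac{n^2t_i^{3/2}}{t_{i-1}}+n^2t_0\right).$$ That is, there is an integer $\kappa\ge 0$ such that for every real $c$ there is a constant $C$ for which, for all $n$, all $p\le c\log n$, all parameters $t_0,\dots,t_{p+1}$, all starting graphs with a topological order, and all sequences of edges as above, the total number of steps is at most $$C\,(\log n)^{\kappa}\left(\sum_{i=1}^{p+1}\frac{n^2t_i^{3/2}}{t_{i-1}}+n^2t_0\right).$$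 -/

import Mathlib

/-!
Online topological ordering: the insertion algorithm with auxiliary pails, as an executable
program whose elementary steps are counted on a clock.

Cost model: a unit-cost RAM.  One unit pays for a constant number of array accesses, comparisons
and arithmetic operations on indices; loops and recursions pay at least one unit per round.
-/

namespace OnlineTopo

/-! ### Computations with a step count -/

/-- A value together with the number of steps spent on computing it. -/
structure Timed (α : Type) where
  ret : α
  time : ℕ

namespace Timed

instance : Monad Timed where
  pure a := ⟨a, 0⟩
  bind x f := ⟨(f x.ret).ret, x.time + (f x.ret).time⟩

/-- Spend `k` steps. -/
def tick (k : ℕ) : Timed Unit := ⟨(), k⟩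

end Timed

/-! ### Balanced binary search trees (AVL trees) -/

/-- Binary search trees; every node stores its height. -/
inductive SearchTree (α : Type) where
  | nil : SearchTree α
  | node (h : ℕ) (l : SearchTree α) (k : α) (r : SearchTree α) : SearchTree α

namespace SearchTree

variable {α : Type}

def height : SearchTree α → ℕ
  | nil => 0
  | node h _ _ _ => h

/-- The node with key `k` and the given subtrees, with its height filled in. -/
def mk (l : SearchTree α) (k : α) (r : SearchTree α) : SearchTree α :=
  node (max l.height r.height + 1) l k r

/-- As `mk`, but restores the AVL condition by a single or double rotation
when the heights of `l` and `r` differ by two. -/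
def balance (l : SearchTree α) (k : α) (r : SearchTree α) : SearchTree α :=
  if r.height + 1 < l.height then
    match l with
    | nil => mk l k r
    | node _ ll lk lr =>
      if lr.height ≤ ll.height then mk ll lk (mk lr k r)
      else
        match lr with
        | nil => mk l k r
        | node _ lrl lrk lrr => mk (mk ll lk lrl) lrk (mk lrr k r)
  else if l.height + 1 < r.height then
    match r with
    | nil => mk l k r
    | node _ rl rk rr =>
      if rl.height ≤ rr.height then mk (mk l k rl) rk rr
      else
        match rl with
        | nil => mk l k r
        | node _ rll rlk rlr => mk (mk l k rll) rlk (mk rlr rk rr)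
  else mk l k r

variable [LinearOrder α]

/-- Insert a key (nothing changes if it is present). -/
def insert (x : α) : SearchTree α → Timed (SearchTree α)
  | nil => do
    Timed.tick 1
    return mk nil x nil
  | node h l k r => do
    Timed.tick 1
    if x < k then
      let l' ← insert x l
      return balance l' k r
    else if k < x then
      let r' ← insert x r
      return balance l k r'
    else
      return node h l k r

/-- Remove the least key of the nonempty tree with subtrees `l`, `r` and root key `k`;
returns that key and the remaining tree. -/
def popMin : SearchTree α → α → SearchTree α → Timed (α × SearchTree α)
  | nil, k, r => do
    Timed.tick 1
    return (k, r)
  | node _ ll lk lr, k, r => do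
    Timed.tick 1
    let q ← popMin ll lk lr
    return (q.1, balance q.2 k r)

/-- Delete a key (nothing changes if it is absent). -/
def delete (x : α) : SearchTree α → Timed (SearchTree α)
  | nil => do
    Timed.tick 1
    return nil
  | node _ l k r => do
    Timed.tick 1
    if x < k then
      let l' ← delete x l
      return balance l' k r
    else if k < x then
      let r' ← delete x r
      return balance l k r'
    else
      match r with
      | nil => return l
      | node _ rl rk rr =>
        let q ← popMin rl rk rr
        return balance l q.1 q.2

/-- Put the keys of a tree, in decreasing order, in front of `acc`. -/
def collectOnto : SearchTree α → List α → Timed (List α)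
  | nil, acc => do
    Timed.tick 1
    return acc
  | node _ l k r, acc => do
    Timed.tick 1
    let acc' ← collectOnto l acc
    collectOnto r (k :: acc')

/-- All keys of a tree, in decreasing order. -/
def collectAll (t : SearchTree α) : Timed (List α) := collectOnto t []

end SearchTree

/-! ### The two sorting routines -/

section Sorting

variable {n : ℕ}

/-- Insert the positions of the listed vertices into a search tree. -/
def plant (T : Fin n ≃ Fin n) : List (Fin n) → SearchTree (Fin n) → Timed (SearchTree (Fin n))
  | [], t => return t
  | w :: ws, t => do
    Timed.tick 1
    let t' ← t.insert (T w)
    plant T ws t'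

/-- Sort vertices by decreasing position, by means of a search tree. -/
def treeSort (T : Fin n ≃ Fin n) (ws : List (Fin n)) : Timed (List (Fin n)) := do
  let t ← plant T ws SearchTree.nil
  let qs ← t.collectAll
  Timed.tick qs.length
  return qs.map T.symm

/-- Distribute vertices to buckets according to `key`. -/
def scatter (key : Fin n → ℕ) :
    List (Fin n) → (ℕ → List (Fin n)) → Timed (ℕ → List (Fin n))
  | [], b => return b
  | w :: ws, b => do
    Timed.tick 1
    scatter key ws (Function.update b (key w) (w :: b (key w)))

/-- Concatenate the buckets `0, …, k - 1` in front of `acc`. -/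
def gather (b : ℕ → List (Fin n)) : ℕ → List (Fin n) → Timed (List (Fin n))
  | 0, acc => return acc
  | k + 1, acc => do
    Timed.tick (1 + (b k).length)
    gather b k (b k ++ acc)

/-- Counting sort of vertices by increasing `key`, for keys in `{0, …, m}`;
the first line pays for the allocation of the `m + 1` empty buckets. -/
def countingSort (m : ℕ) (key : Fin n → ℕ) (ws : List (Fin n)) : Timed (List (Fin n)) := do
  Timed.tick (m + 1)
  let b ← scatter key ws (fun _ => [])
  gather b (m + 1) []

end Sorting

/-! ### Memory and programs -/

/-- The memory for vertices `Fin n`.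
* `pos` is the current order `T` together with its inverse (two arrays);
* `outAdj u v` and `inAdj v u` are the bit arrays for the edges `u → v`;
* `outPail u i` holds the `w` with `u → w` and `0 < d(u, w) ≤ t i`, and
  `inPail u i` holds the `w` with `w → u` and `0 < d(w, u) ≤ t i`;
* `clock` is the number of steps made so far. -/
structure Mem (n : ℕ) where
  pos : Fin n ≃ Fin n
  outAdj : Fin n → Fin n → Bool
  inAdj : Fin n → Fin n → Bool
  outPail : Fin n → ℕ → SearchTree (Fin n)
  inPail : Fin n → ℕ → SearchTree (Fin n)
  clock : ℕ

/-- Programs acting on the memory; `none` means that a program does not return. -/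
abbrev Prog (n : ℕ) (α : Type) : Type := StateT (Mem n) Option α

section Programs

variable {n : ℕ}

/-- Run a step-counted computation and let the clock advance accordingly. -/
def timed {α : Type} (x : Timed α) : Prog n α := do
  modify fun s => { s with clock := s.clock + x.time }
  return x.ret

def tick (k : ℕ) : Prog n Unit := timed (Timed.tick k)

def outPailInsert (u : Fin n) (i : ℕ) (w : Fin n) : Prog n Unit := do
  let s ← get
  let t ← timed ((s.outPail u i).insert w)
  modify fun s =>
    { s with outPail := Function.update s.outPail u (Function.update (s.outPail u) i t) }

def outPailDelete (u : Fin n) (i : ℕ) (w : Fin n) : Prog n Unit := do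
  let s ← get
  let t ← timed ((s.outPail u i).delete w)
  modify fun s =>
    { s with outPail := Function.update s.outPail u (Function.update (s.outPail u) i t) }

def inPailInsert (u : Fin n) (i : ℕ) (w : Fin n) : Prog n Unit := do
  let s ← get
  let t ← timed ((s.inPail u i).insert w)
  modify fun s =>
    { s with inPail := Function.update s.inPail u (Function.update (s.inPail u) i t) }

def inPailDelete (u : Fin n) (i : ℕ) (w : Fin n) : Prog n Unit := do
  let s ← get
  let t ← timed ((s.inPail u i).delete w)
  modify fun s =>
    { s with inPail := Function.update s.inPail u (Function.update (s.inPail u) i t) }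

/-- Run `f` on the vertices at the positions `q` with `a ≤ q < b` (and `q < n`), one after
the other. -/
def forPositions (a b : ℕ) (f : Fin n → Prog n Unit) : Prog n Unit :=
  (List.Ico a (min b n)).forM fun q => do
    tick 1
    let s ← get
    if h : q < n then f (s.pos.symm ⟨q, h⟩) else pure ()

/-! In the sequel `p` and `t : ℕ → ℕ` are the parameters of the algorithm: the thresholds are
`t 0, …, t (p + 1)`.  As `d(u, v)` is an integer, `d(u, v) ≤ t i` may be tested with the integer
part of a real threshold, and only integer thresholds are used here. -/

/-- Insert the edge `u → v` into the adjacency arrays and into the pails. -/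
def insertEdge (p : ℕ) (t : ℕ → ℕ) (u v : Fin n) : Prog n Unit := do
  tick 2
  modify fun s => { s with
    outAdj := Function.update s.outAdj u (Function.update (s.outAdj u) v true)
    inAdj := Function.update s.inAdj v (Function.update (s.inAdj v) u true) }
  (List.range (p + 2)).forM fun i => do
    tick 1
    let s ← get
    let a : ℕ := s.pos u
    let b : ℕ := s.pos v
    if a < b ∧ b - a ≤ t i then
      outPailInsert u i v
      inPailInsert v i u

/-- Update the pails of level `i` for a swap of `u` and `v`, where `u` is before `v`.
Writing `T` for the current order and `d = T v - T u`, the four loops run over the `w` with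
* `T u - t i ≤ T w < min (T u) (T u - t i + d)`,
* `max (T v + t i - d) (T v) < T w ≤ T v + t i`,
* `max (T v) (T u + t i) < T w ≤ T u + t i + d`,
* `T v - t i - d ≤ T w < min (T u) (T v - t i + d)`. -/
def swapPails (t : ℕ → ℕ) (u v : Fin n) (i : ℕ) : Prog n Unit := do
  tick 1
  let s ← get
  let a : ℕ := s.pos u
  let b : ℕ := s.pos v
  let d : ℕ := b - a
  forPositions (a - t i) (min a (a + d - t i)) fun w => do
    inPailDelete u i w
    outPailDelete w i u
  forPositions (max (b + t i - d) b + 1) (b + t i + 1) fun w => do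
    outPailDelete v i w
    inPailDelete w i v
  forPositions (max b (a + t i) + 1) (a + t i + d + 1) fun w => do
    if s.outAdj u w then
      outPailInsert u i w
      inPailInsert w i u
  forPositions (b - d - t i) (min a (b + d - t i)) fun w => do
    if s.inAdj v w then
      inPailInsert v i w
      outPailInsert w i v

/-- Exchange the positions of `u` and `v`, where `u` is before `v`. -/
def swapVertices (p : ℕ) (t : ℕ → ℕ) (u v : Fin n) : Prog n Unit := do
  (List.range (p + 2)).forM fun i => swapPails t u v i
  tick 4
  modify fun s => { s with pos := (Equiv.swap u v).trans s.pos }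

/-- The set `{w | u → w, d(u, w) ≤ t i, w < v}`, in decreasing order, by counting sort. -/
def outNearCount (t : ℕ → ℕ) (i : ℕ) (u v : Fin n) : Prog n (List (Fin n)) := do
  let s ← get
  let ws ← timed (s.outPail u i).collectAll
  let ws' ← timed (countingSort (t i) (fun w => (s.pos u : ℕ) + t i - s.pos w) ws)
  tick ws'.length
  return ws'.filter fun w => s.pos w < s.pos v

/-- The set `{w | w → v, d(w, v) ≤ t i, u < w}`, in decreasing order, by counting sort. -/
def inNearCount (t : ℕ → ℕ) (i : ℕ) (u v : Fin n) : Prog n (List (Fin n)) := do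
  let s ← get
  let ws ← timed (s.inPail v i).collectAll
  let ws' ← timed (countingSort (t i) (fun w => (s.pos v : ℕ) - s.pos w) ws)
  tick ws'.length
  return ws'.filter fun w => s.pos u < s.pos w

/-- The set `{w | u → w, d(u, w) ≤ t i, w < v}`, in decreasing order, by comparison sort. -/
def outNearTree (i : ℕ) (u v : Fin n) : Prog n (List (Fin n)) := do
  let s ← get
  let ws ← timed (s.outPail u i).collectAll
  let ws' ← timed (treeSort s.pos ws)
  tick ws'.length
  return ws'.filter fun w => s.pos w < s.pos v

/-- The set `{w | w → v, d(w, v) ≤ t i, u < w}`, in decreasing order, by comparison sort. -/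
def inNearTree (i : ℕ) (u v : Fin n) : Prog n (List (Fin n)) := do
  let s ← get
  let ws ← timed (s.inPail v i).collectAll
  let ws' ← timed (treeSort s.pos ws)
  tick ws'.length
  return ws'.filter fun w => s.pos u < s.pos w

/-- The least `j` in `{k, …, k + m}` with `d ≤ t j` (and `k + m` if there is none), by linear
search. -/
def findLevel (t : ℕ → ℕ) (d : ℕ) : ℕ → ℕ → Timed ℕ
  | k, 0 => do
    Timed.tick 1
    return k
  | k, m + 1 => do
    Timed.tick 1
    if d ≤ t k then return k else findLevel t d (k + 1) m

/-- The sets `A` and `B` of a call of `reorder`, in decreasing order. -/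
def nearSets (p : ℕ) (t : ℕ → ℕ) (u v : Fin n) (f₁ f₂ : Bool) :
    Prog n (List (Fin n) × List (Fin n)) := do
  let s ← get
  let j ← timed (findLevel t ((s.pos v : ℕ) - s.pos u) 0 (p + 1))
  match j with
  | 0 =>
    let A ← outNearCount t 0 u v
    let B ← inNearCount t 0 u v
    return (A, B)
  | i + 1 =>
    let A₀ ← outNearTree i u v
    let B₀ ← inNearTree i u v
    let A ← if A₀ ≠ [] ∨ f₁ = true then pure A₀ else outNearCount t (i + 1) u v
    let B ← if B₀ ≠ [] ∨ f₂ = true then pure B₀ else inNearCount t (i + 1) u v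
    return (A, B)

/-- The pairs `(u', v')` with `v'` in the given decreasing list and `u' < v'`, in increasing order
of `v'`, put in front of `acc`. -/
def callsFrom (T : Fin n ≃ Fin n) (u' : Fin n) :
    List (Fin n) → List (Fin n × Fin n) → Timed (List (Fin n × Fin n))
  | [], acc => do
    Timed.tick 1
    return acc
  | v' :: vs, acc => do
    Timed.tick 1
    if T u' < T v' then callsFrom T u' vs ((u', v') :: acc) else return acc

/-- All pairs `(u', v')` with `u'` in `us`, `v'` in `vs` and `u' < v'` (both lists are decreasing),
for decreasing `u'` and, for the same `u'`, for increasing `v'`. -/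
def schedule (T : Fin n ≃ Fin n) (vs : List (Fin n)) :
    List (Fin n) → Timed (List (Fin n × Fin n))
  | [] => return []
  | u' :: us => do
    Timed.tick 1
    let c ← callsFrom T u' vs []
    let cs ← schedule T vs us
    return c ++ cs

/-- Change the order, so that `v` comes before `u`.  The pairs for the recursive calls are
determined by the order at the start of the execution.

The recursion is unbounded; `fuel` bounds its depth only to make it a total function, and the result
is `none` (for the whole program) when the depth is exceeded.  A result different from `none` does
not depend on `fuel`, and no steps are charged for it. -/
def reorder (p : ℕ) (t : ℕ → ℕ) :
    (fuel : ℕ) → (u v : Fin n) → (f₁ f₂ : Bool) → Prog n Unit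
  | 0, _, _, _, _ => failure
  | fuel + 1, u, v, f₁, f₂ => do
    tick 1
    let s ← get
    if s.pos v ≤ s.pos u then
      pure ()
    else
      let AB ← nearSets p t u v f₁ f₂
      if AB.1 = [] ∧ AB.2 = [] then
        swapVertices p t u v
      else
        let cs ← timed (schedule s.pos (v :: AB.2) (AB.1 ++ [u]))
        tick (AB.1.length + cs.length)
        cs.forM fun c =>
          reorder p t fuel c.1 c.2
            (decide (c.1 = u ∧ AB.1 = [])) (decide (c.2 = v ∧ AB.2 = []))

/-- Process the insertion of the edge `u → v`. -/
def insert (p : ℕ) (t : ℕ → ℕ) (fuel : ℕ) (u v : Fin n) : Prog n Unit := do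
  tick 1
  let s ← get
  if s.pos v ≤ s.pos u then reorder p t fuel v u false false
  insertEdge p t u v

/-- The memory for the graph without edges and the order `T`. -/
def emptyMem (T : Fin n ≃ Fin n) : Mem n where
  pos := T
  outAdj := fun _ _ => false
  inAdj := fun _ _ => false
  outPail := fun _ _ => SearchTree.nil
  inPail := fun _ _ => SearchTree.nil
  clock := 0

/-- Set up the data structures for the starting graph with edges `E₀`, start the clock, and insert
the edges `es` one after the other. -/
def session (p : ℕ) (t : ℕ → ℕ) (fuel : ℕ) (E₀ es : List (Fin n × Fin n)) : Prog n Unit := do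
  E₀.forM fun e => insertEdge p t e.1 e.2
  modify fun s => { s with clock := 0 }
  es.forM fun e => insert p t fuel e.1 e.2

end Programs

/-- The order `T` is a topological order of the graph with edges `E`. -/
def IsTopologicalOrder {n : ℕ} (E : List (Fin n × Fin n)) (T : Fin n ≃ Fin n) : Prop :=
  ∀ e ∈ E, T e.1 < T e.2

/-- The directed graph with edges `E` has no directed cycle. -/
def IsAcyclic {n : ℕ} (E : List (Fin n × Fin n)) : Prop :=
  ∀ x : Fin n, ¬ Relation.TransGen (fun a b => (a, b) ∈ E) x x

end OnlineTopo

/-! The running time is paid for by potentials that measure how far the current order `T` has come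
towards a fixed topological order `S` of the final graph. While an edge a → b is processed, every
exchange takes a descendant x of b and an ancestor y of a with x before y, and puts y before x. In
the graph with the new edge, y reaches x, so this pair now has its final relative order. By
`swap_settled` no such settled pair is ever lost, so there are at most n² exchanges.

For a scale t, `potential` counts t for every settled pair at `S`-distance at most n/√t, and adds
√t/n times the correlation ∑ S(x)T(x). An exchange over a distance d ≤ t raises the first term by t
≥ d if its pair is near in `S`. Otherwise it raises the second term by √t/n times the product of the
`S`-distance and d, which exceeds d (`Step.potential_le`). The potential stays between 0 and 2n²√t
(`potential_le`), and this bounds the total movement inside windows of length at most t. At the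
scale t = n it pays for all exchanges: n^(5/2) up to logarithms, which is below n² t₀ because √n <
t₀.

Every scheduled call still finds its two vertices unexchanged (`Progress.next`), and a call that
does not exchange makes at least two further calls. So the number of calls is proportional to the
number of exchanges, and each call can be given O(t₀) steps plus logarithmic factors. A comparison
sort costs in proportion to its output, hence to the number of calls made next. There remain the
counting sorts at a level i + 1, of cost O(t_{i+1}). On the side of u, one occurs only if u has no
out-neighbour within distance t_i, and then u must move by more than t_i before the call ends
(`Steps.lt_left`; `Steps.lt_right` for v). Charging O(t_{i+1}/t_i) per unit of this movement gives
n² t_{i+1}^(3/2)/t_i in total. The flags and the order of the calls ensure that nested calls use the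
same growth of the potential at most twice on each side (`Progress.weight_out`,
`Progress.weight_in`).

`Inv.runs_reorder` proves termination, correctness and the amortised cost in one induction;
`Progress.depth_lt` bounds the recursion depth. -/

namespace OnlineTopo

/-! ### Step counts of composed computations. -/

namespace Timed

variable {α β : Type}

@[simp] theorem ret_bind (x : Timed α) (f : α → Timed β) : (x >>= f).ret = (f x.ret).ret := rfl

@[simp] theorem time_bind (x : Timed α) (f : α → Timed β) :
    (x >>= f).time = x.time + (f x.ret).time := rfl

@[simp] theorem ret_pure (a : α) : (pure a : Timed α).ret = a := rfl

@[simp] theorem time_pure (a : α) : (pure a : Timed α).time = 0 := rfl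

@[simp] theorem time_tick (k : ℕ) : (tick k).time = k := rfl

end Timed

/-! ### AVL trees: contents, balance and logarithmic cost. -/

namespace SearchTree

variable {α : Type}

/-- The keys in order. -/
def toList : SearchTree α → List α
  | nil => []
  | node _ l k r => l.toList ++ k :: r.toList

/-- Heights are stored correctly and sibling heights differ by at most one. -/
def IsAVL : SearchTree α → Prop
  | nil => True
  | node h l _ r => l.IsAVL ∧ r.IsAVL ∧ h = max l.height r.height + 1 ∧
      l.height ≤ r.height + 1 ∧ r.height ≤ l.height + 1

@[simp] theorem toList_nil : (nil : SearchTree α).toList = [] := rfl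

@[simp] theorem toList_node (h : ℕ) (l : SearchTree α) (k : α) (r : SearchTree α) :
    (node h l k r).toList = l.toList ++ k :: r.toList := rfl

@[simp] theorem toList_mk (l : SearchTree α) (k : α) (r : SearchTree α) :
    (mk l k r).toList = l.toList ++ k :: r.toList := rfl

@[simp] theorem height_mk (l : SearchTree α) (k : α) (r : SearchTree α) :
    (mk l k r).height = max l.height r.height + 1 := rfl

@[simp] theorem height_nil : (nil : SearchTree α).height = 0 := rfl

@[simp] theorem height_node (h : ℕ) (l : SearchTree α) (k : α) (r : SearchTree α) :
    (node h l k r).height = h := rfl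

@[simp] theorem toList_balance (l : SearchTree α) (k : α) (r : SearchTree α) :
    (balance l k r).toList = l.toList ++ k :: r.toList := by
  unfold balance
  split_ifs
  · rcases l with _ | ⟨_, ll, lk, lr⟩
    · rfl
    · dsimp only
      split_ifs
      · simp
      · rcases lr with _ | ⟨_, lrl, lrk, lrr⟩ <;> simp
  · rcases r with _ | ⟨_, rl, rk, rr⟩
    · rfl
    · dsimp only
      split_ifs
      · simp
      · rcases rl with _ | ⟨_, rll, rlk, rlr⟩ <;> simp
  · simp

/-- One update changes the height of one child by at most one, so an imbalance of two is the worst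
case. A rotation may or may not lower the height. The exact value in the last clause is needed when
no rotation happens, to show that an update never changes the height in the wrong direction. -/
theorem IsAVL.balance {l r : SearchTree α} (k : α) (hl : l.IsAVL) (hr : r.IsAVL)
    (h₁ : l.height ≤ r.height + 2) (h₂ : r.height ≤ l.height + 2) :
    (balance l k r).IsAVL ∧ max l.height r.height ≤ (balance l k r).height ∧
      (balance l k r).height ≤ max l.height r.height + 1 ∧
      (l.height ≤ r.height + 1 → r.height ≤ l.height + 1 →
        (balance l k r).height = max l.height r.height + 1) := by
  unfold SearchTree.balance
  split_ifs with c₁ c₂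
  · rcases l with _ | ⟨_, ll, lk, lr⟩
    · simp at c₁
    · dsimp only
      simp only [IsAVL, height_node] at *
      split_ifs with c₃
      · simp only [mk, IsAVL, height_node]
        (repeat' apply And.intro) <;> (intros; first | omega | tauto)
      · rcases lr with _ | ⟨_, lrl, lrk, lrr⟩
        · simp at c₃
        · simp only [mk, IsAVL, height_node] at *
          (repeat' apply And.intro) <;> (intros; first | omega | tauto)
  · rcases r with _ | ⟨_, rl, rk, rr⟩
    · simp at c₂
    · dsimp only
      simp only [IsAVL, height_node] at *
      split_ifs with c₃
      · simp only [mk, IsAVL, height_node]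
        (repeat' apply And.intro) <;> (intros; first | omega | tauto)
      · rcases rl with _ | ⟨_, rll, rlk, rlr⟩
        · simp at c₃
        · simp only [mk, IsAVL, height_node] at *
          (repeat' apply And.intro) <;> (intros; first | omega | tauto)
  · simp only [mk, IsAVL, height_node]
    (repeat' apply And.intro) <;> (intros; first | omega | tauto)

theorem IsAVL.two_pow_le {t : SearchTree α} (ht : t.IsAVL) :
    2 ^ (t.height / 2) ≤ t.toList.length + 1 := by
  -- With `m` only a lower bound for the height, both children fall under the case `m - 2`, although
  -- their heights may differ.
  suffices H : ∀ (m : ℕ) (t : SearchTree α), t.IsAVL → m ≤ t.height →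
      2 ^ (m / 2) ≤ t.toList.length + 1 from H _ t ht le_rfl
  intro m
  induction m using Nat.strong_induction_on with
  | _ m ih =>
    intro t ht hm
    rcases t with _ | ⟨h, l, k, r⟩
    · simp at hm; simp [hm]
    · obtain ⟨hl, hr, h0, h1, h2⟩ := ht
      rcases Nat.lt_or_ge m 2 with hm2 | hm2
      · have : m / 2 = 0 := by omega
        simp [this]
      · simp only [height_node] at hm
        have e1 := ih (m - 2) (by omega) l hl (by omega)
        have e2 := ih (m - 2) (by omega) r hr (by omega)
        have : m / 2 = (m - 2) / 2 + 1 := by omega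
        rw [this, pow_succ]
        simp
        omega

theorem length_toList_le {n : ℕ} {t : SearchTree (Fin n)} (hs : t.toList.Pairwise (· < ·)) :
    t.toList.length ≤ n := by
  have : t.toList.Nodup := hs.imp (fun h => ne_of_lt h)
  simpa using this.length_le_card

/-- Upper bound for the height of an AVL tree with keys in `Fin n`. -/
def maxHeight (n : ℕ) : ℕ := 2 * Nat.log 2 (n + 1) + 1

theorem IsAVL.height_le {n : ℕ} {t : SearchTree (Fin n)} (ht : t.IsAVL)
    (hs : t.toList.Pairwise (· < ·)) : t.height ≤ maxHeight n := by
  have h1 := ht.two_pow_le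
  have h2 := length_toList_le hs
  have h3 : t.height / 2 ≤ Nat.log 2 (n + 1) :=
    Nat.le_log_of_pow_le (by norm_num) (by omega)
  unfold maxHeight
  omega

theorem toList_popMin (l : SearchTree α) (k : α) (r : SearchTree α) :
    (popMin l k r).ret.1 :: (popMin l k r).ret.2.toList = l.toList ++ k :: r.toList := by
  induction l generalizing k r with
  | nil => simp [popMin]
  | node h ll lk lr ihl ihr =>
    have := ihl lk lr
    simp [popMin, ← this]

theorem IsAVL.popMin {h : ℕ} {l : SearchTree α} {k : α} {r : SearchTree α}
    (ht : (node h l k r).IsAVL) :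
    (popMin l k r).ret.2.IsAVL ∧ h ≤ (popMin l k r).ret.2.height + 1 ∧
      (SearchTree.popMin l k r).ret.2.height ≤ h ∧ (SearchTree.popMin l k r).time ≤ h := by
  induction l generalizing h k r with
  | nil =>
    obtain ⟨hl, hr, h0, h1, h2⟩ := ht
    simp only [height_nil] at *
    simp only [SearchTree.popMin, Timed.ret_bind, Timed.ret_pure, Timed.time_bind, Timed.time_tick,
      Timed.time_pure]
    refine ⟨hr, ?_, ?_, ?_⟩ <;> omega
  | node hh ll lk lr ihl ihr =>
    obtain ⟨hl, hr, h0, h1, h2⟩ := ht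
    obtain ⟨a1, a2, a3, a4⟩ := ihl hl
    simp only [height_node] at *
    obtain ⟨b1, b2, b3, b4⟩ := IsAVL.balance k a1 hr (by omega) (by omega)
    simp only [SearchTree.popMin, Timed.ret_bind, Timed.ret_pure, Timed.time_bind, Timed.time_tick,
      Timed.time_pure]
    refine ⟨b1, ?_, ?_, ?_⟩ <;> omega

section Ordered

variable [LinearOrder α]

theorem mem_insert (x : α) (t : SearchTree α) (z : α) :
    z ∈ (insert x t).ret.toList ↔ z ∈ t.toList ∨ z = x := by
  induction t with
  | nil => simp [insert]
  | node h l k r ihl ihr =>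
    simp only [insert, Timed.ret_bind]
    split_ifs with h1 h2
    · simp [ihl]; tauto
    · simp [ihr]; tauto
    · have : x = k := le_antisymm (not_lt.mp h2) (not_lt.mp h1)
      subst this; simp; tauto

theorem insert_sorted (x : α) (t : SearchTree α) (hs : t.toList.Pairwise (· < ·)) :
    (insert x t).ret.toList.Pairwise (· < ·) := by
  induction t with
  | nil => simp [insert]
  | node h l k r ihl ihr =>
    simp only [toList_node, List.pairwise_append, List.pairwise_cons, List.mem_cons] at hs
    obtain ⟨h1, ⟨h2, h3⟩, h4⟩ := hs
    simp only [insert, Timed.ret_bind]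
    split_ifs with c1 c2
    · simp only [Timed.ret_bind, Timed.ret_pure, toList_balance, List.pairwise_append,
        List.pairwise_cons, List.mem_cons, mem_insert]
      refine ⟨ihl h1, ⟨h2, h3⟩, ?_⟩
      rintro a (ha | rfl) b (rfl | hb)
      · exact h4 a ha _ (Or.inl rfl)
      · exact h4 a ha b (Or.inr hb)
      · exact c1
      · exact c1.trans (h2 b hb)
    · simp only [Timed.ret_bind, Timed.ret_pure, toList_balance, List.pairwise_append,
        List.pairwise_cons, List.mem_cons, mem_insert]
      refine ⟨h1, ⟨?_, ihr h3⟩, ?_⟩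
      · rintro a (ha | rfl)
        · exact h2 a ha
        · exact c2
      · rintro a ha b (rfl | hb | rfl)
        · exact h4 a ha _ (Or.inl rfl)
        · exact h4 a ha b (Or.inr hb)
        · exact (h4 a ha k (Or.inl rfl)).trans c2
    · simp only [Timed.ret_pure, toList_node, List.pairwise_append, List.pairwise_cons,
        List.mem_cons]
      exact ⟨h1, ⟨h2, h3⟩, h4⟩

theorem IsAVL.insert (x : α) {t : SearchTree α} (ht : t.IsAVL) :
    (insert x t).ret.IsAVL ∧ t.height ≤ (insert x t).ret.height ∧
      (SearchTree.insert x t).ret.height ≤ t.height + 1 := by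
  induction t with
  | nil => simp [SearchTree.insert, mk, IsAVL]
  | node h l k r ihl ihr =>
    obtain ⟨hl, hr, h0, h1, h2⟩ := ht
    simp only [SearchTree.insert, Timed.ret_bind]
    split_ifs with c1 c2
    · obtain ⟨a1, a2, a3⟩ := ihl hl
      obtain ⟨b1, b2, b3, b4⟩ := IsAVL.balance k a1 hr (by omega) (by omega)
      simp only [Timed.ret_bind, Timed.ret_pure, height_node]
      refine ⟨b1, ?_, ?_⟩ <;> omega
    · obtain ⟨a1, a2, a3⟩ := ihr hr
      obtain ⟨b1, b2, b3, b4⟩ := IsAVL.balance k hl a1 (by omega) (by omega)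
      simp only [Timed.ret_bind, Timed.ret_pure, height_node]
      refine ⟨b1, ?_, ?_⟩ <;> omega
    · exact ⟨⟨hl, hr, h0, h1, h2⟩, le_rfl, by simp⟩

theorem time_insert_le (x : α) {t : SearchTree α} (ht : t.IsAVL) :
    (insert x t).time ≤ t.height + 1 := by
  induction t with
  | nil => simp [insert]
  | node h l k r ihl ihr =>
    obtain ⟨hl, hr, h0, h1, h2⟩ := ht
    have := ihl hl
    have := ihr hr
    simp only [insert, Timed.time_bind, Timed.time_tick, height_node]
    split_ifs with c1 c2
    all_goals simp only [Timed.time_bind, Timed.time_pure]; omega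

theorem toList_delete (x : α) (t : SearchTree α) (hs : t.toList.Pairwise (· < ·)) :
    (delete x t).ret.toList = t.toList.filter (fun z => z ≠ x) := by
  induction t with
  | nil => simp [delete]
  | node h l k r ihl ihr =>
    simp only [toList_node, List.pairwise_append, List.pairwise_cons, List.mem_cons] at hs
    obtain ⟨h1, ⟨h2, h3⟩, h4⟩ := hs
    have hlk : ∀ a ∈ l.toList, a < k := fun a ha => h4 a ha k (Or.inl rfl)
    simp only [delete, Timed.ret_bind, toList_node, List.filter_append]
    split_ifs with c1 c2
    · simp only [Timed.ret_bind, Timed.ret_pure, toList_balance, ihl h1]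
      congr 1
      symm
      rw [List.filter_eq_self]
      intro a ha
      rcases List.mem_cons.mp ha with rfl | ha
      · simpa using c1.ne'
      · simpa using (c1.trans (h2 a ha)).ne'
    · simp only [Timed.ret_bind, Timed.ret_pure, toList_balance, ihr h3]
      have e1 : l.toList.filter (fun z => z ≠ x) = l.toList := by
        rw [List.filter_eq_self]
        intro a ha
        simpa using ((hlk a ha).trans c2).ne
      rw [e1, List.filter_cons_of_pos (by simpa using c2.ne)]
    · have hx : x = k := le_antisymm (not_lt.mp c2) (not_lt.mp c1)
      subst hx
      have e1 : l.toList.filter (fun z => z ≠ x) = l.toList := by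
        rw [List.filter_eq_self]
        intro a ha
        simpa using (hlk a ha).ne
      have e2 : r.toList.filter (fun z => z ≠ x) = r.toList := by
        rw [List.filter_eq_self]
        intro a ha
        simpa using (h2 a ha).ne'
      rw [e1, List.filter_cons_of_neg (by simp), e2]
      rcases r with _ | ⟨rh, rl, rk, rr⟩
      · simp
      · simp [toList_popMin]

theorem mem_delete (x : α) (t : SearchTree α) (hs : t.toList.Pairwise (· < ·)) (z : α) :
    z ∈ (delete x t).ret.toList ↔ z ∈ t.toList ∧ z ≠ x := by
  rw [toList_delete x t hs]; simp

theorem delete_sorted (x : α) (t : SearchTree α) (hs : t.toList.Pairwise (· < ·)) :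
    (delete x t).ret.toList.Pairwise (· < ·) := by
  rw [toList_delete x t hs]; exact hs.filter _

theorem IsAVL.delete (x : α) {t : SearchTree α} (ht : t.IsAVL) :
    (delete x t).ret.IsAVL ∧ t.height ≤ (delete x t).ret.height + 1 ∧
      (SearchTree.delete x t).ret.height ≤ t.height ∧
      (SearchTree.delete x t).time ≤ t.height + 1 := by
  induction t with
  | nil => simp [SearchTree.delete, IsAVL]
  | node h l k r ihl ihr =>
    obtain ⟨hl, hr, h0, h1, h2⟩ := ht
    simp only [SearchTree.delete, Timed.ret_bind, Timed.time_bind, Timed.time_tick]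
    split_ifs with c1 c2
    · obtain ⟨a1, a2, a3, a4⟩ := ihl hl
      obtain ⟨b1, b2, b3, b4⟩ := IsAVL.balance k a1 hr (by omega) (by omega)
      simp only [Timed.ret_bind, Timed.ret_pure, height_node, Timed.time_bind, Timed.time_pure]
      refine ⟨b1, ?_, ?_, ?_⟩ <;> omega
    · obtain ⟨a1, a2, a3, a4⟩ := ihr hr
      obtain ⟨b1, b2, b3, b4⟩ := IsAVL.balance k hl a1 (by omega) (by omega)
      simp only [Timed.ret_bind, Timed.ret_pure, height_node, Timed.time_bind, Timed.time_pure]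
      refine ⟨b1, ?_, ?_, ?_⟩ <;> omega
    · rcases r with _ | ⟨rh, rl, rk, rr⟩
      · simp only [height_nil, height_node] at *
        refine ⟨hl, ?_, ?_, ?_⟩
        all_goals simp only [Timed.ret_pure, Timed.time_pure]; omega
      · obtain ⟨a1, a2, a3, a4⟩ := IsAVL.popMin hr
        simp only [height_node] at *
        obtain ⟨b1, b2, b3, b4⟩ := IsAVL.balance (SearchTree.popMin rl rk rr).ret.1 hl a1
          (by omega) (by omega)
        simp only [Timed.ret_bind, Timed.ret_pure, Timed.time_bind, Timed.time_pure]
        refine ⟨b1, ?_, ?_, ?_⟩ <;> omega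

end Ordered

theorem collectOnto_eq (t : SearchTree α) (acc : List α) :
    (collectOnto t acc).ret = t.toList.reverse ++ acc ∧
      (collectOnto t acc).time = 2 * t.toList.length + 1 := by
  induction t generalizing acc with
  | nil => simp [collectOnto]
  | node h l k r ihl ihr =>
    simp only [collectOnto, Timed.ret_bind, Timed.time_bind, ihl, ihr, Timed.time_tick]
    simp
    omega

theorem ret_collectAll (t : SearchTree α) : (collectAll t).ret = t.toList.reverse := by
  simp [collectAll, collectOnto_eq]

theorem time_collectAll (t : SearchTree α) :
    (collectAll t).time = 2 * t.toList.length + 1 := by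
  simp [collectAll, collectOnto_eq]

/-- AVL trees with increasing keys. -/
def IsBalanced [LinearOrder α] (t : SearchTree α) : Prop :=
  t.IsAVL ∧ t.toList.Pairwise (· < ·)

theorem IsBalanced.nil [LinearOrder α] : (nil : SearchTree α).IsBalanced := ⟨trivial, by simp⟩

theorem IsBalanced.insert [LinearOrder α] {t : SearchTree α} (ht : t.IsBalanced) (x : α) :
    (insert x t).ret.IsBalanced := ⟨(ht.1.insert x).1, insert_sorted x t ht.2⟩

theorem IsBalanced.delete [LinearOrder α] {t : SearchTree α} (ht : t.IsBalanced) (x : α) :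
    (delete x t).ret.IsBalanced := ⟨(ht.1.delete x).1, delete_sorted x t ht.2⟩

theorem IsBalanced.time_insert_le {n : ℕ} {t : SearchTree (Fin n)} (ht : t.IsBalanced)
    (x : Fin n) : (SearchTree.insert x t).time ≤ maxHeight n + 1 :=
  (SearchTree.time_insert_le x ht.1).trans (by have := ht.1.height_le ht.2; omega)

theorem IsBalanced.time_delete_le {n : ℕ} {t : SearchTree (Fin n)} (ht : t.IsBalanced)
    (x : Fin n) : (SearchTree.delete x t).time ≤ maxHeight n + 1 :=
  ((ht.1.delete x).2.2.2).trans (by have := ht.1.height_le ht.2; omega)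

end SearchTree

/-! ### Correctness and cost of the two sorting routines. -/

section Sorting

variable {n : ℕ}

theorem plant_spec (T : Fin n ≃ Fin n) (ws : List (Fin n)) (t : SearchTree (Fin n))
    (ht : t.IsBalanced) :
    (plant T ws t).ret.IsBalanced ∧
      (∀ z, z ∈ (plant T ws t).ret.toList ↔ z ∈ t.toList ∨ T.symm z ∈ ws) ∧
      (plant T ws t).ret.toList.length ≤ t.toList.length + ws.length ∧
      (plant T ws t).time ≤ ws.length * (SearchTree.maxHeight n + 2) := by
  induction ws generalizing t with
  | nil => exact ⟨ht, by simp [plant], by simp [plant], by simp [plant]⟩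
  | cons w ws ih =>
    obtain ⟨h1, h2, h3, h4⟩ := ih _ (ht.insert (T w))
    refine ⟨h1, ?_, ?_, ?_⟩
    · intro z
      simp only [plant, Timed.ret_bind, h2, SearchTree.mem_insert, List.mem_cons,
        Equiv.symm_apply_eq]
      tauto
    · have hlen : (t.insert (T w)).ret.toList.length ≤ t.toList.length + 1 := by
        have hnd : (t.insert (T w)).ret.toList.Nodup :=
          (ht.insert (T w)).2.imp (fun h => ne_of_lt h)
        have hsub : (t.insert (T w)).ret.toList ⊆ T w :: t.toList := by
          intro z hz
          rw [SearchTree.mem_insert] at hz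
          simp only [List.mem_cons]; tauto
        simpa using (hnd.subperm hsub).length_le
      simp only [plant, Timed.ret_bind, List.length_cons]
      omega
    · have := ht.time_insert_le (T w)
      simp only [plant, Timed.time_bind, Timed.time_tick, List.length_cons]
      rw [add_mul]
      omega

theorem mem_treeSort (T : Fin n ≃ Fin n) (ws : List (Fin n)) (z : Fin n) :
    z ∈ (treeSort T ws).ret ↔ z ∈ ws := by
  have h := (plant_spec T ws SearchTree.nil SearchTree.IsBalanced.nil).2.1
  simp only [treeSort, Timed.ret_bind, Timed.ret_pure, SearchTree.ret_collectAll, List.mem_map,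
    List.mem_reverse, h]
  simp only [SearchTree.toList_nil, List.not_mem_nil, false_or]
  constructor
  · rintro ⟨a, ha, rfl⟩; exact ha
  · intro hz; exact ⟨T z, by simpa using hz, by simp⟩

theorem treeSort_sorted (T : Fin n ≃ Fin n) (ws : List (Fin n)) :
    (treeSort T ws).ret.Pairwise (fun x y => T y < T x) := by
  have h := (plant_spec T ws SearchTree.nil SearchTree.IsBalanced.nil).1.2
  simp only [treeSort, Timed.ret_bind, Timed.ret_pure, SearchTree.ret_collectAll, List.pairwise_map,
    Equiv.apply_symm_apply]
  exact List.pairwise_reverse.mpr h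

theorem length_treeSort_le (T : Fin n ≃ Fin n) (ws : List (Fin n)) :
    (treeSort T ws).ret.length ≤ ws.length := by
  have h := (plant_spec T ws SearchTree.nil SearchTree.IsBalanced.nil).2.2.1
  simpa [treeSort, SearchTree.ret_collectAll] using h

theorem time_treeSort_le (T : Fin n ≃ Fin n) (ws : List (Fin n)) :
    (treeSort T ws).time ≤ ws.length * (SearchTree.maxHeight n + 5) + 1 := by
  obtain ⟨-, -, h1, h2⟩ := plant_spec T ws SearchTree.nil SearchTree.IsBalanced.nil
  simp only [treeSort, Timed.time_bind, Timed.time_pure, Timed.time_tick,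
    SearchTree.time_collectAll, SearchTree.ret_collectAll, List.length_reverse]
  simp only [SearchTree.toList_nil, List.length_nil] at h1
  nlinarith

theorem scatter_spec (key : Fin n → ℕ) (ws : List (Fin n)) (b : ℕ → List (Fin n)) :
    (∀ k z, z ∈ (scatter key ws b).ret k ↔ z ∈ b k ∨ (z ∈ ws ∧ key z = k)) ∧
      (∀ k, ((scatter key ws b).ret k).length = (b k).length + (ws.map key).count k) ∧
      (scatter key ws b).time = ws.length := by
  induction ws generalizing b with
  | nil => simp [scatter]
  | cons w ws ih =>
    obtain ⟨h1, h2, h3⟩ := ih (Function.update b (key w) (w :: b (key w)))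
    refine ⟨?_, ?_, ?_⟩
    · intro k z
      simp only [scatter, Timed.ret_bind, h1, List.mem_cons]
      rcases eq_or_ne k (key w) with rfl | hk
      · simp only [Function.update_self, List.mem_cons]
        constructor
        · rintro ((rfl | h) | h)
          · simp
          · exact Or.inl h
          · exact Or.inr ⟨Or.inr h.1, h.2⟩
        · rintro (h | ⟨rfl | h, h'⟩)
          · exact Or.inl (Or.inr h)
          · exact Or.inl (Or.inl rfl)
          · exact Or.inr ⟨h, h'⟩
      · simp only [Function.update_of_ne hk]
        constructor
        · rintro (h | h)
          · exact Or.inl h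
          · exact Or.inr ⟨Or.inr h.1, h.2⟩
        · rintro (h | ⟨rfl | h, h'⟩)
          · exact Or.inl h
          · exact absurd h'.symm hk
          · exact Or.inr ⟨h, h'⟩
    · intro k
      simp only [scatter, Timed.ret_bind, h2, List.map_cons]
      rcases eq_or_ne k (key w) with rfl | hk
      · simp; omega
      · simp [Function.update_of_ne hk, hk.symm]
    · simp only [scatter, Timed.time_bind, Timed.time_tick, h3, List.length_cons]; omega

theorem gather_spec (b : ℕ → List (Fin n)) (k : ℕ) (acc : List (Fin n)) :
    (gather b k acc).ret = (List.range k).flatMap b ++ acc ∧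
      (gather b k acc).time = k + ((List.range k).map fun j => (b j).length).sum := by
  induction k generalizing acc with
  | zero => simp [gather]
  | succ k ih =>
    simp only [gather, Timed.ret_bind, Timed.time_bind, ih, Timed.time_tick, List.range_succ,
      List.flatMap_append, List.map_append, List.sum_append]
    constructor
    · simp
    · simp; omega

theorem sum_count_range_le (l : List ℕ) (k : ℕ) :
    ((List.range k).map fun j => l.count j).sum ≤ l.length := by
  induction l with
  | nil => simp
  | cons a l ih =>
    have : ((List.range k).map fun j => (a :: l).count j).sum =
        ((List.range k).map fun j => l.count j).sum +
          ((List.range k).map fun j => if a = j then 1 else 0).sum := by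
      rw [← List.sum_map_add]
      congr 1
      apply List.map_congr_left
      intro j _
      simp [List.count_cons]
    rw [this, List.length_cons]
    have h2 : ((List.range k).map fun j => if a = j then 1 else 0).sum ≤ 1 := by
      rw [← List.sum_toFinset _ (List.nodup_range)]
      simp only [Finset.sum_ite_eq]
      split_ifs <;> simp
    omega

theorem mem_countingSort (m : ℕ) (key : Fin n → ℕ) (ws : List (Fin n)) (z : Fin n) :
    z ∈ (countingSort m key ws).ret ↔ z ∈ ws ∧ key z ≤ m := by
  obtain ⟨h1, -, -⟩ := scatter_spec key ws (fun _ => [])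
  simp only [countingSort, Timed.ret_bind, (gather_spec _ _ _).1, List.append_nil,
    List.mem_flatMap, h1, List.mem_range]
  simp [and_comm]

/-- Distinct keys leave at most one vertex in each bucket. No bound on the keys is needed here:
vertices with a key above `m` are dropped, as `mem_countingSort` records. -/
theorem countingSort_sorted (m : ℕ) (key : Fin n → ℕ) (ws : List (Fin n)) (hn : ws.Nodup)
    (hk : ∀ x ∈ ws, ∀ y ∈ ws, key x = key y → x = y) :
    (countingSort m key ws).ret.Pairwise (fun x y => key x < key y) := by
  obtain ⟨h1, h2, -⟩ := scatter_spec key ws (fun _ => [])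
  simp only [countingSort, Timed.ret_bind, (gather_spec _ _ _).1, List.append_nil]
  rw [List.pairwise_flatMap]
  constructor
  · intro k _
    have hlen : ((scatter key ws fun _ => []).ret k).length ≤ 1 := by
      rw [h2]
      have hnd : (ws.map key).Nodup :=
        List.Nodup.map_on (fun x hx y hy h => hk x hx y hy h) hn
      simpa using List.nodup_iff_count_le_one.mp hnd k
    generalize (scatter key ws fun _ => []).ret k = l at hlen
    match l, hlen with
    | [], _ => simp
    | [x], _ => simp
  · refine List.Pairwise.imp ?_ List.pairwise_lt_range
    intro a b hab x hx y hy
    rw [h1] at hx hy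
    simp at hx hy
    omega

theorem length_countingSort_le (m : ℕ) (key : Fin n → ℕ) (ws : List (Fin n)) :
    (countingSort m key ws).ret.length ≤ ws.length := by
  obtain ⟨-, h2, -⟩ := scatter_spec key ws (fun _ => [])
  have := sum_count_range_le (ws.map key) (m + 1)
  simp only [countingSort, Timed.ret_bind, (gather_spec _ _ _).1, List.append_nil,
    List.length_flatMap, h2]
  simpa using this

theorem time_countingSort_le (m : ℕ) (key : Fin n → ℕ) (ws : List (Fin n)) :
    (countingSort m key ws).time ≤ 2 * (m + 1) + 2 * ws.length := by
  obtain ⟨-, h2, h3⟩ := scatter_spec key ws (fun _ => [])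
  have := sum_count_range_le (ws.map key) (m + 1)
  simp only [countingSort, Timed.time_bind, (gather_spec _ _ _).2, Timed.time_tick, h2, h3]
  simp at this ⊢
  omega

end Sorting

open Relation

/-! ### Sequences of exchanges, detached from the program. -/

section Steps

variable {n : ℕ}

/-- `T` is a topological order for the edge relation `E`. -/
def Topo (E : Fin n → Fin n → Prop) (T : Fin n ≃ Fin n) : Prop := ∀ x y, E x y → T x < T y

theorem Topo.le {E : Fin n → Fin n → Prop} {T : Fin n ≃ Fin n} (hT : Topo E T) {x y : Fin n}
    (h : ReflTransGen E x y) : T x ≤ T y := by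
  induction h with
  | refl => exact le_rfl
  | tail _ h ih => exact ih.trans (hT _ _ h).le

/-- All out-neighbours of `u` come after `v`. -/
def ClearOut (E : Fin n → Fin n → Prop) (T : Fin n ≃ Fin n) (u v : Fin n) : Prop :=
  ∀ w, E u w → T v < T w

/-- All in-neighbours of `v` come before `u`. -/
def ClearIn (E : Fin n → Fin n → Prop) (T : Fin n ≃ Fin n) (u v : Fin n) : Prop :=
  ∀ w, E w v → T w < T u

/-- An exchange, within the positions `lo, …, hi`, of a descendant `x` of `u` and an ancestor `y`
of `v` that keeps the order topological. -/
def Step (E : Fin n → Fin n → Prop) (u v lo hi : Fin n) (T T' : Fin n ≃ Fin n) : Prop :=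
  ∃ x y, ReflTransGen E u x ∧ ReflTransGen E y v ∧ lo ≤ T x ∧ T x < T y ∧ T y ≤ hi ∧
    ClearOut E T x y ∧ ClearIn E T x y ∧ T' = (Equiv.swap x y).trans T

/-- Sequences of exchanges. -/
def Steps (E : Fin n → Fin n → Prop) (u v lo hi : Fin n) : (Fin n ≃ Fin n) → (Fin n ≃ Fin n) → Prop :=
  ReflTransGen (Step E u v lo hi)

variable {E : Fin n → Fin n → Prop} {u v lo hi : Fin n} {T T' : Fin n ≃ Fin n}

theorem swap_trans_apply (x y z : Fin n) (T : Fin n ≃ Fin n) :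
    (Equiv.swap x y).trans T z = if z = x then T y else if z = y then T x else T z := by
  simp only [Equiv.trans_apply, Equiv.swap_apply_def]
  split_ifs <;> rfl

/-- Only edges out of x or into y get shorter towards a violation, and the two clearness conditions
are exactly what these need. An edge x → y is excluded by `ClearOut`. -/
theorem Step.topo (h : Step E u v lo hi T T') (hT : Topo E T) : Topo E T' := by
  obtain ⟨x, y, -, -, -, hxy, -, h1, h2, rfl⟩ := h
  intro p q hpq
  have hlt := hT p q hpq
  simp only [swap_trans_apply]
  split_ifs with c1 c2 c3 c4 c5 c6 c7 c8
  · subst c1 c2; exact absurd hlt (lt_irrefl _)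
  · subst c1 c3; exact absurd (h1 _ hpq) (lt_irrefl _)
  · subst c1; exact h1 _ hpq
  · exact hxy
  · subst c4 c6; exact absurd hlt (lt_irrefl _)
  · subst c4; exact hxy.trans hlt
  · subst c7; exact hlt.trans hxy
  · subst c8; exact h2 _ hpq
  · exact hlt

theorem Steps.topo (h : Steps E u v lo hi T T') (hT : Topo E T) : Topo E T' := by
  induction h with
  | refl => exact hT
  | tail _ h ih => exact h.topo ih

/-- A descendant of u can only be the left partner of an exchange: as the right partner it would
also be an ancestor of v, and u would reach v. -/
theorem Steps.le_left (h : Steps E u v lo hi T T') (hac : ¬ ReflTransGen E u v) {x : Fin n}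
    (hx : ReflTransGen E u x) : T x ≤ T' x := by
  induction h with
  | refl => exact le_rfl
  | tail _ h ih =>
    refine ih.trans ?_
    obtain ⟨p, q, -, hq, -, hpq, -, -, -, rfl⟩ := h
    rw [swap_trans_apply]
    split_ifs with c1 c2
    · subst c1; exact hpq.le
    · subst c2; exact absurd (hx.trans hq) hac
    · exact le_rfl

theorem Steps.le_right (h : Steps E u v lo hi T T') (hac : ¬ ReflTransGen E u v) {y : Fin n}
    (hy : ReflTransGen E y v) : T' y ≤ T y := by
  induction h with
  | refl => exact le_rfl
  | tail _ h ih =>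
    refine le_trans ?_ ih
    obtain ⟨p, q, hp, -, -, hpq, -, -, -, rfl⟩ := h
    rw [swap_trans_apply]
    split_ifs with c1 c2
    · subst c1; exact absurd (hp.trans hy) hac
    · subst c2; exact hpq.le
    · exact le_rfl

theorem Steps.fixed (h : Steps E u v lo hi T T') {z : Fin n} (h1 : ¬ ReflTransGen E u z)
    (h2 : ¬ ReflTransGen E z v) : T' z = T z := by
  induction h with
  | refl => rfl
  | tail _ h ih =>
    rw [← ih]
    obtain ⟨p, q, hp, hq, -, hpq, -, -, -, rfl⟩ := h
    rw [swap_trans_apply, if_neg, if_neg]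
    · rintro rfl; exact h2 hq
    · rintro rfl; exact h1 hp

theorem Steps.outside (h : Steps E u v lo hi T T') {z : Fin n} (hz : T z < lo ∨ hi < T z) :
    T' z = T z := by
  induction h with
  | refl => rfl
  | tail _ h ih =>
    rw [← ih] at hz ⊢
    obtain ⟨p, q, hp, hq, hlo, hpq, hhi, -, -, rfl⟩ := h
    rw [swap_trans_apply, if_neg, if_neg]
    · rintro rfl; rcases hz with hz | hz
      · exact absurd (hlo.trans_lt hpq) hz.not_gt
      · exact absurd hz hhi.not_gt
    · rintro rfl; rcases hz with hz | hz
      · exact absurd hz hlo.not_gt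
      · exact absurd (hpq.trans_le hhi) hz.not_gt

theorem Steps.inside (h : Steps E u v lo hi T T') {z : Fin n} (hz : lo ≤ T z ∧ T z ≤ hi) :
    lo ≤ T' z ∧ T' z ≤ hi := by
  induction h with
  | refl => exact hz
  | tail _ h ih =>
    obtain ⟨p, q, hp, hq, hlo, hpq, hhi, -, -, rfl⟩ := h
    rw [swap_trans_apply]
    split_ifs
    · exact ⟨hlo.trans hpq.le, hhi⟩
    · exact ⟨hlo, hpq.le.trans hhi⟩
    · exact ih

theorem Step.mono {u' v' lo' hi' : Fin n} (h : Step E u' v' lo' hi' T T')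
    (hu : ReflTransGen E u u') (hv : ReflTransGen E v' v) (hlo : lo ≤ lo') (hhi : hi' ≤ hi) :
    Step E u v lo hi T T' := by
  obtain ⟨x, y, h1, h2, h3, h4, h5, h6⟩ := h
  exact ⟨x, y, hu.trans h1, h2.trans hv, hlo.trans h3, h4, h5.trans hhi, h6⟩

theorem Steps.mono {u' v' lo' hi' : Fin n} (h : Steps E u' v' lo' hi' T T')
    (hu : ReflTransGen E u u') (hv : ReflTransGen E v' v) (hlo : lo ≤ lo') (hhi : hi' ≤ hi) :
    Steps E u v lo hi T T' := by
  induction h with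
  | refl => exact .refl
  | tail _ h ih => exact ih.tail (h.mono hu hv hlo hhi)

/-- If `u` has no out-neighbour at a position up to `m`, then it moves beyond `m` in order to get
past `v`. -/
theorem Steps.lt_left (h : Steps E u v lo hi T T') (hT : Topo E T) (hac : ¬ ReflTransGen E u v)
    {m : ℕ} (hu : ∀ w, E u w → m < T w) (hv : m < T v) (hf : T' v < T' u) : m < T' u := by
  -- The disjunction is invariant under exchanges. If v is exchanged with u, then u takes the place
  -- of v beyond `m`. Any other partner of v is a proper descendant of u, so it lies at or after an
  -- out-neighbour of u, and v lands beyond `m` again. Once u is beyond `m` it never moves back.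
  suffices H : m < T' v ∨ m < T' u by
    rcases H with H | H
    · exact H.trans hf
    · exact H
  clear hf
  induction h with
  | refl => exact Or.inl hv
  | @tail T₁ T₂ h₁ h ih =>
    have h₂ : Steps E u v lo hi T₁ T₂ := ReflTransGen.single h
    rcases ih with ih | ih
    · obtain ⟨x, y, hx, hy, hlo, hxy, hhi, -, -, rfl⟩ := h
      simp only [swap_trans_apply]
      by_cases cv : v = y
      · subst cv
        by_cases cu : u = x
        · right; simp [cu]; exact ih
        · left
          have hvx : v ≠ x := by rintro rfl; exact lt_irrefl _ hxy
          simp only [hvx, if_false, if_true]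
          have h3 : T x ≤ T₁ x := Steps.le_left h₁ hac hx
          rcases ReflTransGen.cases_head hx with rfl | ⟨w, hw, hwx⟩
          · exact absurd rfl cu
          · exact (hu w hw).trans_le ((hT.le hwx).trans h3)
      · left
        have hvx : v ≠ x := by rintro rfl; exact hac hx
        simpa [cv, hvx] using ih
    · exact Or.inr (ih.trans_le (h₂.le_left hac .refl))

/-- If `v` has no in-neighbour at a position from `m` on, then it moves before `m` in order to get
past `u`. -/
theorem Steps.lt_right (h : Steps E u v lo hi T T') (hT : Topo E T) (hac : ¬ ReflTransGen E u v)
    {m : ℕ} (hv : ∀ w, E w v → T w < m) (hu : T u < m) (hf : T' v < T' u) : T' v < m := by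
  suffices H : T' u < m ∨ T' v < m by
    rcases H with H | H
    · exact lt_trans (Fin.lt_def.mp hf) H
    · exact H
  clear hf
  induction h with
  | refl => exact Or.inl hu
  | @tail T₁ T₂ h₁ h ih =>
    have h₂ : Steps E u v lo hi T₁ T₂ := ReflTransGen.single h
    rcases ih with ih | ih
    · obtain ⟨x, y, hx, hy, hlo, hxy, hhi, -, -, rfl⟩ := h
      simp only [swap_trans_apply]
      by_cases cu : u = x
      · subst cu
        have huy : u ≠ y := by rintro rfl; exact lt_irrefl _ hxy
        by_cases cv : v = y
        · right
          have hvu : v ≠ u := by rintro rfl; exact huy cv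
          simp only [cv, if_true, huy.symm, if_false]; exact ih
        · left
          simp only [if_true]
          have h3 : T₁ y ≤ T y := Steps.le_right h₁ hac hy
          rcases ReflTransGen.cases_tail hy with rfl | ⟨w, hwy, hw⟩
          · exact absurd rfl cv
          · exact lt_of_le_of_lt (Fin.le_def.mp (h3.trans (hT.le hwy))) (hv w hw)
      · left
        have huy : u ≠ y := by rintro rfl; exact hac hy
        simpa [cu, huy] using ih
    · exact Or.inr (lt_of_le_of_lt (Fin.le_def.mp (h₂.le_right hac .refl)) ih)

end Steps

/-! ### Settled pairs and the potential at a given scale. -/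

section Potentials

variable {n : ℕ}

/-- The relation `r`, which contains the edges `E`, relates the ancestors of `v` to the descendants
of `u`, and beyond these it is given by `E`. -/
structure Crossing (E r : Fin n → Fin n → Prop) (u v : Fin n) : Prop where
  acyclic : ¬ ReflTransGen E u v
  cross : ∀ x y, ReflTransGen E u x → ReflTransGen E y v → r y x
  left : ∀ x z, ReflTransGen E u x → r x z → ReflTransGen E x z
  right : ∀ z y, ReflTransGen E y v → r z y → ReflTransGen E z y

theorem Crossing.mono {E r : Fin n → Fin n → Prop} {u v u' v' : Fin n} (h : Crossing E r u v)
    (hu : ReflTransGen E u u') (hv : ReflTransGen E v' v) : Crossing E r u' v' where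
  acyclic := fun h' => h.acyclic ((hu.trans h').trans hv)
  cross := fun x y hx hy => h.cross x y (hu.trans hx) (hy.trans hv)
  left := fun x z hx => h.left x z (hu.trans hx)
  right := fun z y hy => h.right z y (hy.trans hv)

open Classical in
/-- The pairs related by `r` which `T` puts in the right order. -/
noncomputable def settled (r : Fin n → Fin n → Prop) (T : Fin n ≃ Fin n) :
    Finset (Fin n × Fin n) :=
  Finset.univ.filter fun p => r p.1 p.2 ∧ T p.1 < T p.2

open Classical in
/-- The settled pairs whose distance in `S` is at most `n / √t`. -/
noncomputable def nearSettled (r : Fin n → Fin n → Prop) (S : Fin n ≃ Fin n) (t : ℝ)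
    (T : Fin n ≃ Fin n) : Finset (Fin n × Fin n) :=
  (settled r T).filter fun p => (((S p.2 : ℕ) : ℝ) - (S p.1 : ℕ)) * √t ≤ n

/-- The potential that pays for the exchanges over a distance of at most `t`. -/
noncomputable def potential (r : Fin n → Fin n → Prop) (S : Fin n ≃ Fin n) (t : ℝ)
    (T : Fin n ≃ Fin n) : ℝ :=
  t * (nearSettled r S t T).card + √t / n * ∑ x, ((S x : ℕ) : ℝ) * (T x : ℕ)

variable {E r : Fin n → Fin n → Prop} {u v lo hi : Fin n} {T T' S : Fin n ≃ Fin n}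

theorem mem_settled {p : Fin n × Fin n} : p ∈ settled r T ↔ r p.1 p.2 ∧ T p.1 < T p.2 := by
  simp [settled]

/-- Only pairs that start at x or end at y could be spoilt. By `Crossing`, for these pairs `r` is
reachability by old edges, so the pair passes through an out-neighbour of x, which lies beyond y, or
through an in-neighbour of y, which lies before x. -/
theorem swap_settled (hC : Crossing E r u v) (hT : Topo E T) {x y : Fin n}
    (hx : ReflTransGen E u x) (hy : ReflTransGen E y v) (hxy : T x < T y)
    (h1 : ClearOut E T x y) (h2 : ClearIn E T x y) :
    settled r T ⊆ settled r ((Equiv.swap x y).trans T) ∧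
      (y, x) ∉ settled r T ∧ (y, x) ∈ settled r ((Equiv.swap x y).trans T) := by
  refine ⟨?_, fun h => (mem_settled.mp h).2.not_gt hxy, ?_⟩
  · rintro ⟨p, q⟩ h
    rw [mem_settled] at h ⊢
    obtain ⟨hr, hlt⟩ := h
    refine ⟨hr, ?_⟩
    dsimp only at hr hlt ⊢
    have hA : p = x → T y < T q := by
      rintro rfl
      rcases ReflTransGen.cases_head (hC.left p q hx hr) with rfl | ⟨w, hw, hwq⟩
      · exact absurd hlt (lt_irrefl _)
      · exact (h1 w hw).trans_le (hT.le hwq)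
    have hB : q = y → T p < T x := by
      rintro rfl
      rcases ReflTransGen.cases_tail (hC.right p q hy hr) with rfl | ⟨w, hwq, hw⟩
      · exact absurd hlt (lt_irrefl _)
      · exact (hT.le hwq).trans_lt (h2 w hw)
    simp only [swap_trans_apply]
    split_ifs with c1 c2 c3 c4 c5 c6 c7 c8
    · subst c1 c2; exact absurd hlt (lt_irrefl _)
    · subst c3; exact absurd (hA c1) (lt_irrefl _)
    · exact hA c1
    · exact hxy
    · subst c4 c6; exact absurd hlt (lt_irrefl _)
    · subst c4; exact hxy.trans hlt
    · subst c7; exact hlt.trans hxy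
    · exact hB c8
    · exact hlt
  · rw [mem_settled]
    refine ⟨hC.cross x y hx hy, ?_⟩
    simp [hxy]

theorem Step.card_settled_lt (h : Step E u v lo hi T T') (hC : Crossing E r u v)
    (hT : Topo E T) : (settled r T).card + 1 ≤ (settled r T').card := by
  obtain ⟨x, y, hx, hy, -, hxy, -, h1, h2, rfl⟩ := h
  obtain ⟨ha, hb, hc⟩ := swap_settled hC hT hx hy hxy h1 h2
  exact Finset.card_lt_card ⟨ha, fun h => hb (h hc)⟩

theorem Steps.card_settled_le (h : Steps E u v lo hi T T') (hC : Crossing E r u v)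
    (hT : Topo E T) : (settled r T).card ≤ (settled r T').card := by
  induction h with
  | refl => exact le_rfl
  | tail h₁ h ih => have := h.card_settled_lt hC (Steps.topo h₁ hT); omega

theorem Steps.card_settled_lt (h : Steps E u v lo hi T T') (hC : Crossing E r u v)
    (hT : Topo E T) (hne : T ≠ T') : (settled r T).card + 1 ≤ (settled r T').card := by
  rcases ReflTransGen.cases_head h with h | ⟨T₁, h₁, h₂⟩
  · exact absurd h hne
  · exact (h₁.card_settled_lt hC hT).trans (Steps.card_settled_le h₂ hC (h₁.topo hT))

/-- The rearrangement identity: the correlation of the two orders changes by the product of the two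
distances. -/
theorem sum_swap (x y : Fin n) (hxy : x ≠ y) (S T : Fin n ≃ Fin n) :
    ∑ z, ((S z : ℕ) : ℝ) * ((Equiv.swap x y).trans T z : ℕ) =
      ∑ z, ((S z : ℕ) : ℝ) * (T z : ℕ) +
        (((S x : ℕ) : ℝ) - (S y : ℕ)) * (((T y : ℕ) : ℝ) - (T x : ℕ)) := by
  rw [← sub_eq_iff_eq_add', ← Finset.sum_sub_distrib]
  have hsub : ∑ z, (((S z : ℕ) : ℝ) * ((Equiv.swap x y).trans T z : ℕ) -
      ((S z : ℕ) : ℝ) * (T z : ℕ)) =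
      ∑ z ∈ {x, y}, (((S z : ℕ) : ℝ) * ((Equiv.swap x y).trans T z : ℕ) -
      ((S z : ℕ) : ℝ) * (T z : ℕ)) := by
    symm
    apply Finset.sum_subset (Finset.subset_univ _)
    intro z _ hz
    simp only [Finset.mem_insert, Finset.mem_singleton, not_or] at hz
    rw [swap_trans_apply, if_neg hz.1, if_neg hz.2, sub_self]
  rw [hsub, Finset.sum_pair hxy]
  simp
  ring

/-- Since `r` relates y to x, the final order `S` has y before x, so the exchange increases the
correlation, and it settles one further pair. Neither term of the potential can fall; inside a
window of length at most t, one of them grows by the whole distance of the exchange. -/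
theorem Step.potential_le (h : Step E u v lo hi T T') (hC : Crossing E r u v) (hT : Topo E T)
    (hS : ∀ p q, r p q → S p < S q) {t : ℝ} (ht : 0 < t) :
    potential r S t T ≤ potential r S t T' ∧
      (((hi : ℕ) : ℝ) - (lo : ℕ) ≤ t → ∀ z, |((T' z : ℕ) : ℝ) - (T z : ℕ)| ≤
        potential r S t T' - potential r S t T) := by
  obtain ⟨x, y, hx, hy, hlo, hxy, hhi, h1, h2, rfl⟩ := h
  obtain ⟨ha, hb, hc⟩ := swap_settled hC hT hx hy hxy h1 h2
  have hn : (0 : ℝ) < n := by exact_mod_cast x.pos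
  have hne : x ≠ y := by rintro rfl; exact lt_irrefl _ hxy
  have hd : (0 : ℝ) < ((T y : ℕ) : ℝ) - (T x : ℕ) := by
    rw [sub_pos]; exact_mod_cast hxy
  have hδ : (0 : ℝ) < ((S x : ℕ) : ℝ) - (S y : ℕ) := by
    rw [sub_pos]; exact_mod_cast hS _ _ (hC.cross x y hx hy)
  have hsub : nearSettled r S t T ⊆ nearSettled r S t ((Equiv.swap x y).trans T) := by
    classical
    exact Finset.filter_subset_filter _ ha
  have hcard : ((nearSettled r S t T).card : ℝ) ≤
      (nearSettled r S t ((Equiv.swap x y).trans T)).card := by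
    exact_mod_cast Finset.card_le_card hsub
  have hs : 0 < √t := Real.sqrt_pos.mpr ht
  have hquad : 0 ≤ √t / n * ((((S x : ℕ) : ℝ) - (S y : ℕ)) * (((T y : ℕ) : ℝ) - (T x : ℕ))) := by
    positivity
  have hdiff : potential r S t ((Equiv.swap x y).trans T) - potential r S t T =
      t * ((nearSettled r S t ((Equiv.swap x y).trans T)).card - (nearSettled r S t T).card) +
      √t / n * ((((S x : ℕ) : ℝ) - (S y : ℕ)) * (((T y : ℕ) : ℝ) - (T x : ℕ))) := by
    unfold potential
    rw [sum_swap x y hne]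
    ring
  have hmono : 0 ≤ t * (((nearSettled r S t ((Equiv.swap x y).trans T)).card : ℝ) -
      (nearSettled r S t T).card) := mul_nonneg ht.le (sub_nonneg.mpr hcard)
  refine ⟨by linarith, fun htd z => ?_⟩
  have hkey : ((T y : ℕ) : ℝ) - (T x : ℕ) ≤
      potential r S t ((Equiv.swap x y).trans T) - potential r S t T := by
    rw [hdiff]
    -- A pair near in `S` is a new element of `nearSettled`, worth t. For a far pair, the factor
    -- √t/n times the `S`-distance exceeds one.
    by_cases hnear : (((S x : ℕ) : ℝ) - (S y : ℕ)) * √t ≤ n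
    · have hlt : (nearSettled r S t T).card <
          (nearSettled r S t ((Equiv.swap x y).trans T)).card := by
        apply Finset.card_lt_card
        refine ⟨hsub, fun h => hb ?_⟩
        classical
        exact (Finset.mem_filter.mp (h (Finset.mem_filter.mpr ⟨hc, hnear⟩))).1
      have hlt' : ((nearSettled r S t T).card : ℝ) + 1 ≤
          (nearSettled r S t ((Equiv.swap x y).trans T)).card := by exact_mod_cast hlt
      have h3 : ((T y : ℕ) : ℝ) - (T x : ℕ) ≤ t := by
        have e1 : ((lo : ℕ) : ℝ) ≤ (T x : ℕ) := by exact_mod_cast hlo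
        have e2 : ((T y : ℕ) : ℝ) ≤ (hi : ℕ) := by exact_mod_cast hhi
        linarith
      nlinarith
    · push Not at hnear
      have h4 : 1 ≤ √t / n * (((S x : ℕ) : ℝ) - (S y : ℕ)) := by
        rw [div_mul_eq_mul_div, le_div_iff₀ hn]; linarith
      have h5 : ((T y : ℕ) : ℝ) - (T x : ℕ) ≤
          √t / n * ((((S x : ℕ) : ℝ) - (S y : ℕ)) * (((T y : ℕ) : ℝ) - (T x : ℕ))) := by
        rw [← mul_assoc]
        exact le_mul_of_one_le_left hd.le h4
      linarith
  refine le_trans ?_ hkey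
  rw [swap_trans_apply]
  split_ifs with c1 c2
  · subst c1; rw [abs_of_pos hd]
  · subst c2; rw [abs_sub_comm, abs_of_pos hd]
  · simpa using hd.le

theorem Steps.potential_le (h : Steps E u v lo hi T T') (hC : Crossing E r u v) (hT : Topo E T)
    (hS : ∀ p q, r p q → S p < S q) {t : ℝ} (ht : 0 < t) :
    potential r S t T ≤ potential r S t T' := by
  induction h with
  | refl => exact le_rfl
  | tail h₁ h ih => exact ih.trans (h.potential_le hC (Steps.topo h₁ hT) hS ht).1

/-- It is enough to add up the movements of a single vertex, by the triangle inequality; the growth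
of the potential telescopes. -/
theorem Steps.abs_sub_le (h : Steps E u v lo hi T T') (hC : Crossing E r u v) (hT : Topo E T)
    (hS : ∀ p q, r p q → S p < S q) {t : ℝ} (ht : 0 < t)
    (hd : ((hi : ℕ) : ℝ) - (lo : ℕ) ≤ t) (z : Fin n) :
    |((T' z : ℕ) : ℝ) - (T z : ℕ)| ≤ potential r S t T' - potential r S t T := by
  induction h with
  | refl => simp
  | @tail T₁ T₂ h₁ h ih =>
    have := (h.potential_le hC (Steps.topo h₁ hT) hS ht).2 hd z
    calc |((T₂ z : ℕ) : ℝ) - (T z : ℕ)|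
        ≤ |((T₂ z : ℕ) : ℝ) - (T₁ z : ℕ)| + |((T₁ z : ℕ) : ℝ) - (T z : ℕ)| := _root_.abs_sub_le _ _ _
      _ ≤ _ := by linarith

theorem card_settled_le_sq (r : Fin n → Fin n → Prop) (T : Fin n ≃ Fin n) :
    (settled r T).card ≤ n ^ 2 := by
  have := Finset.card_le_univ (settled r T)
  simpa [sq] using this

theorem settled_mono {r' : Fin n → Fin n → Prop} (h : ∀ p q, r p q → r' p q) :
    settled r T ⊆ settled r' T := fun p hp => by
  rw [mem_settled] at hp ⊢; exact ⟨h _ _ hp.1, hp.2⟩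

/-- Inserting an edge enlarges `r`. As this cannot lower the potential, the growths during the
individual insertions add up to at most the final value. -/
theorem potential_mono {r' : Fin n → Fin n → Prop} (h : ∀ p q, r p q → r' p q) {t : ℝ}
    (ht : 0 < t) : potential r S t T ≤ potential r' S t T := by
  have : nearSettled r S t T ⊆ nearSettled r' S t T := by
    classical
    exact Finset.filter_subset_filter _ (settled_mono h)
  have hc : ((nearSettled r S t T).card : ℝ) ≤ (nearSettled r' S t T).card := by
    exact_mod_cast Finset.card_le_card this
  unfold potential
  gcongr

theorem potential_nonneg {t : ℝ} (ht : 0 < t) : 0 ≤ potential r S t T := by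
  unfold potential
  positivity

/-- Each vertex begins at most n/√t near pairs, worth t each, and the correlation is at most n³. The
threshold n/√t is the one that makes both contributions n²√t. -/
theorem potential_le (hS : ∀ p q, r p q → S p < S q) {t : ℝ} (ht : 0 < t) :
    potential r S t T ≤ 2 * ((n : ℝ) ^ 2 * √t) := by
  rcases Nat.eq_zero_or_pos n with rfl | hn
  · have : (nearSettled r S t T) = ∅ := Finset.eq_empty_of_forall_notMem (fun p => p.1.elim0)
    simp [potential, this]
  have hn' : (0 : ℝ) < n := by exact_mod_cast hn
  have hs : 0 < √t := Real.sqrt_pos.mpr ht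
  have h1 : (nearSettled r S t T).card ≤ n * ⌊n / √t⌋₊ := by
    classical
    have : (nearSettled r S t T).card ≤
        ((Finset.univ : Finset (Fin n)) ×ˢ Finset.range ⌊n / √t⌋₊).card := by
      -- A near pair is encoded by its first vertex and its `S`-distance. The distance is at least
      -- one, and subtracting one fits it into the range.
      apply Finset.card_le_card_of_injOn (fun p => (p.1, (S p.2 : ℕ) - S p.1 - 1))
      · rintro ⟨p, q⟩ hp
        obtain ⟨ha, hb⟩ := Finset.mem_filter.mp hp
        have hlt := hS _ _ (mem_settled.mp ha).1
        dsimp only at hb hlt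
        simp only [Finset.coe_product, Finset.coe_univ, Set.mem_prod, Set.mem_univ, true_and,
          Finset.coe_range, Set.mem_Iio]
        have hlt' : (S p : ℕ) < S q := hlt
        have : (S q : ℕ) - S p ≤ ⌊n / √t⌋₊ := by
          apply Nat.le_floor
          rw [le_div_iff₀ hs, Nat.cast_sub hlt'.le]
          exact hb
        omega
      · rintro ⟨p, q⟩ hp ⟨p', q'⟩ hp' heq
        have hlt : (S p : ℕ) < S q := hS _ _ (mem_settled.mp (Finset.mem_filter.mp hp).1).1
        have hlt' : (S p' : ℕ) < S q' := hS _ _ (mem_settled.mp (Finset.mem_filter.mp hp').1).1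
        simp only [Prod.mk.injEq] at heq
        obtain ⟨rfl, h⟩ := heq
        have : S q = S q' := Fin.ext (by omega)
        rw [S.injective this]
    simpa using this
  have h2 : t * (nearSettled r S t T).card ≤ (n : ℝ) ^ 2 * √t := by
    have e1 : ((nearSettled r S t T).card : ℝ) ≤ n * (n / √t) := by
      calc ((nearSettled r S t T).card : ℝ) ≤ n * (⌊n / √t⌋₊ : ℝ) := by exact_mod_cast h1
        _ ≤ _ := by gcongr; exact Nat.floor_le (by positivity)
    calc t * ((nearSettled r S t T).card : ℝ) ≤ t * (n * (n / √t)) := by gcongr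
      _ = (n : ℝ) ^ 2 * (t / √t) := by ring
      _ = _ := by rw [Real.div_sqrt]
  have h3 : ∑ x, ((S x : ℕ) : ℝ) * (T x : ℕ) ≤ (n : ℝ) ^ 3 := by
    calc ∑ x, ((S x : ℕ) : ℝ) * (T x : ℕ) ≤ ∑ _x : Fin n, (n : ℝ) * n := by
          apply Finset.sum_le_sum
          intro x _
          have e1 : ((S x : ℕ) : ℝ) ≤ n := by exact_mod_cast (S x).2.le
          have e2 : ((T x : ℕ) : ℝ) ≤ n := by exact_mod_cast (T x).2.le
          gcongr
      _ = _ := by simp; ring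
  have h4 : √t / n * ∑ x, ((S x : ℕ) : ℝ) * (T x : ℕ) ≤ (n : ℝ) ^ 2 * √t := by
    calc √t / n * ∑ x, ((S x : ℕ) : ℝ) * (T x : ℕ) ≤ √t / n * (n : ℝ) ^ 3 := by gcongr
      _ = _ := by field_simp
  unfold potential
  linarith

end Potentials

/-! ### Running the loops that update the pails. -/

section Programs

variable {n : ℕ}

/-- The program `x`, started in memory `s`, returns `a` and leaves the memory `s'`. -/
def Runs {α : Type} (x : Prog n α) (s : Mem n) (a : α) (s' : Mem n) : Prop :=
  x.run s = some (a, s')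

theorem Runs.bind {α β : Type} {x : Prog n α} {f : α → Prog n β} {s s' s'' : Mem n} {a : α} {b : β}
    (h : Runs x s a s') (h' : Runs (f a) s' b s'') : Runs (x >>= f) s b s'' := by
  unfold Runs at *
  rw [StateT.run_bind, h]
  exact h'

theorem Runs.get (s : Mem n) : Runs (MonadState.get : Prog n (Mem n)) s s s := rfl

theorem Runs.timed {α : Type} (x : Timed α) (s : Mem n) :
    Runs (timed x) s x.ret { s with clock := s.clock + x.time } := rfl

theorem Runs.tick (k : ℕ) (s : Mem n) : Runs (tick k) s () { s with clock := s.clock + k } := rfl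

theorem update_update_apply {α : Type} (f : Fin n → ℕ → α) (u : Fin n) (i : ℕ) (a : α) (x : Fin n)
    (j : ℕ) : Function.update f u (Function.update (f u) i a) x j =
      if x = u ∧ j = i then a else f x j := by
  by_cases hx : x = u
  · subst hx
    by_cases hj : j = i
    · subst hj; simp
    · simp [hj]
  · simp [hx]

/-- The memory `s` stores the edges `E` and the order `T`, and its pails are balanced search trees
with the entries `O x j z`, for vertices `x`, `z` and levels `j`. -/
structure View (E : Fin n → Fin n → Prop) (O : Fin n → ℕ → Fin n → Prop) (T : Fin n ≃ Fin n)
    (s : Mem n) : Prop where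
  pos : s.pos = T
  outAdj : ∀ x z, s.outAdj x z = true ↔ E x z
  inAdj : ∀ x z, s.inAdj z x = true ↔ E x z
  outBalanced : ∀ x j, (s.outPail x j).IsBalanced
  inBalanced : ∀ x j, (s.inPail x j).IsBalanced
  out : ∀ x j z, z ∈ (s.outPail x j).toList ↔ O x j z
  inn : ∀ x j z, x ∈ (s.inPail z j).toList ↔ O x j z

variable {E : Fin n → Fin n → Prop} {O : Fin n → ℕ → Fin n → Prop} {T : Fin n ≃ Fin n} {s : Mem n}

theorem View.congr {O' : Fin n → ℕ → Fin n → Prop} (h : View E O T s)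
    (hO : ∀ x j z, O x j z ↔ O' x j z) : View E O' T s :=
  { h with
    out := fun x j z => (h.out x j z).trans (hO x j z)
    inn := fun x j z => (h.inn x j z).trans (hO x j z) }

theorem View.setClock (h : View E O T s) (k : ℕ) : View E O T { s with clock := k } :=
  ⟨h.pos, h.outAdj, h.inAdj, h.outBalanced, h.inBalanced, h.out, h.inn⟩

/-- The cost of an operation on both pails that an edge belongs to. -/
def pairCost (n : ℕ) : ℕ := 2 * (SearchTree.maxHeight n + 1)

/-- The view after replacing two pails. -/
theorem View.update (h : View E O T s) {O' : Fin n → ℕ → Fin n → Prop} (x z : Fin n) (i : ℕ)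
    (t t' : SearchTree (Fin n)) (c : ℕ) (ht : t.IsBalanced) (ht' : t'.IsBalanced)
    (hO : ∀ a j b, ¬ (a = x ∧ j = i ∧ b = z) → (O' a j b ↔ O a j b))
    (hx : ∀ b, b ∈ t.toList ↔ O' x i b) (hz : ∀ a, a ∈ t'.toList ↔ O' a i z) :
    View E O' T { s with
      outPail := Function.update s.outPail x (Function.update (s.outPail x) i t)
      inPail := Function.update s.inPail z (Function.update (s.inPail z) i t')
      clock := c } where
  pos := h.pos
  outAdj := h.outAdj
  inAdj := h.inAdj
  outBalanced a j := by
    simp only [update_update_apply]; split_ifs; exacts [ht, h.outBalanced a j]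
  inBalanced a j := by
    simp only [update_update_apply]; split_ifs; exacts [ht', h.inBalanced a j]
  out a j b := by
    simp only [update_update_apply]
    split_ifs with c
    · obtain ⟨rfl, rfl⟩ := c; exact hx b
    · rw [h.out, hO]; tauto
  inn a j b := by
    simp only [update_update_apply]
    split_ifs with c
    · obtain ⟨rfl, rfl⟩ := c; exact hz a
    · rw [h.inn, hO]; tauto

/-- The algorithm updates the two pails of an edge in either order, depending on the loop; hence the
two conjuncts. -/
theorem View.insertPair (h : View E O T s) (x z : Fin n) (i : ℕ) :
    (∃ s', Runs (do outPailInsert x i z; inPailInsert z i x : Prog n Unit) s () s' ∧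
      View E (fun a j b => O a j b ∨ (a = x ∧ j = i ∧ b = z)) T s' ∧
      s'.clock ≤ s.clock + pairCost n) ∧
    (∃ s', Runs (do inPailInsert z i x; outPailInsert x i z : Prog n Unit) s () s' ∧
      View E (fun a j b => O a j b ∨ (a = x ∧ j = i ∧ b = z)) T s' ∧
      s'.clock ≤ s.clock + pairCost n) := by
  have h1 := (h.outBalanced x i).time_insert_le z
  have h2 := (h.inBalanced z i).time_insert_le x
  have key : ∀ c, View E (fun a j b => O a j b ∨ (a = x ∧ j = i ∧ b = z)) T { s with
      outPail := Function.update s.outPail x (Function.update (s.outPail x) i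
        (SearchTree.insert z (s.outPail x i)).ret)
      inPail := Function.update s.inPail z (Function.update (s.inPail z) i
        (SearchTree.insert x (s.inPail z i)).ret)
      clock := c } := fun c => by
    refine h.update x z i _ _ c ((h.outBalanced x i).insert z) ((h.inBalanced z i).insert x)
      ?_ ?_ ?_
    · intro a j b; tauto
    · intro b; rw [SearchTree.mem_insert, h.out]; simp
    · intro a; rw [SearchTree.mem_insert, h.inn]; simp
  refine ⟨⟨_, rfl, key _, ?_⟩, ⟨_, rfl, key _, ?_⟩⟩
  · change s.clock + (SearchTree.insert z (s.outPail x i)).time +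
      (SearchTree.insert x (s.inPail z i)).time ≤ _
    unfold pairCost; omega
  · change s.clock + (SearchTree.insert x (s.inPail z i)).time +
      (SearchTree.insert z (s.outPail x i)).time ≤ _
    unfold pairCost; omega

theorem View.deletePair (h : View E O T s) (x z : Fin n) (i : ℕ) :
    (∃ s', Runs (do outPailDelete x i z; inPailDelete z i x : Prog n Unit) s () s' ∧
      View E (fun a j b => O a j b ∧ ¬ (a = x ∧ j = i ∧ b = z)) T s' ∧
      s'.clock ≤ s.clock + pairCost n) ∧
    (∃ s', Runs (do inPailDelete z i x; outPailDelete x i z : Prog n Unit) s () s' ∧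
      View E (fun a j b => O a j b ∧ ¬ (a = x ∧ j = i ∧ b = z)) T s' ∧
      s'.clock ≤ s.clock + pairCost n) := by
  have h1 := (h.outBalanced x i).time_delete_le z
  have h2 := (h.inBalanced z i).time_delete_le x
  have key : ∀ c, View E (fun a j b => O a j b ∧ ¬ (a = x ∧ j = i ∧ b = z)) T { s with
      outPail := Function.update s.outPail x (Function.update (s.outPail x) i
        (SearchTree.delete z (s.outPail x i)).ret)
      inPail := Function.update s.inPail z (Function.update (s.inPail z) i
        (SearchTree.delete x (s.inPail z i)).ret)
      clock := c } := fun c => by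
    refine h.update x z i _ _ c ((h.outBalanced x i).delete z) ((h.inBalanced z i).delete x)
      ?_ ?_ ?_
    · intro a j b; tauto
    · intro b; rw [SearchTree.mem_delete _ _ (h.outBalanced x i).2, h.out]; simp
    · intro a; rw [SearchTree.mem_delete _ _ (h.inBalanced z i).2, h.inn]; simp
  refine ⟨⟨_, rfl, key _, ?_⟩, ⟨_, rfl, key _, ?_⟩⟩
  · change s.clock + (SearchTree.delete z (s.outPail x i)).time +
      (SearchTree.delete x (s.inPail z i)).time ≤ _
    unfold pairCost; omega
  · change s.clock + (SearchTree.delete x (s.inPail z i)).time +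
      (SearchTree.delete z (s.outPail x i)).time ≤ _
    unfold pairCost; omega

/-- Invariant of a loop. -/
theorem runs_forM {α : Type} (M : List α → Mem n → Prop) (f : α → Prog n Unit)
    (l : List α) (s : Mem n)
    (step : ∀ l₁ a l₂ s, l = l₁ ++ a :: l₂ → M l₁ s → ∃ s', Runs (f a) s () s' ∧ M (l₁ ++ [a]) s')
    (h0 : M [] s) : ∃ s', Runs (l.forM f) s () s' ∧ M l s' := by
  suffices H : ∀ (l₂ l₁ : List α) (s : Mem n), l = l₁ ++ l₂ → M l₁ s →
      ∃ s', Runs (l₂.forM f) s () s' ∧ M l s' from H l [] s rfl h0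
  intro l₂
  induction l₂ with
  | nil => intro l₁ s hl hM; simp only [List.append_nil] at hl; subst hl; exact ⟨s, rfl, hM⟩
  | cons a l₂ ih =>
    intro l₁ s hl hM
    obtain ⟨s₁, r1, m1⟩ := step l₁ a l₂ s hl hM
    obtain ⟨s₂, r2, m2⟩ := ih (l₁ ++ [a]) s₁ (by simp [hl]) m1
    exact ⟨s₂, r1.bind r2, m2⟩

/-- Invariant of a loop with at most `k` steps in each round. -/
theorem runs_forM_time {α : Type} (M : List α → Mem n → Prop) (k : ℕ) (f : α → Prog n Unit)
    (l : List α) (s : Mem n)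
    (step : ∀ l₁ a l₂ s, l = l₁ ++ a :: l₂ → M l₁ s →
      ∃ s', Runs (f a) s () s' ∧ M (l₁ ++ [a]) s' ∧ s'.clock ≤ s.clock + k)
    (h0 : M [] s) :
    ∃ s', Runs (l.forM f) s () s' ∧ M l s' ∧ s'.clock ≤ s.clock + l.length * k := by
  refine runs_forM (fun l s' => M l s' ∧ s'.clock ≤ s.clock + l.length * k) f l s ?_ ⟨h0, by simp⟩
  rintro l₁ a l₂ s₁ hl ⟨hM, hc⟩
  obtain ⟨s', h1, h2, h3⟩ := step l₁ a l₂ s₁ hl hM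
  refine ⟨s', h1, h2, ?_⟩
  rw [List.length_append, add_mul, List.length_singleton]
  omega

/-- The invariant is indexed by the next position to be visited. The final index `max a (min b n)`
covers ranges that are empty or stick out beyond n. -/
theorem runs_forPositions {a b : ℕ} {f : Fin n → Prog n Unit} {k : ℕ} (M : ℕ → Mem n → Prop)
    (hpos : ∀ q s, M q s → s.pos = T)
    (hclock : ∀ q s c, M q s → M q { s with clock := c })
    (step : ∀ w s, a ≤ T w → T w < b → M (T w) s →
      ∃ s', Runs (f w) s () s' ∧ M (T w + 1) s' ∧ s'.clock ≤ s.clock + k)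
    (h0 : M a s) :
    ∃ s', Runs (forPositions a b f) s () s' ∧ M (max a (min b n)) s' ∧
      s'.clock ≤ s.clock + (b - a) * (k + 1) := by
  obtain ⟨s', r, m, c⟩ := runs_forM_time (fun l s => M (a + l.length) s) (k + 1)
    (fun q => do
      tick 1
      let s ← get
      if h : q < n then f (s.pos.symm ⟨q, h⟩) else Pure.pure ()) (List.Ico a (min b n)) s (by
    intro l₁ q l₂ s hl hM
    have hlen : l₁.length < (List.Ico a (min b n)).length := by rw [hl]; simp
    have hq : q = a + l₁.length := by
      have : (List.Ico a (min b n))[l₁.length]'hlen = q := by simp [hl]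
      rw [← this]
      simp [List.Ico]
    rw [List.Ico.length] at hlen
    have hqn : q < n := by omega
    have hw : ((T (T.symm ⟨q, hqn⟩) : Fin n) : ℕ) = q := by simp
    obtain ⟨s', r, m, c⟩ := step (T.symm ⟨q, hqn⟩) { s with clock := s.clock + 1 } (by omega)
      (by omega) (by rw [hw, hq]; exact hclock _ _ _ hM)
    refine ⟨s', ?_, ?_, ?_⟩
    · refine (Runs.tick 1 s).bind ((Runs.get _).bind ?_)
      rw [dif_pos hqn]
      have : s.pos = T := hpos _ _ hM
      simpa [this] using r
    · rw [hw] at m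
      simpa [hq, add_assoc] using m
    · dsimp only at c; omega) (by simpa using h0)
  refine ⟨s', r, ?_, ?_⟩
  · have e : a + (List.Ico a (min b n)).length = max a (min b n) := by
      rw [List.Ico.length]; omega
    rwa [e] at m
  · refine c.trans ?_
    rw [List.Ico.length]
    have : min b n - a ≤ b - a := by omega
    have := Nat.mul_le_mul_right (k + 1) this
    omega

/-- The maps `ex` and `ez` give the ends of the entry that is treated when w is visited; one of them
is constant in each use. This covers edges into u and edges out of v at once. -/
theorem View.deleteLoop (h : View E O T s) {a b i k : ℕ} {f : Fin n → Prog n Unit}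
    (ex ez : Fin n → Fin n)
    (hf : ∀ w s (O : Fin n → ℕ → Fin n → Prop), View E O T s → ∃ s', Runs (f w) s () s' ∧
      View E (fun x j z => O x j z ∧ ¬ (x = ex w ∧ j = i ∧ z = ez w)) T s' ∧
      s'.clock ≤ s.clock + k) :
    ∃ s', Runs (forPositions a b f) s () s' ∧
      View E (fun x j z => O x j z ∧
        ¬ (j = i ∧ ∃ w, a ≤ T w ∧ T w < b ∧ x = ex w ∧ z = ez w)) T s' ∧
      s'.clock ≤ s.clock + (b - a) * (k + 1) := by
  obtain ⟨s', r, m, c⟩ := runs_forPositions (T := T) (s := s) (a := a) (b := b) (f := f) (k := k)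
    (fun q => View E (fun x j z => O x j z ∧
        ¬ (j = i ∧ ∃ w, a ≤ T w ∧ T w < q ∧ x = ex w ∧ z = ez w)) T)
    (fun _ _ h => h.pos) (fun _ _ _ h => h.setClock _) (by
      intro w s ha hb hV
      obtain ⟨s', r, m, c⟩ := hf w s _ hV
      refine ⟨s', r, m.congr ?_, c⟩
      intro x j z
      constructor
      · rintro ⟨⟨h1, h2⟩, h3⟩
        refine ⟨h1, ?_⟩
        rintro ⟨hj, w', h4, h5, h6, h7⟩
        rcases Nat.lt_succ_iff_lt_or_eq.mp h5 with h5 | h5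
        · exact h2 ⟨hj, w', h4, h5, h6, h7⟩
        · have : w' = w := T.injective (Fin.ext h5)
          subst this; exact h3 ⟨h6, hj, h7⟩
      · rintro ⟨h1, h2⟩
        refine ⟨⟨h1, ?_⟩, ?_⟩
        · rintro ⟨hj, w', h4, h5, h6, h7⟩
          exact h2 ⟨hj, w', h4, Nat.lt_succ_of_lt h5, h6, h7⟩
        · rintro ⟨h6, hj, h7⟩
          exact h2 ⟨hj, w, ha, Nat.lt_succ_self _, h6, h7⟩)
    (h.congr (by
      intro x j z
      refine ⟨fun h => ⟨h, ?_⟩, fun h => h.1⟩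
      rintro ⟨-, w, h1, h2, -⟩
      omega))
  refine ⟨s', r, m.congr ?_, c⟩
  intro x j z
  have : ∀ w, (a ≤ (T w : ℕ) ∧ (T w : ℕ) < max a (min b n)) ↔ (a ≤ (T w : ℕ) ∧ (T w : ℕ) < b) := by
    intro w; have := (T w).2; omega
  simp only [← and_assoc, this]

theorem View.insertLoop (h : View E O T s) {a b i k : ℕ} {f : Fin n → Prog n Unit}
    (ex ez : Fin n → Fin n)
    (hf : ∀ w s (O : Fin n → ℕ → Fin n → Prop), View E O T s → ∃ s', Runs (f w) s () s' ∧
      View E (fun x j z => O x j z ∨ (x = ex w ∧ j = i ∧ z = ez w ∧ E x z)) T s' ∧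
      s'.clock ≤ s.clock + k) :
    ∃ s', Runs (forPositions a b f) s () s' ∧
      View E (fun x j z => O x j z ∨
        (j = i ∧ E x z ∧ ∃ w, a ≤ T w ∧ T w < b ∧ x = ex w ∧ z = ez w)) T s' ∧
      s'.clock ≤ s.clock + (b - a) * (k + 1) := by
  obtain ⟨s', r, m, c⟩ := runs_forPositions (T := T) (s := s) (a := a) (b := b) (f := f) (k := k)
    (fun q => View E (fun x j z => O x j z ∨
        (j = i ∧ E x z ∧ ∃ w, a ≤ T w ∧ T w < q ∧ x = ex w ∧ z = ez w)) T)
    (fun _ _ h => h.pos) (fun _ _ _ h => h.setClock _) (by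
      intro w s ha hb hV
      obtain ⟨s', r, m, c⟩ := hf w s _ hV
      refine ⟨s', r, m.congr ?_, c⟩
      intro x j z
      constructor
      · rintro ((h1 | ⟨hj, he, w', h4, h5, h6, h7⟩) | ⟨h6, hj, h7, he⟩)
        · exact Or.inl h1
        · exact Or.inr ⟨hj, he, w', h4, Nat.lt_succ_of_lt h5, h6, h7⟩
        · exact Or.inr ⟨hj, he, w, ha, Nat.lt_succ_self _, h6, h7⟩
      · rintro (h1 | ⟨hj, he, w', h4, h5, h6, h7⟩)
        · exact Or.inl (Or.inl h1)
        · rcases Nat.lt_succ_iff_lt_or_eq.mp h5 with h5 | h5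
          · exact Or.inl (Or.inr ⟨hj, he, w', h4, h5, h6, h7⟩)
          · have : w' = w := T.injective (Fin.ext h5)
            subst this; exact Or.inr ⟨h6, hj, h7, he⟩)
    (h.congr (by
      intro x j z
      refine ⟨fun h => Or.inl h, ?_⟩
      rintro (h | ⟨-, -, w, h1, h2, -⟩)
      · exact h
      · omega))
  refine ⟨s', r, m.congr ?_, c⟩
  intro x j z
  have : ∀ w, (a ≤ (T w : ℕ) ∧ (T w : ℕ) < max a (min b n)) ↔ (a ≤ (T w : ℕ) ∧ (T w : ℕ) < b) := by
    intro w; have := (T w).2; omega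
  simp only [← and_assoc, this]

/-- The entries of the pails: `z` belongs to the pail of level `j` of out-neighbours of `x`. -/
def Near (E : Fin n → Fin n → Prop) (t : ℕ → ℕ) (T : Fin n ≃ Fin n) (x : Fin n) (j : ℕ)
    (z : Fin n) : Prop :=
  E x z ∧ (T z : ℕ) ≤ T x + t j

/-- The number of steps for updating the pails of one level after an exchange over the
distance `d`. -/
def levelCost (n d : ℕ) : ℕ := 5 * d * (pairCost n + 1) + 1

/-- As u moves right and v moves left, edges into u and out of v get longer and may leave a pail,
while edges out of u and into v get shorter and may enter one. The clearness conditions put the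
other ends of the latter beyond v and before u. The view keeps the old order, because the positions
are exchanged only after all levels are done. -/
theorem runs_swapPails (t : ℕ → ℕ) (i : ℕ) {u v : Fin n} (hV : View E O T s)
    (hO : ∀ x z, O x i z ↔ Near E t T x i z) (hT : Topo E T) (huv : T u < T v)
    (ho : ClearOut E T u v) (hi : ClearIn E T u v) :
    ∃ s', Runs (swapPails t u v i) s () s' ∧
      View E (fun x j z => (j ≠ i ∧ O x j z) ∨
        (j = i ∧ Near E t ((Equiv.swap u v).trans T) x i z)) T s' ∧
      s'.clock ≤ s.clock + levelCost n (T v - T u) := by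
  obtain ⟨a, ha⟩ : ∃ a : ℕ, a = T u := ⟨_, rfl⟩
  obtain ⟨b, hb⟩ : ∃ b : ℕ, b = T v := ⟨_, rfl⟩
  have hab : a < b := by rw [ha, hb]; exact huv
  obtain ⟨s₁, r₁, v₁, c₁⟩ := (hV.setClock (s.clock + 1)).deleteLoop (a := a - t i)
    (b := min a (a + (b - a) - t i)) (i := i) (k := pairCost n)
    (f := fun w => do inPailDelete u i w; outPailDelete w i u)
    (fun w => w) (fun _ => u) (fun w s O h => by
      obtain ⟨-, s', h1, h2, h3⟩ := h.deletePair w u i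
      exact ⟨s', h1, h2, h3⟩)
  obtain ⟨s₂, r₂, v₂, c₂⟩ := v₁.deleteLoop (a := max (b + t i - (b - a)) b + 1)
    (b := b + t i + 1) (i := i) (k := pairCost n)
    (f := fun w => do outPailDelete v i w; inPailDelete w i v)
    (fun _ => v) (fun w => w) (fun w s O h => by
      obtain ⟨⟨s', h1, h2, h3⟩, -⟩ := h.deletePair v w i
      exact ⟨s', h1, h2, h3⟩)
  obtain ⟨s₃, r₃, v₃, c₃⟩ := v₂.insertLoop (a := max b (a + t i) + 1)
    (b := a + t i + (b - a) + 1) (i := i) (k := pairCost n)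
    (f := fun w => do
      if s.outAdj u w then
        outPailInsert u i w
        inPailInsert w i u)
    (fun _ => u) (fun w => w) (fun w s' O h => by
      by_cases hE : E u w
      · obtain ⟨⟨s', h1, h2, h3⟩, -⟩ := h.insertPair u w i
        refine ⟨s', ?_, h2.congr ?_, h3⟩
        · rw [if_pos ((hV.outAdj u w).mpr hE)]; exact h1
        · intro x j z
          refine or_congr_right ⟨?_, fun h => ⟨h.1, h.2.1, h.2.2.1⟩⟩
          rintro ⟨rfl, rfl, rfl⟩; exact ⟨rfl, rfl, rfl, hE⟩
      · refine ⟨s', ?_, h.congr ?_, by omega⟩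
        · rw [if_neg (by rw [hV.outAdj]; exact hE)]; rfl
        · intro x j z
          refine ⟨Or.inl, ?_⟩
          rintro (h | ⟨rfl, rfl, rfl, h⟩)
          · exact h
          · exact absurd h hE)
  obtain ⟨s₄, r₄, v₄, c₄⟩ := v₃.insertLoop (a := b - (b - a) - t i)
    (b := min a (b + (b - a) - t i)) (i := i) (k := pairCost n)
    (f := fun w => do
      if s.inAdj v w then
        inPailInsert v i w
        outPailInsert w i v)
    (fun w => w) (fun _ => v) (fun w s' O h => by
      by_cases hE : E w v
      · obtain ⟨-, s', h1, h2, h3⟩ := h.insertPair w v i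
        refine ⟨s', ?_, h2.congr ?_, h3⟩
        · rw [if_pos ((hV.inAdj w v).mpr hE)]; exact h1
        · intro x j z
          refine or_congr_right ⟨?_, fun h => ⟨h.1, h.2.1, h.2.2.1⟩⟩
          rintro ⟨rfl, rfl, rfl⟩; exact ⟨rfl, rfl, rfl, hE⟩
      · refine ⟨s', ?_, h.congr ?_, by omega⟩
        · rw [if_neg (by rw [hV.inAdj]; exact hE)]; rfl
        · intro x j z
          refine ⟨Or.inl, ?_⟩
          rintro (h | ⟨rfl, rfl, rfl, h⟩)
          · exact h
          · exact absurd h hE)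
  refine ⟨s₄, ?_, v₄.congr ?_, ?_⟩
  · refine (Runs.tick 1 s).bind ((Runs.get _).bind ?_)
    have ha' : ((s.pos u : Fin n) : ℕ) = a := by rw [hV.pos, ha]
    have hb' : ((s.pos v : Fin n) : ℕ) = b := by rw [hV.pos, hb]
    simp only [ha', hb']
    refine r₁.bind ?_
    refine r₂.bind ?_
    refine r₃.bind ?_
    exact r₄
  · intro x j z
    by_cases hj : j = i
    swap
    · simp [hj]
    subst hj
    simp only [true_and, hO, Near, ne_eq, not_true_eq_false, false_and, false_or]
    by_cases hE : E x z
    swap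
    · simp [hE]
    have hxz : (T x : ℕ) < T z := hT x z hE
    have hex : ∀ (P : Fin n → Prop) (y : Fin n), (∃ w, P w ∧ y = w) ↔ P y := by
      intro P y
      exact ⟨fun ⟨w, h, e⟩ => e ▸ h, fun h => ⟨y, h, rfl⟩⟩
    have hx1 : x = u → b < T z := by rintro rfl; rw [hb]; exact ho z hE
    have hx2 : x = v → z ≠ u ∧ z ≠ v := by
      rintro rfl; constructor <;> rintro rfl <;> omega
    have hz1 : z = v → (T x : ℕ) < a := by rintro rfl; rw [ha]; exact hi x hE
    have hz2 : z = u → x ≠ u ∧ x ≠ v := by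
      rintro rfl; constructor <;> rintro rfl <;> omega
    have hx3 : x = u → z ≠ u ∧ z ≠ v := by
      intro h; have := hx1 h; constructor <;> rintro rfl <;> omega
    have hz3 : z = v → x ≠ u ∧ x ≠ v := by
      intro h; have := hz1 h; constructor <;> rintro rfl <;> omega
    simp only [hE, true_and, swap_trans_apply]
    have e1 : (∃ w, a - t j ≤ (T w : ℕ) ∧ (T w : ℕ) < min a (a + (b - a) - t j) ∧ x = w ∧ z = u) ↔
        (z = u ∧ a - t j ≤ (T x : ℕ) ∧ (T x : ℕ) < min a (a + (b - a) - t j)) := by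
      constructor
      · rintro ⟨w, h1, h2, rfl, h3⟩; exact ⟨h3, h1, h2⟩
      · rintro ⟨h3, h1, h2⟩; exact ⟨x, h1, h2, rfl, h3⟩
    have e2 : (∃ w, max (b + t j - (b - a)) b + 1 ≤ (T w : ℕ) ∧ (T w : ℕ) < b + t j + 1 ∧
        x = v ∧ z = w) ↔ (x = v ∧ max (b + t j - (b - a)) b + 1 ≤ (T z : ℕ) ∧
        (T z : ℕ) < b + t j + 1) := by
      constructor
      · rintro ⟨w, h1, h2, h3, rfl⟩; exact ⟨h3, h1, h2⟩
      · rintro ⟨h3, h1, h2⟩; exact ⟨z, h1, h2, h3, rfl⟩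
    have e3 : (∃ w, max b (a + t j) + 1 ≤ (T w : ℕ) ∧ (T w : ℕ) < a + t j + (b - a) + 1 ∧
        x = u ∧ z = w) ↔ (x = u ∧ max b (a + t j) + 1 ≤ (T z : ℕ) ∧
        (T z : ℕ) < a + t j + (b - a) + 1) := by
      constructor
      · rintro ⟨w, h1, h2, h3, rfl⟩; exact ⟨h3, h1, h2⟩
      · rintro ⟨h3, h1, h2⟩; exact ⟨z, h1, h2, h3, rfl⟩
    have e4 : (∃ w, b - (b - a) - t j ≤ (T w : ℕ) ∧ (T w : ℕ) < min a (b + (b - a) - t j) ∧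
        x = w ∧ z = v) ↔ (z = v ∧ b - (b - a) - t j ≤ (T x : ℕ) ∧
        (T x : ℕ) < min a (b + (b - a) - t j)) := by
      constructor
      · rintro ⟨w, h1, h2, rfl, h3⟩; exact ⟨h3, h1, h2⟩
      · rintro ⟨h3, h1, h2⟩; exact ⟨x, h1, h2, rfl, h3⟩
    rw [e1, e2, e3, e4]
    -- An edge has at most one end among u and v, since `ClearOut` forbids u → v and the order
    -- forbids v → u. So the four cases exclude one another, and each involves a single loop.
    by_cases c1 : x = u
    · obtain ⟨h1, h2⟩ := hx3 c1
      have h3 := hx1 c1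
      have h4 : x ≠ v := by rintro rfl; subst c1; omega
      have h5 : (T x : ℕ) = a := by rw [c1, ha]
      simp only [c1, h1, h2, if_true, if_false, false_and, true_and, or_false, not_false_eq_true,
        and_true, ← ha, ← hb]
      have h6 : u ≠ v := by rw [← c1]; exact h4
      simp only [h6, false_and, not_false_eq_true, and_true]
      omega
    by_cases c2 : x = v
    · obtain ⟨h1, h2⟩ := hx2 c2
      have h3 : (T x : ℕ) = b := by rw [c2, hb]
      have h6 : v ≠ u := by rw [← c2]; exact c1
      simp only [c2, h6, h1, h2, if_true, if_false, false_and, true_and, or_false,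
        not_false_eq_true, and_true, ← ha, ← hb]
      omega
    by_cases c3 : z = u
    · have h3 : (T z : ℕ) = a := by rw [c3, ha]
      have h6 : u ≠ v := by rintro rfl; omega
      simp only [c3, h6, c1, c2, if_true, if_false, false_and, true_and, or_false,
        not_false_eq_true, and_true, ← ha, ← hb]
      omega
    by_cases c4 : z = v
    · have h1 := hz1 c4
      have h3 : (T z : ℕ) = b := by rw [c4, hb]
      have h6 : v ≠ u := by rw [← c4]; exact c3
      simp only [c4, h6, c1, c2, if_true, if_false, false_and, true_and, or_false,
        not_false_eq_true, and_true, ← ha, ← hb]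
      omega
    simp only [c1, c2, c3, c4, if_false, false_and, or_false, not_false_eq_true, and_true]
  · have e1 : min a (a + (b - a) - t i) - (a - t i) ≤ b - a := by omega
    have e2 : b + t i + 1 - (max (b + t i - (b - a)) b + 1) ≤ b - a := by omega
    have e3 : a + t i + (b - a) + 1 - (max b (a + t i) + 1) ≤ b - a := by omega
    -- The fourth range can be twice as long as the distance. It may contain vertices that are in
    -- the pail already, whose insertion changes nothing. This explains the factor 5 in `levelCost`.
    have e4 : min a (b + (b - a) - t i) - (b - (b - a) - t i) ≤ 2 * (b - a) := by omega
    have f1 := Nat.mul_le_mul_right (pairCost n + 1) e1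
    have f2 := Nat.mul_le_mul_right (pairCost n + 1) e2
    have f3 := Nat.mul_le_mul_right (pairCost n + 1) e3
    have f4 := Nat.mul_le_mul_right (pairCost n + 1) e4
    unfold levelCost
    dsimp only at c₁
    rw [← ha, ← hb]
    linarith

end Programs

/-! ### The data structure invariant under exchanges and edge insertions. -/

section Programs

variable {n : ℕ}

/-- The memory stores the edges `E`, a topological order, and correct pails. -/
structure Inv (p : ℕ) (t : ℕ → ℕ) (E : Fin n → Fin n → Prop) (s : Mem n) : Prop where
  topo : Topo E s.pos
  view : ∃ O, View E O s.pos s ∧ ∀ j ≤ p + 1, ∀ x z, O x j z ↔ Near E t s.pos x j z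

variable {p : ℕ} {t : ℕ → ℕ} {E : Fin n → Fin n → Prop} {s : Mem n}

theorem Inv.setClock (h : Inv p t E s) (c : ℕ) : Inv p t E { s with clock := c } :=
  ⟨h.topo, h.view.imp fun _ hO => ⟨hO.1.setClock c, hO.2⟩⟩

theorem Inv.emptyMem (T : Fin n ≃ Fin n) : Inv p t (fun _ _ => False) (emptyMem T) where
  topo _ _ h := h.elim
  view := by
    refine ⟨fun _ _ _ => False, ⟨rfl, by simp [OnlineTopo.emptyMem], by simp [OnlineTopo.emptyMem],
      fun _ _ => SearchTree.IsBalanced.nil, fun _ _ => SearchTree.IsBalanced.nil, ?_, ?_⟩, ?_⟩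
    · simp [OnlineTopo.emptyMem]
    · simp [OnlineTopo.emptyMem]
    · simp [Near]

/-- A loop over the levels that changes the entries of one level after the other. -/
theorem View.levelLoop {O₀ : Fin n → ℕ → Fin n → Prop} {T : Fin n ≃ Fin n}
    (O₁ : Fin n → ℕ → Fin n → Prop) {k : ℕ} {f : ℕ → Prog n Unit} (hV : View E O₀ T s)
    (hf : ∀ i ≤ p + 1, ∀ s O, View E O T s → (∀ x z, O x i z ↔ O₀ x i z) →
      ∃ s', Runs (f i) s () s' ∧
        View E (fun x j z => (j ≠ i ∧ O x j z) ∨ (j = i ∧ O₁ x i z)) T s' ∧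
        s'.clock ≤ s.clock + k) :
    ∃ s', Runs ((List.range (p + 2)).forM f) s () s' ∧
      (∃ O, View E O T s' ∧ ∀ j ≤ p + 1, ∀ x z, O x j z ↔ O₁ x j z) ∧
      s'.clock ≤ s.clock + (p + 2) * k := by
  obtain ⟨s', r, ⟨O, v, hO⟩, c⟩ := runs_forM_time (fun l s => ∃ O, View E O T s ∧
      ∀ x j z, (j ∈ l → (O x j z ↔ O₁ x j z)) ∧ (j ∉ l → (O x j z ↔ O₀ x j z))) k f
    (List.range (p + 2)) s (by
      rintro l₁ i l₂ s hl ⟨O, v, hO⟩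
      have hnd : (List.range (p + 2)).Nodup := List.nodup_range
      rw [hl, List.nodup_append] at hnd
      have hi : i ∉ l₁ := fun h => hnd.2.2 i h i (by simp) rfl
      have hip : i ∈ List.range (p + 2) := by rw [hl]; simp
      rw [List.mem_range] at hip
      obtain ⟨s', r, v', c⟩ := hf i (by omega) s O v (fun x z => (hO x i z).2 hi)
      refine ⟨s', r, ⟨_, v', ?_⟩, c⟩
      intro x j z
      have := hO x j z
      by_cases hj : j = i
      · subst hj; simp
      · simp [hj]; exact this) ⟨O₀, hV, by simp⟩
  refine ⟨s', r, ⟨O, v, ?_⟩, by simpa using c⟩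
  intro j hj x z
  exact (hO x j z).1 (by rw [List.mem_range]; omega)

/-- The number of steps for an exchange over the distance `d`. -/
def swapCost (n p d : ℕ) : ℕ := (p + 2) * levelCost n d + 4

theorem Inv.runs_swapVertices (h : Inv p t E s) {u v : Fin n} (huv : s.pos u < s.pos v)
    (ho : ClearOut E s.pos u v) (hi : ClearIn E s.pos u v)
    (htopo : Topo E ((Equiv.swap u v).trans s.pos)) :
    ∃ s', Runs (swapVertices p t u v) s () s' ∧ Inv p t E s' ∧
      s'.pos = (Equiv.swap u v).trans s.pos ∧
      s'.clock ≤ s.clock + swapCost n p (s.pos v - s.pos u) := by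
  obtain ⟨O, hV, hO⟩ := h.view
  obtain ⟨s', r, ⟨O', v', hO'⟩, c⟩ := hV.levelLoop (p := p)
    (fun x j z => Near E t ((Equiv.swap u v).trans s.pos) x j z)
    (f := fun i => swapPails t u v i) (k := levelCost n (s.pos v - s.pos u))
    (fun i hip s₁ O₁ v₁ hO₁ => runs_swapPails t i v₁
      (fun x z => (hO₁ x z).trans (hO i hip x z)) h.topo huv ho hi)
  refine ⟨{ s' with clock := s'.clock + 4, pos := (Equiv.swap u v).trans s'.pos },
    r.bind ((Runs.tick 4 s').bind rfl), ⟨?_, O', ?_, ?_⟩, ?_, ?_⟩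
  · rw [v'.pos]; exact htopo
  · exact ⟨rfl, v'.outAdj, v'.inAdj, v'.outBalanced, v'.inBalanced, v'.out, v'.inn⟩
  · rw [v'.pos]; exact hO'
  · rw [v'.pos]
  · unfold swapCost; dsimp only; omega

/-- The edges after inserting the edge `u → v`. -/
def addEdge (E : Fin n → Fin n → Prop) (u v : Fin n) : Fin n → Fin n → Prop :=
  fun x y => E x y ∨ (x = u ∧ y = v)

/-- The number of steps for updating the data structures for a new edge. -/
def insertCost (n p : ℕ) : ℕ := (p + 2) * (pairCost n + 1) + 2

theorem Inv.runs_insertEdge (h : Inv p t E s) {u v : Fin n} (huv : s.pos u < s.pos v) :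
    ∃ s', Runs (insertEdge p t u v) s () s' ∧ Inv p t (addEdge E u v) s' ∧
      s'.pos = s.pos ∧ s'.clock ≤ s.clock + insertCost n p := by
  obtain ⟨O, hV, hO⟩ := h.view
  have htopo : Topo (addEdge E u v) s.pos := by
    rintro x y (hxy | ⟨rfl, rfl⟩)
    · exact h.topo x y hxy
    · exact huv
  have hV₁ : View (addEdge E u v) O s.pos { s with
      clock := s.clock + 2
      outAdj := Function.update s.outAdj u (Function.update (s.outAdj u) v true)
      inAdj := Function.update s.inAdj v (Function.update (s.inAdj v) u true) } := by
    refine ⟨rfl, ?_, ?_, hV.outBalanced, hV.inBalanced, hV.out, hV.inn⟩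
    · intro x z
      by_cases hx : x = u
      · subst hx
        by_cases hz : z = v
        · subst hz; simp [addEdge]
        · simp [addEdge, hz, hV.outAdj]
      · simp [addEdge, hx, hV.outAdj]
    · intro x z
      by_cases hz : z = v
      · subst hz
        by_cases hx : x = u
        · subst hx; simp [addEdge]
        · simp [addEdge, hx, hV.inAdj]
      · simp [addEdge, hz, hV.inAdj]
  obtain ⟨s', r, ⟨O', v', hO'⟩, c⟩ := hV₁.levelLoop (p := p)
    (fun x j z => O x j z ∨ (x = u ∧ z = v ∧ (s.pos v : ℕ) - s.pos u ≤ t j))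
    (k := pairCost n + 1)
    (f := fun i => do
      tick 1
      let s ← get
      let a : ℕ := s.pos u
      let b : ℕ := s.pos v
      if a < b ∧ b - a ≤ t i then
        outPailInsert u i v
        inPailInsert v i u)
    (by
      intro i hip s₁ O₁ v₁ hO₁
      have huv' : ((s.pos u : Fin n) : ℕ) < s.pos v := huv
      by_cases hd : ((s.pos v : Fin n) : ℕ) - s.pos u ≤ t i
      · obtain ⟨⟨s₂, h1, h2, h3⟩, -⟩ := (v₁.setClock (s₁.clock + 1)).insertPair u v i
        refine ⟨s₂, ?_, h2.congr ?_, by dsimp only at h3; omega⟩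
        · refine (Runs.tick 1 s₁).bind ((Runs.get _).bind ?_)
          have hp : s₁.pos = s.pos := v₁.pos
          simp only [hp]
          rw [if_pos ⟨huv', hd⟩]
          rw [← hp]; exact h1
        · intro x j z
          by_cases hj : j = i
          · subst hj; simp [hO₁, hd]
          · simp [hj]
      · refine ⟨{ s₁ with clock := s₁.clock + 1 }, ?_, (v₁.setClock _).congr ?_, by
          dsimp only; omega⟩
        · refine (Runs.tick 1 s₁).bind ((Runs.get _).bind ?_)
          have hp : s₁.pos = s.pos := v₁.pos
          simp only [hp]
          rw [if_neg (fun h => hd h.2)]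
          rw [← hp]; rfl
        · intro x j z
          by_cases hj : j = i
          · subst hj; simp [hO₁, hd]
          · simp [hj])
  refine ⟨s', ?_, ⟨by rw [v'.pos]; exact htopo, O', by rw [v'.pos]; exact v', ?_⟩, v'.pos, ?_⟩
  · exact (Runs.tick 2 s).bind (Runs.bind (a := ()) rfl r)
  · intro j hj x z
    have huv' : ((s.pos u : Fin n) : ℕ) < s.pos v := huv
    rw [hO' j hj, hO j hj, v'.pos]
    unfold Near addEdge
    constructor
    · rintro (⟨h1, h2⟩ | ⟨rfl, rfl, h⟩)
      · exact ⟨Or.inl h1, h2⟩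
      · exact ⟨Or.inr ⟨rfl, rfl⟩, by omega⟩
    · rintro ⟨h1 | ⟨rfl, rfl⟩, h2⟩
      · exact Or.inl ⟨h1, h2⟩
      · exact Or.inr ⟨rfl, rfl, by omega⟩
  · unfold insertCost; dsimp only at c; omega

end Programs

/-! ### Computing the sets A and B, and what they cost. -/

section NearSets

variable {n p : ℕ} {t : ℕ → ℕ} {E : Fin n → Fin n → Prop} {s : Mem n}

/-- The vertices are listed by decreasing position. -/
def Decreasing (T : Fin n ≃ Fin n) (l : List (Fin n)) : Prop := l.Pairwise fun x y => T y < T x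

theorem Decreasing.nodup {T : Fin n ≃ Fin n} {l : List (Fin n)} (h : Decreasing T l) : l.Nodup :=
  List.Pairwise.imp (fun h e => by subst e; exact lt_irrefl _ h) h

/-- The contents of a pail of out-neighbours. -/
theorem Inv.outPail_collect (h : Inv p t E s) {i : ℕ} (hi : i ≤ p + 1) (u : Fin n) :
    (s.outPail u i).collectAll.ret.Nodup ∧
      (∀ w, w ∈ (s.outPail u i).collectAll.ret ↔ Near E t s.pos u i w) ∧
      (s.outPail u i).collectAll.ret.length ≤ t i ∧
      (s.outPail u i).collectAll.time = 2 * (s.outPail u i).collectAll.ret.length + 1 := by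
  obtain ⟨O, hV, hO⟩ := h.view
  have hnd : (s.outPail u i).collectAll.ret.Nodup := by
    rw [SearchTree.ret_collectAll]
    exact List.nodup_reverse.mpr ((hV.outBalanced u i).2.imp fun h => ne_of_lt h)
  have hmem : ∀ w, w ∈ (s.outPail u i).collectAll.ret ↔ Near E t s.pos u i w := fun w => by
    rw [SearchTree.ret_collectAll, List.mem_reverse, hV.out, hO i hi]
  refine ⟨hnd, hmem, ?_, by rw [SearchTree.time_collectAll, SearchTree.ret_collectAll]; simp⟩
  rw [← List.toFinset_card_of_nodup hnd]
  calc _ ≤ (Finset.Ioc (s.pos u : ℕ) (s.pos u + t i)).card := by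
        apply Finset.card_le_card_of_injOn (fun w => (s.pos w : ℕ))
        · intro w hw
          obtain ⟨h1, h2⟩ := (hmem w).mp (by simpa using hw)
          have : (s.pos u : ℕ) < s.pos w := h.topo _ _ h1
          simp only [Finset.coe_Ioc, Set.mem_Ioc]; omega
        · intro a _ b _ hab; exact s.pos.injective (Fin.ext hab)
    _ = t i := by simp

/-- The contents of a pail of in-neighbours. -/
theorem Inv.inPail_collect (h : Inv p t E s) {i : ℕ} (hi : i ≤ p + 1) (v : Fin n) :
    (s.inPail v i).collectAll.ret.Nodup ∧
      (∀ w, w ∈ (s.inPail v i).collectAll.ret ↔ Near E t s.pos w i v) ∧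
      (s.inPail v i).collectAll.ret.length ≤ t i ∧
      (s.inPail v i).collectAll.time = 2 * (s.inPail v i).collectAll.ret.length + 1 := by
  obtain ⟨O, hV, hO⟩ := h.view
  have hnd : (s.inPail v i).collectAll.ret.Nodup := by
    rw [SearchTree.ret_collectAll]
    exact List.nodup_reverse.mpr ((hV.inBalanced v i).2.imp fun h => ne_of_lt h)
  have hmem : ∀ w, w ∈ (s.inPail v i).collectAll.ret ↔ Near E t s.pos w i v := fun w => by
    rw [SearchTree.ret_collectAll, List.mem_reverse, hV.inn, hO i hi]
  refine ⟨hnd, hmem, ?_, by rw [SearchTree.time_collectAll, SearchTree.ret_collectAll]; simp⟩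
  rw [← List.toFinset_card_of_nodup hnd]
  calc _ ≤ (Finset.Ico ((s.pos v : ℕ) - t i) (s.pos v)).card := by
        apply Finset.card_le_card_of_injOn (fun w => (s.pos w : ℕ))
        · intro w hw
          obtain ⟨h1, h2⟩ := (hmem w).mp (by simpa using hw)
          have : (s.pos w : ℕ) < s.pos v := h.topo _ _ h1
          simp only [Finset.coe_Ico, Set.mem_Ico]; omega
        · intro a _ b _ hab; exact s.pos.injective (Fin.ext hab)
    _ ≤ t i := by simp; omega

theorem Inv.runs_outNearCount (h : Inv p t E s) {i : ℕ} (hi : i ≤ p + 1) (u v : Fin n) :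
    ∃ A c, Runs (outNearCount t i u v) s A { s with clock := s.clock + c } ∧
      Decreasing s.pos A ∧ (∀ w, w ∈ A ↔ Near E t s.pos u i w ∧ s.pos w < s.pos v) ∧
      c ≤ 7 * t i + 3 := by
  obtain ⟨hnd, hmem, hlen, htime⟩ := h.outPail_collect hi u
  -- The key falls as the position grows, which yields decreasing order. The truncated subtraction
  -- is injective on the pail, whose vertices lie at most `t i` beyond u.
  have hkey := countingSort_sorted (t i) (fun w => (s.pos u : ℕ) + t i - s.pos w) _ hnd (by
    intro x hx y hy hxy
    have h1 := ((hmem x).mp hx).2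
    have h2 := ((hmem y).mp hy).2
    exact s.pos.injective (Fin.ext (by omega)))
  have r : Runs (outNearCount t i u v) s ((countingSort (t i) (fun w => (s.pos u : ℕ) + t i - s.pos w)
        (s.outPail u i).collectAll.ret).ret.filter fun w => s.pos w < s.pos v)
      { s with clock := s.clock + ((s.outPail u i).collectAll).time +
        (countingSort (t i) (fun w => (s.pos u : ℕ) + t i - s.pos w)
        (s.outPail u i).collectAll.ret).time +
        (countingSort (t i) (fun w => (s.pos u : ℕ) + t i - s.pos w)
        (s.outPail u i).collectAll.ret).ret.length } := rfl
  refine ⟨_, _ + _ + _, by simpa only [add_assoc] using r, ?_, ?_, ?_⟩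
  · refine List.Pairwise.filter _ (hkey.imp ?_)
    intro x y hxy
    rw [Fin.lt_def]; omega
  · intro w
    simp only [List.mem_filter, mem_countingSort, hmem, decide_eq_true_eq]
    refine and_congr_left fun _ => and_iff_left_of_imp fun hw => ?_
    have : (s.pos u : ℕ) < s.pos w := h.topo _ _ hw.1
    omega
  · have h1 := time_countingSort_le (t i) (fun w => (s.pos u : ℕ) + t i - s.pos w)
      (s.outPail u i).collectAll.ret
    have h2 := length_countingSort_le (t i) (fun w => (s.pos u : ℕ) + t i - s.pos w)
      (s.outPail u i).collectAll.ret
    change _ + _ + (countingSort (t i) (fun w => (s.pos u : ℕ) + t i - s.pos w)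
      (s.outPail u i).collectAll.ret).ret.length ≤ _
    omega

theorem Inv.runs_inNearCount (h : Inv p t E s) {i : ℕ} (hi : i ≤ p + 1) (u v : Fin n) :
    ∃ B c, Runs (inNearCount t i u v) s B { s with clock := s.clock + c } ∧
      Decreasing s.pos B ∧ (∀ w, w ∈ B ↔ Near E t s.pos w i v ∧ s.pos u < s.pos w) ∧
      c ≤ 7 * t i + 3 := by
  obtain ⟨hnd, hmem, hlen, htime⟩ := h.inPail_collect hi v
  have hlt : ∀ w, Near E t s.pos w i v → (s.pos w : ℕ) < s.pos v := fun w hw => h.topo _ _ hw.1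
  have hkey := countingSort_sorted (t i) (fun w => (s.pos v : ℕ) - s.pos w) _ hnd (by
    intro x hx y hy hxy
    have h1 := hlt x ((hmem x).mp hx)
    have h2 := hlt y ((hmem y).mp hy)
    exact s.pos.injective (Fin.ext (by omega)))
  have r : Runs (inNearCount t i u v) s ((countingSort (t i) (fun w => (s.pos v : ℕ) - s.pos w)
        (s.inPail v i).collectAll.ret).ret.filter fun w => s.pos u < s.pos w)
      { s with clock := s.clock + ((s.inPail v i).collectAll).time +
        (countingSort (t i) (fun w => (s.pos v : ℕ) - s.pos w)
        (s.inPail v i).collectAll.ret).time +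
        (countingSort (t i) (fun w => (s.pos v : ℕ) - s.pos w)
        (s.inPail v i).collectAll.ret).ret.length } := rfl
  refine ⟨_, _ + _ + _, by simpa only [add_assoc] using r, ?_, ?_, ?_⟩
  · refine List.Pairwise.filter _ (hkey.imp ?_)
    intro x y hxy
    rw [Fin.lt_def]; omega
  · intro w
    simp only [List.mem_filter, mem_countingSort, hmem, decide_eq_true_eq]
    refine and_congr_left fun _ => and_iff_left_of_imp fun hw => ?_
    have := hw.2
    omega
  · have h1 := time_countingSort_le (t i) (fun w => (s.pos v : ℕ) - s.pos w)
      (s.inPail v i).collectAll.ret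
    have h2 := length_countingSort_le (t i) (fun w => (s.pos v : ℕ) - s.pos w)
      (s.inPail v i).collectAll.ret
    change _ + _ + (countingSort (t i) (fun w => (s.pos v : ℕ) - s.pos w)
      (s.inPail v i).collectAll.ret).ret.length ≤ _
    omega

/-- As v is farther away than `t i`, the whole pail lies before v and the filter removes nothing.
Therefore the cost can be measured by the length of the result instead of `t i`. -/
theorem Inv.runs_outNearTree (h : Inv p t E s) {i : ℕ} (hi : i ≤ p + 1) {u v : Fin n}
    (hd : (s.pos u : ℕ) + t i < s.pos v) :
    ∃ A c, Runs (outNearTree i u v) s A { s with clock := s.clock + c } ∧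
      Decreasing s.pos A ∧ (∀ w, w ∈ A ↔ Near E t s.pos u i w ∧ s.pos w < s.pos v) ∧
      c ≤ A.length * (SearchTree.maxHeight n + 8) + 2 := by
  obtain ⟨hnd, hmem, hlen, htime⟩ := h.outPail_collect hi u
  have hmem' : ∀ w, w ∈ (treeSort s.pos (s.outPail u i).collectAll.ret).ret.filter
      (fun w => s.pos w < s.pos v) ↔ Near E t s.pos u i w ∧ s.pos w < s.pos v := by
    intro w
    simp only [List.mem_filter, mem_treeSort, hmem, decide_eq_true_eq]
  have r : Runs (outNearTree i u v) s ((treeSort s.pos (s.outPail u i).collectAll.ret).ret.filter fun w => s.pos w < s.pos v)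
      { s with clock := s.clock + ((s.outPail u i).collectAll).time +
        (treeSort s.pos (s.outPail u i).collectAll.ret).time +
        (treeSort s.pos (s.outPail u i).collectAll.ret).ret.length } := rfl
  refine ⟨_, _ + _ + _, by simpa only [add_assoc] using r, ?_, hmem', ?_⟩
  · exact List.Pairwise.filter _ (treeSort_sorted _ _)
  · have h1 := time_treeSort_le s.pos (s.outPail u i).collectAll.ret
    have h2 := length_treeSort_le s.pos (s.outPail u i).collectAll.ret
    have h3 : (s.outPail u i).collectAll.ret.length ≤
        ((treeSort s.pos (s.outPail u i).collectAll.ret).ret.filter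
          (fun w => s.pos w < s.pos v)).length := by
      refine (hnd.subperm ?_).length_le
      intro w hw
      rw [hmem']
      have := (hmem w).mp hw
      refine ⟨this, ?_⟩
      have := this.2
      rw [Fin.lt_def]; omega
    have h4 := Nat.mul_le_mul_right (SearchTree.maxHeight n + 8) h3
    change _ + _ + (treeSort s.pos (s.outPail u i).collectAll.ret).ret.length ≤ _
    refine le_trans ?_ (Nat.add_le_add_right h4 2)
    rw [Nat.mul_add] at h1 ⊢
    omega

theorem Inv.runs_inNearTree (h : Inv p t E s) {i : ℕ} (hi : i ≤ p + 1) {u v : Fin n}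
    (hd : (s.pos u : ℕ) + t i < s.pos v) :
    ∃ B c, Runs (inNearTree i u v) s B { s with clock := s.clock + c } ∧
      Decreasing s.pos B ∧ (∀ w, w ∈ B ↔ Near E t s.pos w i v ∧ s.pos u < s.pos w) ∧
      c ≤ B.length * (SearchTree.maxHeight n + 8) + 2 := by
  obtain ⟨hnd, hmem, hlen, htime⟩ := h.inPail_collect hi v
  have hmem' : ∀ w, w ∈ (treeSort s.pos (s.inPail v i).collectAll.ret).ret.filter
      (fun w => s.pos u < s.pos w) ↔ Near E t s.pos w i v ∧ s.pos u < s.pos w := by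
    intro w
    simp only [List.mem_filter, mem_treeSort, hmem, decide_eq_true_eq]
  have r : Runs (inNearTree i u v) s ((treeSort s.pos (s.inPail v i).collectAll.ret).ret.filter fun w => s.pos u < s.pos w)
      { s with clock := s.clock + ((s.inPail v i).collectAll).time +
        (treeSort s.pos (s.inPail v i).collectAll.ret).time +
        (treeSort s.pos (s.inPail v i).collectAll.ret).ret.length } := rfl
  refine ⟨_, _ + _ + _, by simpa only [add_assoc] using r, ?_, hmem', ?_⟩
  · exact List.Pairwise.filter _ (treeSort_sorted _ _)
  · have h1 := time_treeSort_le s.pos (s.inPail v i).collectAll.ret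
    have h2 := length_treeSort_le s.pos (s.inPail v i).collectAll.ret
    have h3 : (s.inPail v i).collectAll.ret.length ≤
        ((treeSort s.pos (s.inPail v i).collectAll.ret).ret.filter
          (fun w => s.pos u < s.pos w)).length := by
      refine (hnd.subperm ?_).length_le
      intro w hw
      rw [hmem']
      have := (hmem w).mp hw
      refine ⟨this, ?_⟩
      have := this.2
      rw [Fin.lt_def]; omega
    have h4 := Nat.mul_le_mul_right (SearchTree.maxHeight n + 8) h3
    change _ + _ + (treeSort s.pos (s.inPail v i).collectAll.ret).ret.length ≤ _
    refine le_trans ?_ (Nat.add_le_add_right h4 2)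
    rw [Nat.mul_add] at h1 ⊢
    omega

/-- Serves conditionals whose continuation has been moved into both branches by `do` notation. -/
theorem Runs.ite_bind {α β : Type} {c : Prop} [Decidable c] {x y : Prog n α} {f : α → Prog n β}
    {s s' s'' : Mem n} {a : α} {b : β} (h : Runs (if c then x else y) s a s')
    (h' : Runs (f a) s' b s'') : Runs (if c then x >>= f else y >>= f) s b s'' := by
  split_ifs at h ⊢ <;> exact h.bind h'

theorem findLevel_spec (t : ℕ → ℕ) (d k m : ℕ) (hd : d ≤ t (k + m)) :
    k ≤ (findLevel t d k m).ret ∧ (findLevel t d k m).ret ≤ k + m ∧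
      d ≤ t (findLevel t d k m).ret ∧ (∀ j, k ≤ j → j < (findLevel t d k m).ret → t j < d) ∧
      (findLevel t d k m).time ≤ m + 1 := by
  induction m generalizing k with
  | zero =>
    refine ⟨le_rfl, le_rfl, hd, ?_, le_rfl⟩
    intro j h1 h2
    exact absurd h2 (not_lt.mpr h1)
  | succ m ih =>
    simp only [findLevel, Timed.ret_bind, Timed.time_bind, Timed.time_tick]
    split_ifs with c
    · refine ⟨le_rfl, by simp, c, ?_, by simp⟩
      intro j h1 h2
      exact absurd h2 (not_lt.mpr h1)
    · obtain ⟨h1, h2, h3, h4, h5⟩ := ih (k + 1) (by rw [add_assoc, add_comm 1]; exact hd)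
      refine ⟨by omega, by omega, h3, ?_, by omega⟩
      intro j hj hj'
      rcases Nat.lt_or_ge k j with h | h
      · exact h4 j h hj'
      · have : j = k := by omega
        subst this; omega

/-- What the sets `A` and `B` of a call have to do with the edges, and what is paid for the
counting sorts at the levels above `0`, which costs `cA` and `cB`. -/
structure NearData (p : ℕ) (t : ℕ → ℕ) (E : Fin n → Fin n → Prop) (T : Fin n ≃ Fin n)
    (u v : Fin n) (f₁ f₂ : Bool) (A B : List (Fin n)) (cA cB : ℕ) : Prop where
  decA : Decreasing T A
  decB : Decreasing T B
  memA : ∀ w ∈ A, E u w ∧ T w < T v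
  memB : ∀ w ∈ B, E w v ∧ T u < T w
  clearA : A = [] → ClearOut E T u v
  clearB : B = [] → ClearIn E T u v
  costA : cA = 0 ∨ (f₁ = false ∧ (∀ w, E u w → T w < T v → w ∈ A) ∧
    ∃ i ≤ p, (T u : ℕ) + t i < T v ∧ (T v : ℕ) ≤ T u + t (i + 1) ∧
      (∀ w, E u w → (T u : ℕ) + t i < T w) ∧ cA ≤ 7 * t (i + 1) + 3)
  costB : cB = 0 ∨ (f₂ = false ∧ (∀ w, E w v → T u < T w → w ∈ B) ∧
    ∃ i ≤ p, (T u : ℕ) + t i < T v ∧ (T v : ℕ) ≤ T u + t (i + 1) ∧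
      (∀ w, E w v → (T w : ℕ) + t i < T v) ∧ cB ≤ 7 * t (i + 1) + 3)

/-- At level 0 the two counting sorts are covered by the term `14 * t 0`. At higher levels the
comparison sorts are covered by the output, and only a counting sort after an empty comparison sort
without a flag is recorded in `cA` or `cB`. Such a sort yields all the relevant neighbours, since
d(u, v) is at most the threshold of its level. -/
theorem Inv.runs_nearSets (h : Inv p t E s) {u v : Fin n} (huv : s.pos u < s.pos v)
    (hE : ¬ E u v) (ht : n ≤ t (p + 1)) {f₁ f₂ : Bool} (hf₁ : f₁ = true → ClearOut E s.pos u v)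
    (hf₂ : f₂ = true → ClearIn E s.pos u v) :
    ∃ A B c cA cB, Runs (nearSets p t u v f₁ f₂) s (A, B) { s with clock := s.clock + c } ∧
      NearData p t E s.pos u v f₁ f₂ A B cA cB ∧
      c ≤ p + 14 * t 0 + 12 + (A.length + B.length) * (SearchTree.maxHeight n + 8) + cA + cB := by
  have huv' : (s.pos u : ℕ) < s.pos v := huv
  have hv := (s.pos v).2
  -- An empty set that is known to be complete shows clearness; the vertex v itself is excluded by
  -- `hE`.
  have hclearA : ∀ A : List (Fin n), (∀ w, E u w → s.pos w < s.pos v → w ∈ A) → A = [] →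
      ClearOut E s.pos u v := by
    rintro A hA rfl w hw
    rcases lt_trichotomy (s.pos w) (s.pos v) with h1 | h1 | h1
    · exact absurd (hA w hw h1) (by simp)
    · rw [s.pos.injective h1] at hw; exact absurd hw hE
    · exact h1
  have hclearB : ∀ B : List (Fin n), (∀ w, E w v → s.pos u < s.pos w → w ∈ B) → B = [] →
      ClearIn E s.pos u v := by
    rintro B hB rfl w hw
    rcases lt_trichotomy (s.pos u) (s.pos w) with h1 | h1 | h1
    · exact absurd (hB w hw h1) (by simp)
    · rw [← s.pos.injective h1] at hw; exact absurd hw hE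
    · exact h1
  obtain ⟨-, l2, l3, l4, l5⟩ := findLevel_spec t ((s.pos v : ℕ) - s.pos u) 0 (p + 1)
    (by rw [zero_add]; omega)
  have hI := h.setClock (s.clock + (findLevel t ((s.pos v : ℕ) - s.pos u) 0 (p + 1)).time)
  have hstart : ∀ {a : List (Fin n) × List (Fin n)} {s'' : Mem n},
      Runs (match (findLevel t ((s.pos v : ℕ) - s.pos u) 0 (p + 1)).ret with
        | 0 => do
          let A ← outNearCount t 0 u v
          let B ← inNearCount t 0 u v
          return (A, B)
        | i + 1 => do
          let A₀ ← outNearTree i u v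
          let B₀ ← inNearTree i u v
          let A ← if A₀ ≠ [] ∨ f₁ = true then pure A₀ else outNearCount t (i + 1) u v
          let B ← if B₀ ≠ [] ∨ f₂ = true then pure B₀ else inNearCount t (i + 1) u v
          return (A, B))
        { s with clock := s.clock + (findLevel t ((s.pos v : ℕ) - s.pos u) 0 (p + 1)).time }
        a s'' → Runs (nearSets p t u v f₁ f₂) s a s'' := fun hr =>
    (Runs.get s).bind ((Runs.timed _ s).bind hr)
  generalize (findLevel t ((s.pos v : ℕ) - s.pos u) 0 (p + 1)).time = c₀ at *
  generalize (findLevel t ((s.pos v : ℕ) - s.pos u) 0 (p + 1)).ret = j at *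
  rcases j with _ | i
  · obtain ⟨A, c₁, r₁, d₁, m₁, b₁⟩ := hI.runs_outNearCount (Nat.zero_le _) u v
    obtain ⟨B, c₂, r₂, d₂, m₂, b₂⟩ := (hI.setClock (s.clock + c₀ + c₁)).runs_inNearCount
      (Nat.zero_le _) u v
    dsimp only at *
    refine ⟨A, B, c₀ + c₁ + c₂, 0, 0, hstart (r₁.bind (r₂.bind ?_)), ?_, ?_⟩
    · simp only [add_assoc]; rfl
    · refine ⟨d₁, d₂, fun w hw => ?_, fun w hw => ?_, hclearA A ?_, hclearB B ?_, Or.inl rfl,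
        Or.inl rfl⟩
      · exact ⟨((m₁ w).mp hw).1.1, ((m₁ w).mp hw).2⟩
      · exact ⟨((m₂ w).mp hw).1.1, ((m₂ w).mp hw).2⟩
      · intro w hw hlt
        rw [m₁]
        have : (s.pos w : ℕ) < s.pos v := hlt
        exact ⟨⟨hw, by omega⟩, hlt⟩
      · intro w hw hlt
        rw [m₂]
        have : (s.pos u : ℕ) < s.pos w := hlt
        exact ⟨⟨hw, by omega⟩, hlt⟩
    · have := Nat.zero_le ((A.length + B.length) * (SearchTree.maxHeight n + 8))
      omega
  · have hti := l4 i (Nat.zero_le _) (Nat.lt_succ_self _)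
    have hdi : (s.pos u : ℕ) + t i < s.pos v := by omega
    obtain ⟨A₀, c₁, r₁, d₁, m₁, b₁⟩ := hI.runs_outNearTree (i := i) (by omega) (u := u) (v := v) hdi
    obtain ⟨B₀, c₂, r₂, d₂, m₂, b₂⟩ := (hI.setClock (s.clock + c₀ + c₁)).runs_inNearTree (i := i)
      (by omega) (u := u) (v := v) hdi
    dsimp only at *
    have hA : ∃ A c₃ cA, Runs (if A₀ ≠ [] ∨ f₁ = true then pure A₀ else outNearCount t (i + 1) u v)
        { s with clock := s.clock + c₀ + c₁ + c₂ } A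
        { s with clock := s.clock + c₀ + c₁ + c₂ + c₃ } ∧ Decreasing s.pos A ∧
        (∀ w ∈ A, E u w ∧ s.pos w < s.pos v) ∧ (A = [] → ClearOut E s.pos u v) ∧
        (cA = 0 ∨ (f₁ = false ∧ (∀ w, E u w → s.pos w < s.pos v → w ∈ A) ∧
        ∃ i ≤ p, (s.pos u : ℕ) + t i < s.pos v ∧ (s.pos v : ℕ) ≤ s.pos u + t (i + 1) ∧
        (∀ w, E u w → (s.pos u : ℕ) + t i < s.pos w) ∧ cA ≤ 7 * t (i + 1) + 3)) ∧
        c₁ + c₃ ≤ A.length * (SearchTree.maxHeight n + 8) + cA + 2 := by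
      by_cases hc : A₀ ≠ [] ∨ f₁ = true
      · refine ⟨A₀, 0, 0, by rw [if_pos hc]; rfl, d₁, fun w hw => ?_, fun h0 => ?_, Or.inl rfl,
          by omega⟩
        · exact ⟨((m₁ w).mp hw).1.1, ((m₁ w).mp hw).2⟩
        · exact hf₁ (hc.resolve_left (fun h => h h0))
      · have hc' := not_or.mp hc
        obtain ⟨A, c₃, r₃, d₃, m₃, b₃⟩ := (hI.setClock (s.clock + c₀ + c₁ + c₂)).runs_outNearCount
          (i := i + 1) (by omega) u v
        dsimp only at *
        have hcomp : ∀ w, E u w → s.pos w < s.pos v → w ∈ A := by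
          intro w hw hlt
          rw [m₃]
          have : (s.pos w : ℕ) < s.pos v := hlt
          exact ⟨⟨hw, by omega⟩, hlt⟩
        have hA0 : A₀ = [] := not_not.mp hc'.1
        refine ⟨A, c₃, c₃, by rw [if_neg hc]; exact r₃, d₃, fun w hw => ?_, hclearA A hcomp,
          Or.inr ⟨by simpa using hc'.2, hcomp, i, by omega, hdi, by omega, fun w hw => ?_, b₃⟩, ?_⟩
        · exact ⟨((m₃ w).mp hw).1.1, ((m₃ w).mp hw).2⟩
        -- A closer out-neighbour would have been found by the comparison sort at level `i`, which
        -- came out empty.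
        · by_contra hcon
          have : w ∈ A₀ := by
            rw [m₁]
            refine ⟨⟨hw, by omega⟩, ?_⟩
            rw [Fin.lt_def]; omega
          rw [hA0] at this; simp at this
        · rw [hA0] at b₁; simp at b₁; omega
    obtain ⟨A, c₃, cA, r₃, d₃, m₃, e₃, f₃, b₃⟩ := hA
    have hB : ∃ B c₄ cB, Runs (if B₀ ≠ [] ∨ f₂ = true then pure B₀ else inNearCount t (i + 1) u v)
        { s with clock := s.clock + c₀ + c₁ + c₂ + c₃ } B
        { s with clock := s.clock + c₀ + c₁ + c₂ + c₃ + c₄ } ∧ Decreasing s.pos B ∧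
        (∀ w ∈ B, E w v ∧ s.pos u < s.pos w) ∧ (B = [] → ClearIn E s.pos u v) ∧
        (cB = 0 ∨ (f₂ = false ∧ (∀ w, E w v → s.pos u < s.pos w → w ∈ B) ∧
        ∃ i ≤ p, (s.pos u : ℕ) + t i < s.pos v ∧ (s.pos v : ℕ) ≤ s.pos u + t (i + 1) ∧
        (∀ w, E w v → (s.pos w : ℕ) + t i < s.pos v) ∧ cB ≤ 7 * t (i + 1) + 3)) ∧
        c₂ + c₄ ≤ B.length * (SearchTree.maxHeight n + 8) + cB + 2 := by
      by_cases hc : B₀ ≠ [] ∨ f₂ = true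
      · refine ⟨B₀, 0, 0, by rw [if_pos hc]; rfl, d₂, fun w hw => ?_, fun h0 => ?_, Or.inl rfl,
          by omega⟩
        · exact ⟨((m₂ w).mp hw).1.1, ((m₂ w).mp hw).2⟩
        · exact hf₂ (hc.resolve_left (fun h => h h0))
      · have hc' := not_or.mp hc
        obtain ⟨B, c₄, r₄, d₄, m₄, b₄⟩ :=
          (hI.setClock (s.clock + c₀ + c₁ + c₂ + c₃)).runs_inNearCount (i := i + 1) (by omega) u v
        dsimp only at *
        have hcomp : ∀ w, E w v → s.pos u < s.pos w → w ∈ B := by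
          intro w hw hlt
          rw [m₄]
          have : (s.pos u : ℕ) < s.pos w := hlt
          exact ⟨⟨hw, by omega⟩, hlt⟩
        have hB0 : B₀ = [] := not_not.mp hc'.1
        refine ⟨B, c₄, c₄, by rw [if_neg hc]; exact r₄, d₄, fun w hw => ?_, hclearB B hcomp,
          Or.inr ⟨by simpa using hc'.2, hcomp, i, by omega, hdi, by omega, fun w hw => ?_, b₄⟩, ?_⟩
        · exact ⟨((m₄ w).mp hw).1.1, ((m₄ w).mp hw).2⟩
        · by_contra hcon
          have : w ∈ B₀ := by
            rw [m₂]
            refine ⟨⟨hw, by omega⟩, ?_⟩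
            rw [Fin.lt_def]; omega
          rw [hB0] at this; simp at this
        · rw [hB0] at b₂; simp at b₂; omega
    obtain ⟨B, c₄, cB, r₄, d₄, m₄, e₄, f₄, b₄⟩ := hB
    refine ⟨A, B, c₀ + c₁ + c₂ + c₃ + c₄, cA, cB,
      hstart (r₁.bind (r₂.bind (r₃.ite_bind (r₄.ite_bind ?_)))), ⟨d₃, d₄, m₃, m₄, e₃, e₄, f₃, f₄⟩, ?_⟩
    · simp only [add_assoc]; rfl
    · rw [add_mul]; omega

end NearSets

/-! ### The order of the recursive calls and its invariants. -/

section Schedule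

variable {n : ℕ}

theorem callsFrom_spec (T : Fin n ≃ Fin n) (u' : Fin n) (vs : List (Fin n))
    (acc : List (Fin n × Fin n)) (hvs : Decreasing T vs) :
    (callsFrom T u' vs acc).ret =
        ((vs.filter fun v' => T u' < T v').reverse.map fun v' => (u', v')) ++ acc ∧
      (callsFrom T u' vs acc).time ≤ (vs.filter fun v' => T u' < T v').length + 1 := by
  induction vs generalizing acc with
  | nil => simp [callsFrom]
  | cons v' vs ih =>
    obtain ⟨h1, h2⟩ := List.pairwise_cons.mp hvs
    simp only [callsFrom, Timed.ret_bind, Timed.time_bind, Timed.time_tick]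
    split_ifs with c
    · obtain ⟨h3, h4⟩ := ih ((u', v') :: acc) h2
      rw [List.filter_cons_of_pos (by simpa using c), h3]
      constructor
      · simp
      · simp only [List.length_cons]; omega
    · have : (v' :: vs).filter (fun v' => T u' < T v') = [] := by
        rw [List.filter_eq_nil_iff]
        intro w hw
        rcases List.mem_cons.mp hw with rfl | hw
        · simpa using c
        · simpa using (h1 w hw).le.trans (not_lt.mp c)
      rw [this]
      simp

theorem schedule_eq (T : Fin n ≃ Fin n) (vs us : List (Fin n)) (hvs : Decreasing T vs) :
    (schedule T vs us).ret = us.flatMap (fun u' =>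
        (vs.filter fun v' => T u' < T v').reverse.map fun v' => (u', v')) ∧
      (schedule T vs us).time ≤ 2 * us.length + (schedule T vs us).ret.length := by
  induction us with
  | nil => simp [schedule]
  | cons u' us ih =>
    obtain ⟨h1, h2⟩ := callsFrom_spec T u' vs [] hvs
    simp only [schedule, Timed.ret_bind, Timed.time_bind, Timed.time_tick, Timed.ret_pure,
      Timed.time_pure, List.flatMap_cons, List.length_append, List.length_cons]
    obtain ⟨h3, h4⟩ := ih
    rw [h1]
    constructor
    · rw [h3, List.append_nil]
    · simp only [List.append_nil, List.length_map, List.length_reverse]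
      omega

/-- The order of the calls: by decreasing first component, then by increasing second component. -/
def Before (T : Fin n ≃ Fin n) (c c' : Fin n × Fin n) : Prop :=
  T c'.1 < T c.1 ∨ (c.1 = c'.1 ∧ T c.2 < T c'.2)

/-- The calls for the first components `us` and the second components `vs`. -/
structure IsSchedule (T : Fin n ≃ Fin n) (us vs : List (Fin n)) (cs : List (Fin n × Fin n)) :
    Prop where
  mem : ∀ x y, (x, y) ∈ cs ↔ x ∈ us ∧ y ∈ vs ∧ T x < T y
  before : cs.Pairwise (Before T)

theorem isSchedule_schedule {T : Fin n ≃ Fin n} {vs us : List (Fin n)} (hvs : Decreasing T vs)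
    (hus : Decreasing T us) : IsSchedule T us vs (schedule T vs us).ret := by
  rw [(schedule_eq T vs us hvs).1]
  constructor
  · intro x y
    simp only [List.mem_flatMap, List.mem_map, List.mem_reverse, List.mem_filter,
      decide_eq_true_eq, Prod.mk.injEq]
    constructor
    · rintro ⟨a, ha, b, ⟨hb, hlt⟩, rfl, rfl⟩; exact ⟨ha, hb, hlt⟩
    · rintro ⟨ha, hb, hlt⟩; exact ⟨x, ha, y, ⟨hb, hlt⟩, rfl, rfl⟩
  · rw [List.pairwise_flatMap]
    constructor
    · intro x _
      rw [List.pairwise_map, List.pairwise_reverse]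
      exact (List.Pairwise.filter _ hvs).imp fun h => Or.inr ⟨rfl, h⟩
    · refine hus.imp ?_
      intro a b hab c hc c' hc'
      simp only [List.mem_map] at hc hc'
      obtain ⟨_, -, rfl⟩ := hc
      obtain ⟨_, -, rfl⟩ := hc'
      exact Or.inl hab

theorem IsSchedule.mem_done {T : Fin n ≃ Fin n} {us vs : List (Fin n)}
    {cs l₁ l₂ : List (Fin n × Fin n)} {c c' : Fin n × Fin n} (h : IsSchedule T us vs cs)
    (hl : cs = l₁ ++ c :: l₂) (hc' : c' ∈ cs) (hb : Before T c' c) : c' ∈ l₁ := by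
  have hp := h.before
  rw [hl, List.pairwise_append, List.pairwise_cons] at hp
  rw [hl, List.mem_append, List.mem_cons] at hc'
  rcases hc' with hc' | rfl | hc'
  · exact hc'
  · rcases hb with hb | hb
    · exact absurd hb (lt_irrefl _)
    · exact absurd hb.2 (lt_irrefl _)
  · rcases hp.2.1.1 _ hc' with h1 | h1 <;> rcases hb with hb | hb
    · exact absurd hb h1.not_gt
    · rw [hb.1] at h1; exact absurd h1 (lt_irrefl _)
    · rw [h1.1] at hb; exact absurd hb (lt_irrefl _)
    · exact absurd hb.2 h1.2.not_gt

theorem IsSchedule.pending {T : Fin n ≃ Fin n} {us vs : List (Fin n)}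
    {cs l₁ l₂ : List (Fin n × Fin n)} {c c' : Fin n × Fin n} (h : IsSchedule T us vs cs)
    (hl : cs = l₁ ++ c :: l₂) (hc' : c' ∈ cs) (hn : c' ∉ l₁ ++ [c]) : Before T c c' := by
  have hp := h.before
  rw [hl, List.pairwise_append, List.pairwise_cons] at hp
  rw [hl] at hc'
  simp only [List.mem_append, List.mem_cons, List.not_mem_nil, or_false] at hc' hn
  exact hp.2.1.1 _ (by tauto)

theorem IsSchedule.nodup {T : Fin n ≃ Fin n} {us vs : List (Fin n)} {cs : List (Fin n × Fin n)}
    (h : IsSchedule T us vs cs) : cs.Nodup := by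
  refine h.before.imp ?_
  rintro a b hab rfl
  rcases hab with hab | hab
  · exact lt_irrefl _ hab
  · exact lt_irrefl _ hab.2

/-- The calls (w, v) with w in A, and (u, w) with w in B or w = v, are all different. So the cost of
listing A and B can be charged to the calls. -/
theorem IsSchedule.le_length {T : Fin n ≃ Fin n} {A B : List (Fin n)} {u v : Fin n}
    {cs : List (Fin n × Fin n)} (h : IsSchedule T (A ++ [u]) (v :: B) cs)
    (hA : Decreasing T (A ++ [u])) (hB : Decreasing T (v :: B)) (huv : T u < T v)
    (hAv : ∀ w ∈ A, T w < T v) (hBu : ∀ w ∈ B, T u < T w) :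
    A.length + B.length + 1 ≤ cs.length := by
  have hA' := hA.nodup
  rw [List.nodup_append] at hA'
  have hnd : (A.map (fun w => (w, v)) ++ (v :: B).map fun w => (u, w)).Nodup := by
    rw [List.nodup_append]
    refine ⟨hA'.1.map fun a b h => (Prod.mk.inj h).1, hB.nodup.map fun a b h => (Prod.mk.inj h).2,
      ?_⟩
    rintro a ha b hb rfl
    simp only [List.mem_map] at ha hb
    obtain ⟨w, hw, rfl⟩ := ha
    obtain ⟨w', -, h'⟩ := hb
    exact hA'.2.2 w hw u (by simp) (Prod.mk.inj h').1.symm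
  have := (hnd.subperm (l₂ := cs) (by
    intro c hc
    simp only [List.mem_append, List.mem_map] at hc
    rcases hc with ⟨w, hw, rfl⟩ | ⟨w, hw, rfl⟩
    · rw [h.mem]; exact ⟨by simp [hw], by simp, hAv w hw⟩
    · rw [h.mem]
      refine ⟨by simp, hw, ?_⟩
      rcases List.mem_cons.mp hw with rfl | hw
      · exact huv
      · exact hBu w hw)).length_le
  simp only [List.length_append, List.length_map, List.length_cons] at this
  omega

/-- The orders that occur while the calls of a schedule are executed; `l` lists the calls that
have been made. -/
structure Progress (E : Fin n → Fin n → Prop) (u v : Fin n) (T : Fin n ≃ Fin n)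
    (us vs : List (Fin n)) (cs l : List (Fin n × Fin n)) (T₁ : Fin n ≃ Fin n) : Prop where
  steps : Steps E u v (T u) (T v) T T₁
  flipped : ∀ c ∈ l, T₁ c.2 < T₁ c.1
  left : ∀ x ∈ us, ∀ y ∈ us, T x < T y → T₁ x < T₁ y
  right : ∀ x ∈ vs, ∀ y ∈ vs, T x < T y → T₁ x < T₁ y
  pending : ∀ c ∈ cs, c ∉ l → T₁ c.1 < T₁ c.2

variable {E : Fin n → Fin n → Prop} {u v : Fin n} {T T₁ T₂ : Fin n ≃ Fin n} {us vs : List (Fin n)}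
  {cs l₁ l₂ : List (Fin n × Fin n)} {c : Fin n × Fin n}

/-- The hypotheses on a frame with a schedule. -/
structure Frame (E : Fin n → Fin n → Prop) (u v : Fin n) (T : Fin n ≃ Fin n)
    (us vs : List (Fin n)) (cs : List (Fin n × Fin n)) : Prop where
  topo : Topo E T
  acyclic : ¬ ReflTransGen E u v
  reach_us : ∀ x ∈ us, ReflTransGen E u x
  reach_vs : ∀ y ∈ vs, ReflTransGen E y v
  schedule : IsSchedule T us vs cs

theorem Frame.not_reach (hF : Frame E u v T us vs cs) {x y : Fin n} (hx : x ∈ us) (hy : y ∈ vs) :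
    ¬ ReflTransGen E x y := fun h =>
  hF.acyclic (((hF.reach_us x hx).trans h).trans (hF.reach_vs y hy))

theorem Progress.start (hF : Frame E u v T us vs cs) : Progress E u v T us vs cs [] T where
  steps := .refl
  flipped := by simp
  left _ _ _ _ h := h
  right _ _ _ _ h := h
  pending c hc _ := ((hF.schedule.mem c.1 c.2).mp hc).2.2

/-- At the time of the call `c`, the second component comes before the first components above
that of `c`. -/
theorem Progress.lt_of_lt_left (h : Progress E u v T us vs cs l₁ T₁) (hF : Frame E u v T us vs cs)
    (hl : cs = l₁ ++ c :: l₂) {x : Fin n} (hx : x ∈ us) (hlt : T c.1 < T x) : T₁ c.2 < T₁ x := by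
  have hc := (hF.schedule.mem c.1 c.2).mp (by rw [hl]; simp)
  rcases lt_trichotomy (T c.2) (T x) with h1 | h1 | h1
  · exact (h.steps.le_right hF.acyclic (hF.reach_vs _ hc.2.1)).trans_lt
      (h1.trans_le (h.steps.le_left hF.acyclic (hF.reach_us _ hx)))
  · have h2 := T.injective h1
    exact absurd (by rw [h2] : ReflTransGen E x c.2) (hF.not_reach hx hc.2.1)
  · exact h.flipped (x, c.2) (hF.schedule.mem_done hl ((hF.schedule.mem _ _).mpr ⟨hx, hc.2.1, h1⟩)
      (Or.inl hlt))

/-- At the time of the call `c`, the first component comes after the second components below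
that of `c`. -/
theorem Progress.lt_of_lt_right (h : Progress E u v T us vs cs l₁ T₁)
    (hF : Frame E u v T us vs cs) (hl : cs = l₁ ++ c :: l₂) {y : Fin n} (hy : y ∈ vs)
    (hlt : T y < T c.2) : T₁ y < T₁ c.1 := by
  have hc := (hF.schedule.mem c.1 c.2).mp (by rw [hl]; simp)
  rcases lt_trichotomy (T y) (T c.1) with h1 | h1 | h1
  · exact (h.steps.le_right hF.acyclic (hF.reach_vs _ hy)).trans_lt
      (h1.trans_le (h.steps.le_left hF.acyclic (hF.reach_us _ hc.1)))
  · have h2 := T.injective h1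
    exact absurd (by rw [h2] : ReflTransGen E c.1 y) (hF.not_reach hc.1 hy)
  · exact h.flipped (c.1, y) (hF.schedule.mem_done hl ((hF.schedule.mem _ _).mpr ⟨hc.1, hy, h1⟩)
      (Or.inr ⟨rfl, hlt⟩))

/-- A call of the schedule takes place within the positions of the frame. -/
theorem Progress.bounds (h : Progress E u v T us vs cs l₁ T₁) (hF : Frame E u v T us vs cs)
    (hc : c ∈ cs) :
    T u ≤ T c.1 ∧ T c.1 ≤ T₁ c.1 ∧ T₁ c.2 ≤ T c.2 ∧ T c.2 ≤ T v := by
  have hc := (hF.schedule.mem c.1 c.2).mp hc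
  exact ⟨hF.topo.le (hF.reach_us _ hc.1), h.steps.le_left hF.acyclic (hF.reach_us _ hc.1),
    h.steps.le_right hF.acyclic (hF.reach_vs _ hc.2.1), hF.topo.le (hF.reach_vs _ hc.2.1)⟩

/-- During a call, members of `us` never move left and members of `vs` never move right, so earlier
flips persist. All movement stays in the window between the two vertices of the call. The order of
the calls places the other vertices that matter outside this window, and hence a pending pair is not
flipped prematurely. -/
theorem Progress.next (h : Progress E u v T us vs cs l₁ T₁) (hF : Frame E u v T us vs cs)
    (hl : cs = l₁ ++ c :: l₂) (hs : Steps E c.1 c.2 (T₁ c.1) (T₁ c.2) T₁ T₂)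
    (hflip : T₂ c.2 < T₂ c.1) : Progress E u v T us vs cs (l₁ ++ [c]) T₂ := by
  have hccs : c ∈ cs := by rw [hl]; simp
  obtain ⟨hcu, hcv, hclt⟩ := (hF.schedule.mem c.1 c.2).mp hccs
  have hac : ¬ ReflTransGen E c.1 c.2 := hF.not_reach hcu hcv
  have hT₁ : Topo E T₁ := h.steps.topo hF.topo
  have hcn : c ∉ l₁ := by
    intro hc
    have := hF.schedule.nodup
    rw [hl, List.nodup_append] at this
    exact this.2.2 c hc c (by simp) rfl
  have hlt : T₁ c.1 < T₁ c.2 := h.pending c hccs hcn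
  have hleL : ∀ x ∈ us, T₁ x ≤ T₂ x := by
    intro x hx
    by_cases hr : ReflTransGen E c.1 x
    · exact hs.le_left hac hr
    · exact (hs.fixed hr (hF.not_reach hx hcv)).ge
  have hleR : ∀ y ∈ vs, T₂ y ≤ T₁ y := by
    intro y hy
    by_cases hr : ReflTransGen E y c.2
    · exact hs.le_right hac hr
    · exact (hs.fixed (hF.not_reach hcu hy) hr).le
  obtain ⟨b1, b2, b3, b4⟩ := h.bounds hF hccs
  refine ⟨?_, ?_, ?_, ?_, ?_⟩
  · exact ReflTransGen.trans h.steps (hs.mono (hF.reach_us _ hcu) (hF.reach_vs _ hcv)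
      (b1.trans b2) (b3.trans b4))
  · intro c' hc'
    rcases List.mem_append.mp hc' with hc' | hc'
    · have hmem := (hF.schedule.mem c'.1 c'.2).mp (by rw [hl]; simp [hc'])
      exact (hleR _ hmem.2.1).trans_lt ((h.flipped c' hc').trans_le (hleL _ hmem.1))
    · rw [List.mem_singleton] at hc'; subst hc'; exact hflip
  · intro x hx y hy hxy
    have h1 := h.left x hx y hy hxy
    by_cases hr : ReflTransGen E c.1 x
    -- If x moves it is a descendant of the first vertex of the call, so y is above that vertex as
    -- well and has already been passed by the second one. Thus y is to the right of the window.
    · have h2 : T₁ c.2 < T₁ y := h.lt_of_lt_left hF hl hy ((hF.topo.le hr).trans_lt hxy)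
      rcases lt_or_ge (T₁ c.2) (T₁ x) with h3 | h3
      · rw [hs.outside (Or.inr h3)]; exact h1.trans_le (hleL y hy)
      · exact (hs.inside ⟨hT₁.le hr, h3⟩).2.trans_lt (h2.trans_le (hleL y hy))
    · rw [hs.fixed hr (hF.not_reach hx hcv)]; exact h1.trans_le (hleL y hy)
  · intro x hx y hy hxy
    have h1 := h.right x hx y hy hxy
    by_cases hr : ReflTransGen E y c.2
    · have h2 : T₁ x < T₁ c.1 := h.lt_of_lt_right hF hl hx (hxy.trans_le (hF.topo.le hr))
      rcases lt_or_ge (T₁ y) (T₁ c.1) with h3 | h3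
      · rw [hs.outside (z := y) (Or.inl h3)]; exact (hleR x hx).trans_lt h1
      · exact ((hleR x hx).trans_lt h2).trans_le (hs.inside ⟨h3, hT₁.le hr⟩).1
    · rw [hs.fixed (z := y) (hF.not_reach hcu hy) hr]; exact (hleR x hx).trans_lt h1
  · intro c' hc' hn
    have hmem := (hF.schedule.mem c'.1 c'.2).mp hc'
    have hp := h.pending c' hc' (fun h => hn (by simp [h]))
    -- A later call has either a smaller first component, which lies left of the window, or the same
    -- first component and a larger second one, which lies right of it.
    rcases hF.schedule.pending hl hc' hn with hb | ⟨hb1, hb2⟩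
    · have h1 := h.left _ hmem.1 _ hcu hb
      rw [hs.outside (z := c'.1) (Or.inl h1)]
      by_cases h2 : T₁ c'.2 < T₁ c.1 ∨ T₁ c.2 < T₁ c'.2
      · rw [hs.outside h2]; exact hp
      · push Not at h2
        exact h1.trans_le (hs.inside h2).1
    · have h1 := h.right _ hcv _ hmem.2.1 hb2
      rw [hs.outside (z := c'.2) (Or.inr h1), ← hb1]
      exact (hs.inside ⟨le_rfl, hlt.le⟩).2.trans_lt h1

/-- Out-neighbours of u beyond v are outside the frame and do not move. This justifies handing the
flag on to the calls when A is empty. -/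
theorem Progress.clearOut (h : Progress E u v T us vs cs l₁ T₁) (hF : Frame E u v T us vs cs)
    (hc : c ∈ cs) (ho : ClearOut E T u v) : ClearOut E T₁ u c.2 := by
  intro w hw
  obtain ⟨-, -, b3, b4⟩ := h.bounds hF hc
  rw [h.steps.outside (Or.inr (ho w hw))]
  exact (b3.trans b4).trans_lt (ho w hw)

theorem Progress.clearIn (h : Progress E u v T us vs cs l₁ T₁) (hF : Frame E u v T us vs cs)
    (hc : c ∈ cs) (hi : ClearIn E T u v) : ClearIn E T₁ c.1 v := by
  intro w hw
  obtain ⟨b1, b2, -, -⟩ := h.bounds hF hc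
  rw [h.steps.outside (Or.inl (hi w hw))]
  exact (hi w hw).trans_le (b1.trans b2)

/-- Because first components are processed in decreasing order, the second component has passed
every out-neighbour of u in the frame before it is paired with u itself. -/
theorem Progress.clearOut_of_complete (h : Progress E u v T us vs cs l₁ T₁)
    (hF : Frame E u v T us vs cs) (hl : cs = l₁ ++ c :: l₂) (hc : c.1 = u)
    (hA : ∀ w, E u w → T w < T v → w ∈ us) : ClearOut E T₁ u c.2 := by
  intro w hw
  obtain ⟨-, -, b3, b4⟩ := h.bounds hF (c := c) (by rw [hl]; simp)
  rcases lt_trichotomy (T w) (T v) with h1 | h1 | h1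
  · exact h.lt_of_lt_left hF hl (hA w hw h1) (by rw [hc]; exact hF.topo _ _ hw)
  · rw [T.injective h1] at hw; exact absurd (.single hw) hF.acyclic
  · rw [h.steps.outside (Or.inr h1)]; exact (b3.trans b4).trans_lt h1

theorem Progress.clearIn_of_complete (h : Progress E u v T us vs cs l₁ T₁)
    (hF : Frame E u v T us vs cs) (hl : cs = l₁ ++ c :: l₂) (hc : c.2 = v)
    (hB : ∀ w, E w v → T u < T w → w ∈ vs) : ClearIn E T₁ c.1 v := by
  intro w hw
  obtain ⟨b1, b2, -, -⟩ := h.bounds hF (c := c) (by rw [hl]; simp)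
  rcases lt_trichotomy (T u) (T w) with h1 | h1 | h1
  · exact h.lt_of_lt_right hF hl (hB w hw h1) (by rw [hc]; exact hF.topo _ _ hw)
  · rw [← T.injective h1] at hw; exact absurd (.single hw) hF.acyclic
  · rw [h.steps.outside (Or.inl h1)]; exact h1.trans_le (b1.trans b2)

end Schedule

/-! ### Amortised analysis of a call and its recursion. -/

section Reorder

variable {n : ℕ}

open Classical in
/-- The share of the growth of the potential that a call may use up for counting sorts on one side:
none if the flag `f` forbids them, a single one if `P` holds, so that the set is empty. -/
noncomputable def weight (f : Bool) (P : Prop) : ℝ := if f = true then 0 else if P then 1 else 2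

theorem weight_le_two (f : Bool) (P : Prop) : weight f P ≤ 2 := by
  unfold weight; split_ifs <;> norm_num

theorem weight_of_prop {P : Prop} (h : P) : weight false P = 1 := by simp [weight, h]

theorem weight_of_not {P : Prop} (h : ¬ P) : weight false P = 2 := by simp [weight, h]

theorem weight_true (P : Prop) : weight true P = 0 := by simp [weight]

/-- Potentials that pay for the program: `G` for the exchanges and for `q` steps per pair that
gets settled, and `X` for the counting sorts at the levels above `0`. -/
structure Budget (p : ℕ) (t : ℕ → ℕ) (E r : Fin n → Fin n → Prop) (q : ℕ)
    (G X : (Fin n ≃ Fin n) → ℝ) (rate : ℕ → ℝ) : Prop where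
  mono : ∀ {u v lo hi : Fin n} {T T' : Fin n ≃ Fin n}, Crossing E r u v → Topo E T →
    Steps E u v lo hi T T' → X T ≤ X T'
  disp : ∀ {u v lo hi : Fin n} {T T' : Fin n ≃ Fin n} {i : ℕ}, i ≤ p → Crossing E r u v →
    Topo E T → Steps E u v lo hi T T' → (hi : ℕ) ≤ lo + t (i + 1) → ∀ z,
    rate i * |((T' z : ℕ) : ℝ) - (T z : ℕ)| ≤ X T' - X T
  rate_nonneg : ∀ i ≤ p, 0 ≤ rate i
  rate_le : ∀ i ≤ p, ((7 * t (i + 1) + 3 : ℕ) : ℝ) ≤ rate i * ((t i : ℝ) + 1)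
  swap : ∀ {x y : Fin n} {T : Fin n ≃ Fin n}, Crossing E r x y → Topo E T → T x < T y →
    ClearOut E T x y → ClearIn E T x y →
    3 * (q : ℝ) + swapCost n p (T y - T x) ≤ G ((Equiv.swap x y).trans T) - G T
  base : p + 14 * t 0 + SearchTree.maxHeight n + 28 ≤ q

variable {p q : ℕ} {t : ℕ → ℕ} {E r : Fin n → Fin n → Prop} {G X : (Fin n ≃ Fin n) → ℝ}
  {rate : ℕ → ℝ} {u v : Fin n} {T T₁ T₂ : Fin n ≃ Fin n} {A B : List (Fin n)}
  {cs l₁ l₂ : List (Fin n × Fin n)} {c : Fin n × Fin n} {f₁ f₂ : Bool}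

/-- The parent's share of the growth must cover the child's share and the parent's own charge for
the movement of u. For A empty the child is flagged and needs nothing. For A nonempty the parent
owns two shares: a child with first vertex u needs only one if the parent has run a counting sort,
and any other child does not move u at all. -/
theorem Progress.weight_out (hP : Progress E u v T (A ++ [u]) (v :: B) cs l₁ T₁)
    (hF : Frame E u v T (A ++ [u]) (v :: B) cs) (hB : Budget p t E r q G X rate)
    (hC : Crossing E r u v) (hl : cs = l₁ ++ c :: l₂)
    (hs : Steps E c.1 c.2 (T₁ c.1) (T₁ c.2) T₁ T₂) (hA : A = [] → ClearOut E T u v)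
    (hmem : ∀ w ∈ A, E u w ∧ T w < T v) (hf : f₁ = true → ClearOut E T u v) {ρ : ℝ}
    (hρ : ρ = 0 ∨ (f₁ = false ∧ (∀ w, E u w → T w < T v → w ∈ A) ∧
      ∃ i ≤ p, ρ = rate i ∧ (T v : ℕ) ≤ T u + t (i + 1))) :
    weight (decide (c.1 = u ∧ A = [])) (ClearOut E T₁ c.1 c.2) * (X T₂ - X T₁) +
      ρ * (((T₂ u : ℕ) : ℝ) - (T₁ u : ℕ)) ≤
      weight f₁ (ClearOut E T u v) * (X T₂ - X T₁) := by
  have hccs : c ∈ cs := by rw [hl]; simp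
  obtain ⟨hcu, hcv, hclt⟩ := (hF.schedule.mem c.1 c.2).mp hccs
  have hT₁ : Topo E T₁ := hP.steps.topo hF.topo
  have hCc : Crossing E r c.1 c.2 := hC.mono (hF.reach_us _ hcu) (hF.reach_vs _ hcv)
  have hmono : 0 ≤ X T₂ - X T₁ := sub_nonneg.mpr (hB.mono hCc hT₁ hs)
  obtain ⟨b1, b2, b3, b4⟩ := hP.bounds hF hccs
  have hdisp : ρ * (((T₂ u : ℕ) : ℝ) - (T₁ u : ℕ)) ≤ X T₂ - X T₁ := by
    rcases hρ with rfl | ⟨-, -, i, hi, rfl, hd⟩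
    · simpa using hmono
    · refine le_trans ?_ (hB.disp hi hCc hT₁ hs ?_ u)
      · exact mul_le_mul_of_nonneg_left (le_abs_self _) (hB.rate_nonneg i hi)
      · have h1 : (T u : ℕ) ≤ T₁ c.1 := Fin.le_def.mp (b1.trans b2)
        have h2 : (T₁ c.2 : ℕ) ≤ T v := Fin.le_def.mp (b3.trans b4)
        omega
  by_cases hA0 : A = []
  · subst hA0
    have hcu' : c.1 = u := by simpa using hcu
    have hdec : decide (c.1 = u ∧ ([] : List (Fin n)) = []) = true := by simp [hcu']
    rw [hdec, weight_true]
    rcases f₁ with _ | _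
    · rw [weight_of_prop (hA rfl)]; linarith
    · rcases hρ with rfl | ⟨h, -⟩
      · simp [weight_true]
      · simp at h
  · have hdec : decide (c.1 = u ∧ A = []) = false := by simp [hA0]
    obtain ⟨w, hw⟩ := List.exists_mem_of_ne_nil A hA0
    have hnc : ¬ ClearOut E T u v := fun h => (h w (hmem w hw).1).not_gt (hmem w hw).2
    have hf0 : f₁ = false := by
      rcases f₁ with _ | _
      · rfl
      · exact absurd (hf rfl) hnc
    rw [hdec, hf0, weight_of_not hnc]
    have h2 := mul_le_mul_of_nonneg_right (weight_le_two false (ClearOut E T₁ c.1 c.2)) hmono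
    -- If ρ is not zero, A is complete. The child then starts with a clear out-side and needs one
    -- share, which leaves the other for the parent.
    by_cases hcu' : c.1 = u
    · rcases hρ with rfl | ⟨-, hcomp, -⟩
      · linarith
      · have := hP.clearOut_of_complete hF hl hcu' (fun w h1 h2 => by simp [hcomp w h1 h2])
        rw [hcu', weight_of_prop this]
        linarith
    · have hfix : T₂ u = T₁ u := by
        refine hs.fixed (fun h => ?_) (fun h => ?_)
        · exact hcu' (T.injective (le_antisymm (hF.topo.le h)
            (hF.topo.le (hF.reach_us _ hcu))))
        · exact hF.acyclic (h.trans (hF.reach_vs _ hcv))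
      rw [hfix]
      linarith

theorem Progress.weight_in (hP : Progress E u v T (A ++ [u]) (v :: B) cs l₁ T₁)
    (hF : Frame E u v T (A ++ [u]) (v :: B) cs) (hB : Budget p t E r q G X rate)
    (hC : Crossing E r u v) (hl : cs = l₁ ++ c :: l₂)
    (hs : Steps E c.1 c.2 (T₁ c.1) (T₁ c.2) T₁ T₂) (hI : B = [] → ClearIn E T u v)
    (hmem : ∀ w ∈ B, E w v ∧ T u < T w) (hf : f₂ = true → ClearIn E T u v) {ρ : ℝ}
    (hρ : ρ = 0 ∨ (f₂ = false ∧ (∀ w, E w v → T u < T w → w ∈ B) ∧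
      ∃ i ≤ p, ρ = rate i ∧ (T v : ℕ) ≤ T u + t (i + 1))) :
    weight (decide (c.2 = v ∧ B = [])) (ClearIn E T₁ c.1 c.2) * (X T₂ - X T₁) +
      ρ * (((T₁ v : ℕ) : ℝ) - (T₂ v : ℕ)) ≤
      weight f₂ (ClearIn E T u v) * (X T₂ - X T₁) := by
  have hccs : c ∈ cs := by rw [hl]; simp
  obtain ⟨hcu, hcv, hclt⟩ := (hF.schedule.mem c.1 c.2).mp hccs
  have hT₁ : Topo E T₁ := hP.steps.topo hF.topo
  have hCc : Crossing E r c.1 c.2 := hC.mono (hF.reach_us _ hcu) (hF.reach_vs _ hcv)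
  have hmono : 0 ≤ X T₂ - X T₁ := sub_nonneg.mpr (hB.mono hCc hT₁ hs)
  obtain ⟨b1, b2, b3, b4⟩ := hP.bounds hF hccs
  have hdisp : ρ * (((T₁ v : ℕ) : ℝ) - (T₂ v : ℕ)) ≤ X T₂ - X T₁ := by
    rcases hρ with rfl | ⟨-, -, i, hi, rfl, hd⟩
    · simpa using hmono
    · refine le_trans ?_ (hB.disp hi hCc hT₁ hs ?_ v)
      · rw [abs_sub_comm]
        exact mul_le_mul_of_nonneg_left (le_abs_self _) (hB.rate_nonneg i hi)
      · have h1 : (T u : ℕ) ≤ T₁ c.1 := Fin.le_def.mp (b1.trans b2)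
        have h2 : (T₁ c.2 : ℕ) ≤ T v := Fin.le_def.mp (b3.trans b4)
        omega
  by_cases hB0 : B = []
  · subst hB0
    have hcv' : c.2 = v := by simpa using hcv
    have hdec : decide (c.2 = v ∧ ([] : List (Fin n)) = []) = true := by simp [hcv']
    rw [hdec, weight_true]
    rcases f₂ with _ | _
    · rw [weight_of_prop (hI rfl)]; linarith
    · rcases hρ with rfl | ⟨h, -⟩
      · simp [weight_true]
      · simp at h
  · have hdec : decide (c.2 = v ∧ B = []) = false := by simp [hB0]
    obtain ⟨w, hw⟩ := List.exists_mem_of_ne_nil B hB0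
    have hnc : ¬ ClearIn E T u v := fun h => (h w (hmem w hw).1).not_gt (hmem w hw).2
    have hf0 : f₂ = false := by
      rcases f₂ with _ | _
      · rfl
      · exact absurd (hf rfl) hnc
    rw [hdec, hf0, weight_of_not hnc]
    have h2 := mul_le_mul_of_nonneg_right (weight_le_two false (ClearIn E T₁ c.1 c.2)) hmono
    by_cases hcv' : c.2 = v
    · rcases hρ with rfl | ⟨-, hcomp, -⟩
      · linarith
      · have := hP.clearIn_of_complete hF hl hcv' (fun w h1 h2 => by simp [hcomp w h1 h2])
        rw [hcv', weight_of_prop this]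
        linarith
    · have hfix : T₂ v = T₁ v := by
        refine hs.fixed (fun h => ?_) (fun h => ?_)
        · exact hF.acyclic ((hF.reach_us _ hcu).trans h)
        · exact hcv' (T.injective (le_antisymm (hF.topo.le (hF.reach_vs _ hcv))
            (hF.topo.le h)))
      rw [hfix]
      linarith

/-- A bound for the depth of the recursion. -/
noncomputable def depth (r : Fin n → Fin n → Prop) (T : Fin n ≃ Fin n) (u v : Fin n) : ℕ :=
  (n ^ 2 - (settled r T).card) * (n + 1) + ((T v : ℕ) - T u)

/-- A call for another pair starts with a strictly smaller distance, and settled pairs never get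
lost. A call for the same pair (u, v) comes after some other call, which has settled a new pair;
this outweighs any distance because of the factor n + 1. -/
theorem Progress.depth_lt (hP : Progress E u v T (A ++ [u]) (v :: B) cs l₁ T₁)
    (hF : Frame E u v T (A ++ [u]) (v :: B) cs) (hC : Crossing E r u v)
    (hl : cs = l₁ ++ c :: l₂) (hAB : ¬ (A = [] ∧ B = []))
    (hmemA : ∀ w ∈ A, E u w ∧ T w < T v) (hmemB : ∀ w ∈ B, E w v ∧ T u < T w) :
    depth r T₁ c.1 c.2 < depth r T u v := by
  have hccs : c ∈ cs := by rw [hl]; simp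
  obtain ⟨hcu, hcv, hclt⟩ := (hF.schedule.mem c.1 c.2).mp hccs
  obtain ⟨b1, b2, b3, b4⟩ := hP.bounds hF hccs
  have hb1 : (T u : ℕ) ≤ T₁ c.1 := Fin.le_def.mp (b1.trans b2)
  have hb2 : (T₁ c.2 : ℕ) ≤ T v := Fin.le_def.mp (b3.trans b4)
  have hcl : (T c.1 : ℕ) < T c.2 := hclt
  have huv : (T u : ℕ) < T v := Fin.lt_def.mp (b1.trans_lt (hclt.trans_le b4))
  unfold depth
  by_cases hc : c = (u, v)
  · have hne : T ≠ T₁ := by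
      rintro rfl
      have : ∃ c' ∈ l₁, T c'.1 < T c'.2 := by
        rcases not_and_or.mp hAB with h0 | h0
        · obtain ⟨w, hw⟩ := List.exists_mem_of_ne_nil A h0
          obtain ⟨h1, h2⟩ := hmemA w hw
          refine ⟨(w, v), hF.schedule.mem_done hl ((hF.schedule.mem _ _).mpr
            ⟨by simp [hw], by simp, h2⟩) (Or.inl ?_), h2⟩
          rw [hc]; exact hF.topo _ _ h1
        · obtain ⟨w, hw⟩ := List.exists_mem_of_ne_nil B h0
          obtain ⟨h1, h2⟩ := hmemB w hw
          refine ⟨(u, w), hF.schedule.mem_done hl ((hF.schedule.mem _ _).mpr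
            ⟨by simp, by simp [hw], h2⟩) (Or.inr ⟨by rw [hc], ?_⟩), h2⟩
          rw [hc]; exact hF.topo _ _ h1
      obtain ⟨c', hc', hlt⟩ := this
      exact (hP.flipped c' hc').not_gt hlt
    have h1 := hP.steps.card_settled_lt hC hF.topo hne
    have h2 := card_settled_le_sq r T₁
    have h3 : n ^ 2 - (settled r T₁).card + 1 ≤ n ^ 2 - (settled r T).card := by omega
    have h4 := Nat.mul_le_mul_right (n + 1) h3
    have h5 := (T₁ c.2).2
    rw [add_mul] at h4
    omega
  · have h1 := hP.steps.card_settled_le hC hF.topo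
    have h3 : n ^ 2 - (settled r T₁).card ≤ n ^ 2 - (settled r T).card := by omega
    have h4 := Nat.mul_le_mul_right (n + 1) h3
    have h5 : (T u : ℕ) < T₁ c.1 ∨ (T₁ c.2 : ℕ) < T v := by
      by_cases hc1 : c.1 = u
      · right
        have hc2 : c.2 ≠ v := fun h => hc (Prod.ext hc1 h)
        exact Fin.lt_def.mp (b3.trans_lt (lt_of_le_of_ne b4 fun h => hc2 (T.injective h)))
      · left
        exact Fin.lt_def.mp ((lt_of_le_of_ne b1 fun h => hc1 (T.injective h.symm)).trans_le b2)
    omega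

/-- A counting sort on this side means that u has no out-neighbour within `t i`, so u must move by
more than `t i` in order to get past v. The rate ρ is chosen before the recursive calls are run, so
that their loop invariant can refer to it. -/
theorem charge_out (hB : Budget p t E r q G X rate) {cA : ℕ}
    (hcost : cA = 0 ∨ (f₁ = false ∧ (∀ w, E u w → T w < T v → w ∈ A) ∧
    ∃ i ≤ p, (T u : ℕ) + t i < T v ∧ (T v : ℕ) ≤ T u + t (i + 1) ∧
      (∀ w, E u w → (T u : ℕ) + t i < T w) ∧ cA ≤ 7 * t (i + 1) + 3)) :
    ∃ ρ : ℝ, (ρ = 0 ∨ (f₁ = false ∧ (∀ w, E u w → T w < T v → w ∈ A) ∧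
      ∃ i ≤ p, ρ = rate i ∧ (T v : ℕ) ≤ T u + t (i + 1))) ∧
      ∀ T', Steps E u v (T u) (T v) T T' → Topo E T → ¬ ReflTransGen E u v → T' v < T' u →
        (cA : ℝ) ≤ ρ * (((T' u : ℕ) : ℝ) - (T u : ℕ)) := by
  rcases hcost with rfl | ⟨h1, h2, i, hi, h3, h4, h5, h6⟩
  · exact ⟨0, Or.inl rfl, by simp⟩
  · refine ⟨rate i, Or.inr ⟨h1, h2, i, hi, rfl, h4⟩, fun T' hs hT hac hf => ?_⟩
    have h7 := hs.lt_left hT hac h5 h3 hf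
    have h8 : ((T u : ℕ) : ℝ) + t i + 1 ≤ (T' u : ℕ) := by exact_mod_cast h7
    calc (cA : ℝ) ≤ ((7 * t (i + 1) + 3 : ℕ) : ℝ) := by exact_mod_cast h6
      _ ≤ rate i * ((t i : ℝ) + 1) := hB.rate_le i hi
      _ ≤ _ := mul_le_mul_of_nonneg_left (by linarith) (hB.rate_nonneg i hi)

theorem charge_in (hB : Budget p t E r q G X rate) {cB : ℕ}
    (hcost : cB = 0 ∨ (f₂ = false ∧ (∀ w, E w v → T u < T w → w ∈ B) ∧
    ∃ i ≤ p, (T u : ℕ) + t i < T v ∧ (T v : ℕ) ≤ T u + t (i + 1) ∧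
      (∀ w, E w v → (T w : ℕ) + t i < T v) ∧ cB ≤ 7 * t (i + 1) + 3)) :
    ∃ ρ : ℝ, (ρ = 0 ∨ (f₂ = false ∧ (∀ w, E w v → T u < T w → w ∈ B) ∧
      ∃ i ≤ p, ρ = rate i ∧ (T v : ℕ) ≤ T u + t (i + 1))) ∧
      ∀ T', Steps E u v (T u) (T v) T T' → Topo E T → ¬ ReflTransGen E u v → T' v < T' u →
        (cB : ℝ) ≤ ρ * (((T v : ℕ) : ℝ) - (T' v : ℕ)) := by
  rcases hcost with rfl | ⟨h1, h2, i, hi, h3, h4, h5, h6⟩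
  · exact ⟨0, Or.inl rfl, by simp⟩
  · refine ⟨rate i, Or.inr ⟨h1, h2, i, hi, rfl, h4⟩, fun T' hs hT hac hf => ?_⟩
    have h7 := hs.lt_right hT hac (m := T v - t i) (fun w hw => by have := h5 w hw; omega)
      (by omega) hf
    have h8 : ((T' v : ℕ) : ℝ) + t i + 1 ≤ (T v : ℕ) := by
      have : (T' v : ℕ) + t i + 1 ≤ T v := by omega
      exact_mod_cast this
    calc (cB : ℝ) ≤ ((7 * t (i + 1) + 3 : ℕ) : ℝ) := by exact_mod_cast h6
      _ ≤ rate i * ((t i : ℝ) + 1) := hB.rate_le i hi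
      _ ≤ _ := mul_le_mul_of_nonneg_left (by linarith) (hB.rate_nonneg i hi)

/-- Each call leaves 2q steps of credit. An exchange brings 3q beyond its own cost and its call
spends q. A call with k ≥ 2 children collects 2qk from them and spends qk, so qk ≥ 2q remain.
Counting sorts at the levels above 0 are paid separately, by the weighted growth of `X`. -/
theorem Inv.runs_reorder (hB : Budget p t E r q G X rate) (ht : n ≤ t (p + 1)) (fuel : ℕ)
    {s : Mem n} (h : Inv p t E s) {u v : Fin n} {f₁ f₂ : Bool} (hC : Crossing E r u v)
    (huv : s.pos u < s.pos v) (hf₁ : f₁ = true → ClearOut E s.pos u v)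
    (hf₂ : f₂ = true → ClearIn E s.pos u v) (hfuel : depth r s.pos u v < fuel) :
    ∃ s', Runs (reorder p t fuel u v f₁ f₂) s () s' ∧ Inv p t E s' ∧
      Steps E u v (s.pos u) (s.pos v) s.pos s'.pos ∧ s'.pos v < s'.pos u ∧
      (s'.clock : ℝ) ≤ s.clock + (G s'.pos - G s.pos) - 2 * q +
        weight f₁ (ClearOut E s.pos u v) * (X s'.pos - X s.pos) +
        weight f₂ (ClearIn E s.pos u v) * (X s'.pos - X s.pos) := by
  induction fuel generalizing s u v f₁ f₂ with
  | zero => omega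
  | succ fuel ih =>
    have hE : ¬ E u v := fun hE => hC.acyclic (.single hE)
    obtain ⟨A, B, c, cA, cB, r₁, hN, hc⟩ := (h.setClock (s.clock + 1)).runs_nearSets huv hE ht
      hf₁ hf₂
    obtain ⟨ρA, hρA, hchA⟩ := charge_out hB hN.costA
    obtain ⟨ρB, hρB, hchB⟩ := charge_in hB hN.costB
    dsimp only at *
    have hstart : ∀ {s''}, Runs (if A = [] ∧ B = [] then swapVertices p t u v
        else do
          let cs ← timed (schedule s.pos (v :: B) (A ++ [u]))
          tick (A.length + cs.length)
          cs.forM fun c =>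
            reorder p t fuel c.1 c.2 (decide (c.1 = u ∧ A = [])) (decide (c.2 = v ∧ B = [])))
        { s with clock := s.clock + 1 + c } () s'' →
        Runs (reorder p t (fuel + 1) u v f₁ f₂) s () s'' := by
      intro s'' hr
      refine (Runs.tick 1 s).bind ((Runs.get _).bind ?_)
      rw [if_neg (by simpa using huv)]
      exact r₁.bind hr
    have hbase := hB.base
    have hI := h.setClock (s.clock + 1 + c)
    by_cases hAB : A = [] ∧ B = []
    · have ho := hN.clearA hAB.1
      have hi := hN.clearB hAB.2
      have hstep : Step E u v (s.pos u) (s.pos v) s.pos ((Equiv.swap u v).trans s.pos) :=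
        ⟨u, v, .refl, .refl, le_rfl, huv, le_rfl, ho, hi, rfl⟩
      obtain ⟨s', r₂, hI', hpos, hclock⟩ := hI.runs_swapVertices huv ho hi (hstep.topo h.topo)
      have hflip : s'.pos v < s'.pos u := by rw [hpos]; simpa using huv
      have hsteps : Steps E u v (s.pos u) (s.pos v) s.pos s'.pos := by
        rw [hpos]; exact .single hstep
      refine ⟨s', hstart (by rw [if_pos hAB]; exact r₂), hI', hsteps, hflip, ?_⟩
      have hswap := hB.swap hC h.topo huv ho hi
      rw [← hpos] at hswap
      have hmono := hB.mono hC h.topo hsteps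
      have hA : (cA : ℝ) ≤ weight f₁ (ClearOut E s.pos u v) * (X s'.pos - X s.pos) := by
        refine (hchA _ hsteps h.topo hC.acyclic hflip).trans ?_
        rcases hρA with rfl | ⟨rfl, -, i, hip, rfl, hd⟩
        · rw [zero_mul]
          exact mul_nonneg (by unfold weight; split_ifs <;> norm_num) (by linarith)
        · rw [weight_of_prop ho, one_mul]
          exact (mul_le_mul_of_nonneg_left (le_abs_self _) (hB.rate_nonneg i hip)).trans
            (hB.disp hip hC h.topo hsteps hd u)
      have hB' : (cB : ℝ) ≤ weight f₂ (ClearIn E s.pos u v) * (X s'.pos - X s.pos) := by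
        refine (hchB _ hsteps h.topo hC.acyclic hflip).trans ?_
        rcases hρB with rfl | ⟨rfl, -, i, hip, rfl, hd⟩
        · rw [zero_mul]
          exact mul_nonneg (by unfold weight; split_ifs <;> norm_num) (by linarith)
        · rw [weight_of_prop hi, one_mul, ← neg_sub]
          exact (mul_le_mul_of_nonneg_left (neg_le_abs _) (hB.rate_nonneg i hip)).trans
            (hB.disp hip hC h.topo hsteps hd v)
      rw [hAB.1, hAB.2] at hc
      have hc' : s'.clock ≤ s.clock + q + cA + cB + swapCost n p (s.pos v - s.pos u) := by
        dsimp only at hclock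
        simp only [List.length_nil] at hc
        omega
      have hc'' : (s'.clock : ℝ) ≤ s.clock + q + cA + cB + swapCost n p (s.pos v - s.pos u) := by
        exact_mod_cast hc'
      linarith
    · have hdecA : Decreasing s.pos (A ++ [u]) := by
        refine List.pairwise_append.mpr ⟨hN.decA, by simp, ?_⟩
        intro a ha b hb
        rw [List.mem_singleton] at hb; subst hb
        exact h.topo _ _ (hN.memA a ha).1
      have hdecB : Decreasing s.pos (v :: B) :=
        List.pairwise_cons.mpr ⟨fun b hb => h.topo _ _ (hN.memB b hb).1, hN.decB⟩
      have hS := isSchedule_schedule hdecB hdecA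
      have htime := (schedule_eq s.pos (v :: B) (A ++ [u]) hdecB).2
      have hF : Frame E u v s.pos (A ++ [u]) (v :: B)
          (schedule s.pos (v :: B) (A ++ [u])).ret := by
        refine ⟨h.topo, hC.acyclic, ?_, ?_, hS⟩
        · intro x hx
          rcases List.mem_append.mp hx with hx | hx
          · exact .single (hN.memA x hx).1
          · rw [List.mem_singleton] at hx; subst hx; exact .refl
        · intro y hy
          rcases List.mem_cons.mp hy with rfl | hy
          · exact .refl
          · exact .single (hN.memB y hy).1
      have hlen := hS.le_length hdecA hdecB huv (fun w hw => (hN.memA w hw).2)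
        (fun w hw => (hN.memB w hw).2)
      generalize hcs : (schedule s.pos (v :: B) (A ++ [u])).ret = cs at *
      generalize hct : (schedule s.pos (v :: B) (A ++ [u])).time = ct at *
      set s₀ : Mem n := { s with clock := s.clock + 1 + c + ct + (A.length + cs.length) } with hs₀
      -- The invariant sets aside ρ times the movement made so far by u and by v. When the loop is
      -- over, these reserves pay for `cA` and `cB`.
      obtain ⟨s', r₂, hI', hP', hclock⟩ := runs_forM
        (fun l s' => Inv p t E s' ∧ Progress E u v s.pos (A ++ [u]) (v :: B) cs l s'.pos ∧
          (s'.clock : ℝ) ≤ s₀.clock + (G s'.pos - G s.pos) - 2 * q * l.length +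
            (weight f₁ (ClearOut E s.pos u v) * (X s'.pos - X s.pos) -
              ρA * (((s'.pos u : ℕ) : ℝ) - (s.pos u : ℕ))) +
            (weight f₂ (ClearIn E s.pos u v) * (X s'.pos - X s.pos) -
              ρB * (((s.pos v : ℕ) : ℝ) - (s'.pos v : ℕ))))
        (fun c => reorder p t fuel c.1 c.2 (decide (c.1 = u ∧ A = []))
          (decide (c.2 = v ∧ B = []))) cs s₀ (by
          rintro l₁ ⟨x, y⟩ l₂ s₁ hl ⟨hI₁, hP₁, hc₁⟩
          have hccs : (x, y) ∈ cs := by rw [hl]; simp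
          have hcn : (x, y) ∉ l₁ := by
            intro hc
            have := hS.nodup
            rw [hl, List.nodup_append] at this
            exact this.2.2 _ hc _ (by simp) rfl
          obtain ⟨hxu, hyv, -⟩ := (hS.mem x y).mp hccs
          have hdepth := hP₁.depth_lt hF hC hl hAB hN.memA hN.memB
          obtain ⟨s₂, r₂, hI₂, hst₂, hfl₂, hc₂⟩ := ih (f₁ := decide (x = u ∧ A = []))
            (f₂ := decide (y = v ∧ B = [])) hI₁
            (hC.mono (hF.reach_us _ hxu) (hF.reach_vs _ hyv)) (hP₁.pending _ hccs hcn)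
            (fun hd => by
              rw [decide_eq_true_eq] at hd
              rw [hd.1]
              exact hP₁.clearOut hF hccs (hN.clearA hd.2))
            (fun hd => by
              rw [decide_eq_true_eq] at hd
              rw [hd.1]
              exact hP₁.clearIn hF hccs (hN.clearB hd.2))
            (by dsimp only at hdepth; omega)
          refine ⟨s₂, r₂, hI₂, hP₁.next hF hl hst₂ hfl₂, ?_⟩
          have hw₁ := hP₁.weight_out hF hB hC hl hst₂ hN.clearA hN.memA hf₁ hρA
          have hw₂ := hP₁.weight_in hF hB hC hl hst₂ hN.clearB hN.memB hf₂ hρB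
          dsimp only at hw₁ hw₂
          rw [List.length_append, List.length_singleton]
          push_cast
          linarith)
        ⟨h.setClock _, Progress.start hF, by simp [hs₀]⟩
      have huvcs : (u, v) ∈ cs := (hS.mem u v).mpr ⟨by simp, by simp, huv⟩
      have hflip := hP'.flipped _ huvcs
      refine ⟨s', hstart ?_, hI', hP'.steps, hflip, ?_⟩
      · rw [if_neg hAB]
        refine (Runs.timed _ _).bind ((Runs.tick _ _).bind ?_)
        rw [hcs, hct]
        exact r₂
      · have hA := hchA _ hP'.steps h.topo hC.acyclic hflip
        have hB' := hchB _ hP'.steps h.topo hC.acyclic hflip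
        -- One unit `q` per child covers the work of the call itself, as the sizes of A and B add up
        -- to less than the number of children.
        have h1 : 1 + c + ct + (A.length + cs.length) ≤ q * cs.length + cA + cB := by
          have e1 : (A.length + B.length) * (SearchTree.maxHeight n + 8) ≤
              (cs.length - 1) * (SearchTree.maxHeight n + 8) :=
            Nat.mul_le_mul_right _ (by omega)
          obtain ⟨k, hk⟩ : ∃ k, cs.length = k + 1 := ⟨cs.length - 1, by omega⟩
          have e2 : (p + 14 * t 0 + SearchTree.maxHeight n + 28) * (k + 1) ≤ q * (k + 1) :=
            Nat.mul_le_mul_right _ hbase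
          have e3 : (p + 14 * t 0) * 1 ≤ (p + 14 * t 0) * (k + 1) :=
            Nat.mul_le_mul_left _ (by omega)
          simp only [List.length_append, List.length_singleton] at htime
          rw [hk, Nat.add_sub_cancel] at e1
          rw [hk] at htime hlen ⊢
          nlinarith
        -- Branching at least twice is what keeps the number of calls proportional to the number of
        -- exchanges.
        have h2 : 2 ≤ cs.length := by
          have : A.length + B.length ≠ 0 := fun h0 => hAB
            ⟨List.eq_nil_of_length_eq_zero (by omega), List.eq_nil_of_length_eq_zero (by omega)⟩
          omega
        have h3 : ((1 + c + ct + (A.length + cs.length) : ℕ) : ℝ) ≤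
            ((q * cs.length + cA + cB : ℕ) : ℝ) := by exact_mod_cast h1
        have h4 : (s₀.clock : ℝ) = s.clock + ((1 + c + ct + (A.length + cs.length) : ℕ) : ℝ) := by
          simp only [hs₀]; push_cast; ring
        have h5 : (2 : ℝ) ≤ cs.length := by exact_mod_cast h2
        have h6 : (q : ℝ) * 2 ≤ q * cs.length := mul_le_mul_of_nonneg_left h5 (by positivity)
        push_cast at h3 h4
        linarith

end Reorder

/-! ### From one insertion to the whole sequence. -/

section Session

variable {n : ℕ}

/-- Reachability in an acyclic graph is a partial order. It extends to a linear order, in which each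
vertex is numbered by its strict predecessors. -/
theorem exists_topo (E : Fin n → Fin n → Prop) (hE : ∀ x, ¬ TransGen E x x) :
    ∃ S : Fin n ≃ Fin n, Topo E S := by
  classical
  have hpo : IsPartialOrder (Fin n) (ReflTransGen E) :=
    { refl := fun _ => .refl
      trans := fun _ _ _ => .trans
      antisymm := fun a b hab hba => by
        rcases ReflTransGen.cases_head hab with h | ⟨c, hac, hcb⟩
        · exact h
        · exact absurd (TransGen.head' hac (hcb.trans hba)) (hE a) }
  obtain ⟨s, hs, hle⟩ := extend_partialOrder (ReflTransGen E)
  have htrans : ∀ a b c, s a b → s b c → s a c := fun a b c => hs.trans a b c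
  have hanti : ∀ a b, s a b → s b a → a = b := fun a b => hs.antisymm a b
  have hlt : ∀ x y, s x y → x ≠ y → (Finset.univ.filter fun z => s z x ∧ z ≠ x).card <
      (Finset.univ.filter fun z => s z y ∧ z ≠ y).card := by
    intro x y hxy hne
    apply Finset.card_lt_card
    rw [Finset.ssubset_iff_of_subset]
    · refine ⟨x, by simp [hxy, hne], by simp⟩
    · intro z hz
      simp only [Finset.mem_filter, Finset.mem_univ, true_and] at hz ⊢
      refine ⟨htrans _ _ _ hz.1 hxy, ?_⟩
      rintro rfl
      exact hne (hanti _ _ hxy hz.1)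
  have hn : ∀ x, (Finset.univ.filter fun z => s z x ∧ z ≠ x).card < n := by
    intro x
    calc _ < (Finset.univ : Finset (Fin n)).card := by
          apply Finset.card_lt_card
          rw [Finset.ssubset_iff_of_subset (Finset.subset_univ _)]
          exact ⟨x, by simp, by simp⟩
      _ = n := by simp
  have hinj : Function.Injective fun x : Fin n =>
      (⟨(Finset.univ.filter fun z => s z x ∧ z ≠ x).card, hn x⟩ : Fin n) := by
    intro x y hxy
    by_contra hne
    have hxy' := Fin.mk.inj_iff.mp hxy
    rcases hs.total x y with h | h
    · exact (hlt x y h hne).ne hxy'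
    · exact (hlt y x h (Ne.symm hne)).ne hxy'.symm
  refine ⟨Equiv.ofBijective _ (Finite.injective_iff_bijective.mp hinj), fun x y hxy => ?_⟩
  have hne : x ≠ y := by rintro rfl; exact hE x (.single hxy)
  exact hlt x y (hle _ _ (.single hxy)) hne

/-- A path that starts at a descendant of b cannot use the new edge a → b, for then b would reach a
and close a cycle; paths ending at ancestors of a are alike. -/
theorem crossing_addEdge {E : Fin n → Fin n → Prop} {a b : Fin n}
    (hac : ∀ x, ¬ TransGen (addEdge E a b) x x) : Crossing E (TransGen (addEdge E a b)) b a := by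
  have hmono : ∀ {x y}, ReflTransGen E x y → ReflTransGen (addEdge E a b) x y := by
    intro x y h
    induction h with
    | refl => exact .refl
    | tail _ h ih => exact ih.tail (Or.inl h)
  have hab : addEdge E a b a b := Or.inr ⟨rfl, rfl⟩
  have hba : ¬ ReflTransGen E b a := fun h => hac a (TransGen.head' hab (hmono h))
  refine ⟨hba, fun x y hx hy => ?_, fun x z hx hxz => ?_, fun z y hy hzy => ?_⟩
  · exact TransGen.trans_left (TransGen.tail' (hmono hy) hab) (hmono hx)
  · induction hxz with
    | single h =>
      rcases h with h | ⟨rfl, rfl⟩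
      · exact .single h
      · exact absurd hx hba
    | tail _ h ih =>
      rcases h with h | ⟨rfl, rfl⟩
      · exact ih.tail h
      · exact absurd (hx.trans ih) hba
  · induction hzy using TransGen.head_induction_on with
    | single h =>
      rcases h with h | ⟨rfl, rfl⟩
      · exact .single h
      · exact absurd hy hba
    | head h _ ih =>
      rcases h with h | ⟨rfl, rfl⟩
      · exact ReflTransGen.head h ih
      · exact absurd (ih.trans hy) hba

/-- The potential that pays for the exchanges and for `q` steps per settled pair. -/
noncomputable def swapPotential (p q : ℕ) (S : Fin n ≃ Fin n) (r : Fin n → Fin n → Prop)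
    (T : Fin n ≃ Fin n) : ℝ :=
  3 * q * (settled r T).card + swapCost n p 1 * potential r S n T

/-- The potential that pays for the counting sorts at the levels above `0`. -/
noncomputable def sortPotential (p : ℕ) (t : ℕ → ℝ) (S : Fin n ≃ Fin n)
    (r : Fin n → Fin n → Prop) (T : Fin n ≃ Fin n) : ℝ :=
  ∑ i ∈ Finset.range (p + 1), 10 * t (i + 1) / t i * potential r S (t (i + 1)) T

variable {p q : ℕ} {t : ℕ → ℝ} {S : Fin n ≃ Fin n} {E r : Fin n → Fin n → Prop}

theorem swapCost_le (n p : ℕ) {d : ℕ} (hd : 1 ≤ d) : swapCost n p d ≤ swapCost n p 1 * d := by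
  obtain ⟨k, rfl⟩ := Nat.exists_eq_add_of_le hd
  unfold swapCost levelCost
  nlinarith [Nat.zero_le ((p + 2) * k), Nat.zero_le k]

theorem budget (hn : 0 < n) (ht : ∀ i ≤ p + 1, 1 ≤ t i) (hS : ∀ x y, r x y → S x < S y)
    (hq : p + 14 * ⌊t 0⌋₊ + SearchTree.maxHeight n + 28 ≤ q) :
    Budget p (fun i => ⌊t i⌋₊) E r q (swapPotential p q S r) (sortPotential p t S r)
      (fun i => 10 * t (i + 1) / t i) := by
  have hpos : ∀ i ≤ p + 1, 0 < t i := fun i hi => one_pos.trans_le (ht i hi)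
  have hterm : ∀ {u v lo hi : Fin n} {T T' : Fin n ≃ Fin n}, Crossing E r u v → Topo E T →
      Steps E u v lo hi T T' → ∀ i ∈ Finset.range (p + 1),
      0 ≤ 10 * t (i + 1) / t i * (potential r S (t (i + 1)) T' - potential r S (t (i + 1)) T) := by
    intro u v lo hi T T' hC hT hs i hi
    rw [Finset.mem_range] at hi
    have h1 := hpos (i + 1) (by omega)
    have h2 := hpos i (by omega)
    exact mul_nonneg (by positivity) (sub_nonneg.mpr (hs.potential_le hC hT hS h1))
  have hdiff : ∀ T T', sortPotential p t S r T' - sortPotential p t S r T =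
      ∑ i ∈ Finset.range (p + 1), 10 * t (i + 1) / t i *
        (potential r S (t (i + 1)) T' - potential r S (t (i + 1)) T) := by
    intro T T'
    simp only [sortPotential, ← Finset.sum_sub_distrib, mul_sub]
  refine ⟨?_, ?_, ?_, ?_, ?_, hq⟩
  · intro u v lo hi T T' hC hT hs
    rw [← sub_nonneg, hdiff]
    exact Finset.sum_nonneg (hterm hC hT hs)
  · intro u v lo hi T T' i hi hC hT hs hd z
    have h1 := hpos (i + 1) (by omega)
    have h2 := hpos i (by omega)
    rw [hdiff]
    refine le_trans ?_ (Finset.single_le_sum (hterm hC hT hs)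
      (Finset.mem_range.mpr (Nat.lt_succ_of_le hi)))
    refine mul_le_mul_of_nonneg_left (hs.abs_sub_le hC hT hS h1 ?_ z) (by positivity)
    have h3 : ((_ : ℕ) : ℝ) ≤ ((_ + ⌊t (i + 1)⌋₊ : ℕ) : ℝ) := Nat.cast_le.mpr hd
    have h4 := Nat.floor_le h1.le
    push_cast at h3
    linarith
  · intro i hi
    have h1 := hpos (i + 1) (by omega)
    have h2 := hpos i (by omega)
    positivity
  · intro i hi
    have h1 := ht (i + 1) (by omega)
    have h2 := hpos i (by omega)
    have h3 := Nat.floor_le (zero_le_one.trans h1)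
    -- Moving past the integer threshold means moving by at least the real one. The constant 10 is 7
    -- + 3, with the 3 absorbed by `t (i + 1)` being at least one.
    have h4 : t i ≤ (⌊t i⌋₊ : ℝ) + 1 := (Nat.lt_floor_add_one _).le
    push_cast
    calc 7 * (⌊t (i + 1)⌋₊ : ℝ) + 3 ≤ 10 * t (i + 1) := by linarith
      _ = 10 * t (i + 1) / t i * t i := by field_simp
      _ ≤ _ := mul_le_mul_of_nonneg_left h4 (by positivity)
  · intro x y T hC hT hxy ho hi
    have hstep : Step E x y (T x) (T y) T ((Equiv.swap x y).trans T) :=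
      ⟨x, y, .refl, .refl, le_rfl, hxy, le_rfl, ho, hi, rfl⟩
    have h1 := hstep.card_settled_lt hC hT
    -- At the scale n every window is short enough, so this potential pays for all exchanges.
    have h2 := (hstep.potential_le hC hT hS (t := n) (by exact_mod_cast hn)).2 (by
      have e1 : ((T y : ℕ) : ℝ) ≤ n := by exact_mod_cast (T y).2.le
      have e2 : (0 : ℝ) ≤ ((T x : ℕ) : ℝ) := by positivity
      linarith) x
    have h3 : ((T y : ℕ) : ℝ) - (T x : ℕ) ≤
        potential r S n ((Equiv.swap x y).trans T) - potential r S n T := by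
      refine le_trans (le_abs_self _) ?_
      simpa using h2
    have hlt : (T x : ℕ) < T y := hxy
    have h4 := swapCost_le n p (d := (T y : ℕ) - T x) (by omega)
    have h4' : (swapCost n p ((T y : ℕ) - T x) : ℝ) ≤
        swapCost n p 1 * (((T y : ℕ) : ℝ) - (T x : ℕ)) := by
      rw [← Nat.cast_sub hlt.le]; exact_mod_cast h4
    have h5 : ((settled r T).card : ℝ) + 1 ≤ (settled r ((Equiv.swap x y).trans T)).card := by
      exact_mod_cast h1
    have h6 := mul_le_mul_of_nonneg_left h3 (by positivity : (0 : ℝ) ≤ swapCost n p 1)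
    have h7 := mul_le_mul_of_nonneg_left h5 (by positivity : (0 : ℝ) ≤ 3 * (q : ℝ))
    unfold swapPotential
    linarith

theorem swapPotential_mono (hn : 0 < n) {r' : Fin n → Fin n → Prop}
    (h : ∀ x y, r x y → r' x y) (T : Fin n ≃ Fin n) :
    swapPotential p q S r T ≤ swapPotential p q S r' T := by
  have h1 : ((settled r T).card : ℝ) ≤ (settled r' T).card := by
    exact_mod_cast Finset.card_le_card (settled_mono h)
  have h2 : potential r S n T ≤ potential r' S n T :=
    potential_mono h (by exact_mod_cast hn)
  unfold swapPotential
  gcongr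

theorem sortPotential_mono (ht : ∀ i ≤ p + 1, 1 ≤ t i) {r' : Fin n → Fin n → Prop}
    (h : ∀ x y, r x y → r' x y) (T : Fin n ≃ Fin n) :
    sortPotential p t S r T ≤ sortPotential p t S r' T := by
  refine Finset.sum_le_sum fun i hi => ?_
  rw [Finset.mem_range] at hi
  have h1 := one_pos.trans_le (ht (i + 1) (by omega))
  have h2 := one_pos.trans_le (ht i (by omega))
  exact mul_le_mul_of_nonneg_left (potential_mono h h1) (by positivity)

/-- Both weights are at most 2, which explains the factor 4. The bound on `fuel` is uniform: no
state has a greater `depth`. -/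
theorem Inv.runs_insert {s : Mem n} {a b : Fin n} {fuel : ℕ}
    (h : Inv p (fun i => ⌊t i⌋₊) E s) (hn : 0 < n) (ht : ∀ i ≤ p + 1, 1 ≤ t i)
    (htn : t (p + 1) = n) (hac : ∀ x, ¬ TransGen (addEdge E a b) x x)
    (hS : ∀ x y, TransGen (addEdge E a b) x y → S x < S y)
    (hq : p + 14 * ⌊t 0⌋₊ + SearchTree.maxHeight n + 28 ≤ q)
    (hfuel : n ^ 2 * (n + 1) + n < fuel) :
    ∃ s', Runs (insert p (fun i => ⌊t i⌋₊) fuel a b) s () s' ∧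
      Inv p (fun i => ⌊t i⌋₊) (addEdge E a b) s' ∧
      (s'.clock : ℝ) ≤ s.clock + (insertCost n p + 1) +
        (swapPotential p q S (TransGen (addEdge E a b)) s'.pos -
          swapPotential p q S (TransGen (addEdge E a b)) s.pos) +
        4 * (sortPotential p t S (TransGen (addEdge E a b)) s'.pos -
          sortPotential p t S (TransGen (addEdge E a b)) s.pos) := by
  have hab : a ≠ b := by rintro rfl; exact hac a (.single (Or.inr ⟨rfl, rfl⟩))
  by_cases hlt : s.pos b ≤ s.pos a
  · have hC := crossing_addEdge hac
    have hB := budget (E := E) (p := p) (q := q) (S := S) hn ht hS hq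
    have hlt' : s.pos b < s.pos a := lt_of_le_of_ne hlt fun h => hab (s.pos.injective h).symm
    obtain ⟨s₁, r₁, hI₁, hst, hfl, hc₁⟩ := (h.setClock (s.clock + 1)).runs_reorder hB
      (by simp [htn]) fuel (f₁ := false) (f₂ := false) hC hlt' (by simp) (by simp) (by
        have := (s.pos a).2
        have h3 : (n ^ 2 - (settled (TransGen (addEdge E a b)) s.pos).card) * (n + 1) ≤
          n ^ 2 * (n + 1) := Nat.mul_le_mul_right _ (Nat.sub_le _ _)
        unfold depth
        dsimp only
        omega)
    obtain ⟨s₂, r₂, hI₂, hpos, hc₂⟩ := hI₁.runs_insertEdge (u := a) (v := b) hfl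
    refine ⟨s₂, ?_, hI₂, ?_⟩
    · refine (Runs.tick 1 s).bind ((Runs.get _).bind ?_)
      rw [if_pos hlt]
      exact r₁.bind r₂
    · have hmono : 0 ≤ sortPotential p t S (TransGen (addEdge E a b)) s₁.pos -
          sortPotential p t S (TransGen (addEdge E a b)) s.pos :=
        sub_nonneg.mpr (hB.mono hC h.topo hst)
      have w₁ := mul_le_mul_of_nonneg_right
        (weight_le_two false (ClearOut E s.pos b a)) hmono
      have w₂ := mul_le_mul_of_nonneg_right
        (weight_le_two false (ClearIn E s.pos b a)) hmono
      have hc₂' : (s₂.clock : ℝ) ≤ s₁.clock + insertCost n p := by exact_mod_cast hc₂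
      rw [hpos]
      dsimp only at hc₁
      push_cast at hc₁
      have : (0 : ℝ) ≤ q := by positivity
      linarith
  · push Not at hlt
    obtain ⟨s₂, r₂, hI₂, hpos, hc₂⟩ := (h.setClock (s.clock + 1)).runs_insertEdge
      (u := a) (v := b) hlt
    refine ⟨s₂, ?_, hI₂, ?_⟩
    · refine (Runs.tick 1 s).bind ((Runs.get _).bind ?_)
      rw [if_neg (not_le.mpr hlt)]
      exact r₂
    · have hc₂' : (s₂.clock : ℝ) ≤ ((s.clock + 1 : ℕ) : ℝ) + insertCost n p := by
        exact_mod_cast hc₂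
      rw [hpos]
      push_cast at hc₂'
      dsimp only
      linarith

theorem Inv.congr {t : ℕ → ℕ} {E' : Fin n → Fin n → Prop} {s : Mem n} (h : Inv p t E s)
    (hE : ∀ x y, E x y ↔ E' x y) : Inv p t E' s := by
  have : E = E' := by ext x y; exact hE x y
  rwa [← this]

theorem transGen_mono {E' : Fin n → Fin n → Prop} (h : ∀ x y, E x y → E' x y) {x y : Fin n}
    (hxy : TransGen E x y) : TransGen E' x y := by
  induction hxy with
  | single h' => exact .single (h _ _ h')
  | tail _ h' ih => exact ih.tail (h _ _ h')

theorem addEdge_mem_append (l : List (Fin n × Fin n)) (a b : Fin n) :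
    addEdge (fun x y => (x, y) ∈ l) a b = fun x y => (x, y) ∈ l ++ [(a, b)] := by
  ext x y
  simp [addEdge]

theorem runs_session {E₀ es : List (Fin n × Fin n)} {T₀ : Fin n ≃ Fin n} (hn : 0 < n)
    (ht : ∀ i ≤ p + 1, 1 ≤ t i) (htn : t (p + 1) = n) (hT₀ : IsTopologicalOrder E₀ T₀)
    (hac : IsAcyclic (E₀ ++ es))
    (hq : p + 14 * ⌊t 0⌋₊ + SearchTree.maxHeight n + 28 ≤ q) :
    ∃ (fuel : ℕ) (s : Mem n) (S T : Fin n ≃ Fin n) (r : Fin n → Fin n → Prop),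
      Runs (session p (fun i => ⌊t i⌋₊) fuel E₀ es) (emptyMem T₀) () s ∧
      (∀ x y, r x y → S x < S y) ∧
      (s.clock : ℝ) ≤ es.length * (insertCost n p + 1) + swapPotential p q S r T +
        4 * sortPotential p t S r T := by
  -- One order of the final graph serves for all insertions; otherwise the potentials would not
  -- telescope.
  obtain ⟨S, hS⟩ := exists_topo _ hac
  have hS' : ∀ x y, TransGen (fun a b => (a, b) ∈ E₀ ++ es) x y → S x < S y := by
    intro x y h
    induction h with
    | single h => exact hS _ _ h
    | tail _ h ih => exact ih.trans (hS _ _ h)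
  obtain ⟨s₀, r₀, hI₀, hpos₀⟩ := runs_forM
    (fun l s => Inv p (fun i => ⌊t i⌋₊) (fun x y => (x, y) ∈ l) s ∧ s.pos = T₀)
    (fun e => insertEdge p (fun i => ⌊t i⌋₊) e.1 e.2) E₀ (emptyMem T₀) (by
      rintro l₁ ⟨a, b⟩ l₂ s hl ⟨hI, hpos⟩
      obtain ⟨s', r, hI', hpos', -⟩ := hI.runs_insertEdge (u := a) (v := b) (by
        rw [hpos]; exact hT₀ (a, b) (by rw [hl]; simp))
      rw [addEdge_mem_append] at hI'
      exact ⟨s', r, hI', hpos'.trans hpos⟩)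
    ⟨(Inv.emptyMem T₀).congr (by simp), rfl⟩
  have hrmono : ∀ {l₁ l₂ : List (Fin n × Fin n)}, l₁ ⊆ l₂ → ∀ x y,
      TransGen (fun x y => (x, y) ∈ l₁) x y → TransGen (fun x y => (x, y) ∈ l₂) x y :=
    fun h x y => transGen_mono fun _ _ h' => h h'
  have hpot₀ : ∀ (r : Fin n → Fin n → Prop) (T : Fin n ≃ Fin n),
      0 ≤ swapPotential p q S r T + 4 * sortPotential p t S r T := by
    intro r T
    have h1 : 0 ≤ swapPotential p q S r T := by
      have := potential_nonneg (r := r) (S := S) (T := T) (t := n) (by exact_mod_cast hn)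
      unfold swapPotential; positivity
    have h2 : 0 ≤ sortPotential p t S r T := by
      refine Finset.sum_nonneg fun i hi => ?_
      rw [Finset.mem_range] at hi
      have h1 := one_pos.trans_le (ht (i + 1) (by omega))
      have h2 := one_pos.trans_le (ht i (by omega))
      exact mul_nonneg (by positivity) (potential_nonneg h1)
    linarith
  obtain ⟨s, r, hI, hc⟩ := runs_forM
    (fun l s => Inv p (fun i => ⌊t i⌋₊) (fun x y => (x, y) ∈ E₀ ++ l) s ∧
      (s.clock : ℝ) ≤ l.length * (insertCost n p + 1) +
        swapPotential p q S (TransGen fun x y => (x, y) ∈ E₀ ++ l) s.pos +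
        4 * sortPotential p t S (TransGen fun x y => (x, y) ∈ E₀ ++ l) s.pos)
    (fun e => insert p (fun i => ⌊t i⌋₊) (n ^ 2 * (n + 1) + n + 1) e.1 e.2) es
    { s₀ with clock := 0 } (by
      rintro l₁ ⟨a, b⟩ l₂ s hl ⟨hI, hc⟩
      have hsub : E₀ ++ (l₁ ++ [(a, b)]) ⊆ E₀ ++ es := by
        intro e he
        simp only [hl, List.mem_append, List.mem_cons, List.not_mem_nil, or_false] at he ⊢
        tauto
      have hsub' : E₀ ++ l₁ ⊆ E₀ ++ (l₁ ++ [(a, b)]) := by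
        intro e he
        simp only [List.mem_append] at he ⊢
        tauto
      have hadd : addEdge (fun x y => (x, y) ∈ E₀ ++ l₁) a b =
          fun x y => (x, y) ∈ E₀ ++ (l₁ ++ [(a, b)]) := by
        rw [addEdge_mem_append, List.append_assoc]
      obtain ⟨s', r, hI', hc'⟩ := hI.runs_insert (a := a) (b := b) (S := S) (q := q) hn ht htn
        (by rw [hadd]; exact fun x hx => hac x (hrmono hsub x x hx))
        (by rw [hadd]; exact fun x y hxy => hS' x y (hrmono hsub x y hxy)) hq (Nat.lt_succ_self _)
      rw [hadd] at hI' hc'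
      refine ⟨s', r, hI', ?_⟩
      have m₁ := swapPotential_mono (p := p) (q := q) (S := S) hn (hrmono hsub') s.pos
      have m₂ := sortPotential_mono (S := S) ht (hrmono hsub') s.pos
      rw [List.length_append, List.length_singleton]
      push_cast
      linarith)
    ⟨by simpa using hI₀.setClock 0, by
      have := hpot₀ (TransGen fun x y => (x, y) ∈ E₀ ++ []) s₀.pos
      simpa using this⟩
  exact ⟨_, s, S, s.pos, _, r₀.bind (Runs.bind (a := ()) rfl r), hS', hc⟩

theorem swapPotential_le (hn : 0 < n) (hS : ∀ x y, r x y → S x < S y) (T : Fin n ≃ Fin n) :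
    swapPotential p q S r T ≤ 3 * q * (n : ℝ) ^ 2 + swapCost n p 1 * (2 * ((n : ℝ) ^ 2 * √n)) := by
  have h1 : ((settled r T).card : ℝ) ≤ (n : ℝ) ^ 2 := by exact_mod_cast card_settled_le_sq r T
  have h2 := potential_le (T := T) hS (t := n) (by exact_mod_cast hn)
  unfold swapPotential
  gcongr

/-- The rate 10 t_{i+1}/t_i times the maximum 2n²√t_{i+1} of the potential is 20 times the summand
of the theorem. -/
theorem sortPotential_le (ht : ∀ i ≤ p + 1, 1 ≤ t i) (hS : ∀ x y, r x y → S x < S y)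
    (T : Fin n ≃ Fin n) :
    sortPotential p t S r T ≤
      20 * ∑ i ∈ Finset.Icc 1 (p + 1), (n : ℝ) ^ 2 * t i ^ (3 / 2 : ℝ) / t (i - 1) := by
  have hre : ∑ i ∈ Finset.Icc 1 (p + 1), (n : ℝ) ^ 2 * t i ^ (3 / 2 : ℝ) / t (i - 1) =
      ∑ i ∈ Finset.range (p + 1), (n : ℝ) ^ 2 * t (i + 1) ^ (3 / 2 : ℝ) / t i := by
    refine (Finset.sum_bij (fun i _ => i + 1) (fun i hi => ?_) (fun _ _ _ _ h => by omega)
      (fun j hj => ?_) fun i _ => ?_).symm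
    · rw [Finset.mem_range] at hi
      rw [Finset.mem_Icc]
      omega
    · rw [Finset.mem_Icc] at hj
      exact ⟨j - 1, by rw [Finset.mem_range]; omega, by omega⟩
    · simp
  rw [hre, Finset.mul_sum]
  refine Finset.sum_le_sum fun i hi => ?_
  rw [Finset.mem_range] at hi
  have h1 := one_pos.trans_le (ht (i + 1) (by omega))
  have h2 := one_pos.trans_le (ht i (by omega))
  have h3 : t (i + 1) ^ (3 / 2 : ℝ) = t (i + 1) * √(t (i + 1)) := by
    rw [Real.sqrt_eq_rpow, ← Real.rpow_one_add' h1.le (by norm_num)]; norm_num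
  rw [h3]
  calc 10 * t (i + 1) / t i * potential r S (t (i + 1)) T
      ≤ 10 * t (i + 1) / t i * (2 * ((n : ℝ) ^ 2 * √(t (i + 1)))) :=
        mul_le_mul_of_nonneg_left (potential_le hS h1) (by positivity)
    _ = _ := by ring

/-- All factors in the bound other than those of the theorem. -/
def overhead (n p : ℕ) : ℕ :=
  insertCost n p + 1 + 3 * (p + SearchTree.maxHeight n + 42) + 2 * swapCost n p 1 + 80

/-- All terms other than the counting sorts above level 0 fit under n² t₀: distinct edges number at
most n², and n²√n is below n² t₀ by the assumption on `t 0`. -/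
theorem session_bound {E₀ es : List (Fin n × Fin n)} {T₀ : Fin n ≃ Fin n} (hn : 0 < n)
    (ht₀ : √n < t 0) (ht : ∀ i ≤ p + 1, 1 ≤ t i) (htn : t (p + 1) = n)
    (hT₀ : IsTopologicalOrder E₀ T₀) (hnd : (E₀ ++ es).Nodup) (hac : IsAcyclic (E₀ ++ es)) :
    ∃ (fuel : ℕ) (s : Mem n),
      Runs (session p (fun i => ⌊t i⌋₊) fuel E₀ es) (emptyMem T₀) () s ∧
      (s.clock : ℝ) ≤ overhead n p *
        (∑ i ∈ Finset.Icc 1 (p + 1), (n : ℝ) ^ 2 * t i ^ (3 / 2 : ℝ) / t (i - 1) +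
          (n : ℝ) ^ 2 * t 0) := by
  obtain ⟨fuel, s, S, T, r, hr, hS, hc⟩ := runs_session hn ht htn hT₀ hac le_rfl
  refine ⟨fuel, s, hr, ?_⟩
  have h1 := swapPotential_le (p := p)
    (q := p + 14 * ⌊t 0⌋₊ + SearchTree.maxHeight n + 28) hn hS T
  have h2 := sortPotential_le ht hS T
  have hlen : (es.length : ℝ) ≤ (n : ℝ) ^ 2 := by
    have := (List.nodup_append.mp hnd).2.1.length_le_card
    simp only [Fintype.card_prod, Fintype.card_fin] at this
    rw [sq]; exact_mod_cast this
  have hsum : 0 ≤ ∑ i ∈ Finset.Icc 1 (p + 1), (n : ℝ) ^ 2 * t i ^ (3 / 2 : ℝ) / t (i - 1) := by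
    refine Finset.sum_nonneg fun i hi => ?_
    rw [Finset.mem_Icc] at hi
    have h1 := one_pos.trans_le (ht i (by omega))
    have h2 := one_pos.trans_le (ht (i - 1) (by omega))
    positivity
  set W := ∑ i ∈ Finset.Icc 1 (p + 1), (n : ℝ) ^ 2 * t i ^ (3 / 2 : ℝ) / t (i - 1)
  have ht0 := ht 0 (Nat.zero_le _)
  have hfl := Nat.floor_le (zero_le_one.trans ht0)
  have hn2 : (n : ℝ) ^ 2 ≤ (n : ℝ) ^ 2 * t 0 := le_mul_of_one_le_right (by positivity) ht0
  have e1 : (es.length : ℝ) * (insertCost n p + 1) ≤ (insertCost n p + 1) * ((n : ℝ) ^ 2 * t 0) := by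
    rw [mul_comm]
    exact mul_le_mul_of_nonneg_left (hlen.trans hn2) (by positivity)
  have e2 : (n : ℝ) ^ 2 * √n ≤ (n : ℝ) ^ 2 * t 0 :=
    mul_le_mul_of_nonneg_left ht₀.le (by positivity)
  have e3 : (swapCost n p 1 : ℝ) * (2 * ((n : ℝ) ^ 2 * √n)) ≤
      2 * swapCost n p 1 * ((n : ℝ) ^ 2 * t 0) := by
    have := mul_le_mul_of_nonneg_left e2 (by positivity : (0 : ℝ) ≤ 2 * swapCost n p 1)
    linarith
  have e4 : (p : ℝ) + 14 * ⌊t 0⌋₊ + SearchTree.maxHeight n + 28 ≤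
      (p + SearchTree.maxHeight n + 42) * t 0 := by
    have h3 : (0 : ℝ) ≤ (p + SearchTree.maxHeight n + 28 : ℝ) * (t 0 - 1) :=
      mul_nonneg (by positivity) (by linarith)
    nlinarith
  have e5 : 3 * ((p : ℝ) + 14 * ⌊t 0⌋₊ + SearchTree.maxHeight n + 28) * (n : ℝ) ^ 2 ≤
      3 * (p + SearchTree.maxHeight n + 42) * ((n : ℝ) ^ 2 * t 0) := by
    have := mul_le_mul_of_nonneg_right e4 (by positivity : (0 : ℝ) ≤ 3 * (n : ℝ) ^ 2)
    linarith
  have e6 : 0 ≤ (overhead n p - 80 : ℝ) * W := by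
    refine mul_nonneg ?_ hsum
    unfold overhead
    push_cast
    have : (0 : ℝ) ≤ insertCost n p + 1 + 3 * (p + SearchTree.maxHeight n + 42) +
      2 * swapCost n p 1 := by positivity
    linarith
  have e7 : (overhead n p : ℝ) * ((n : ℝ) ^ 2 * t 0) = (insertCost n p + 1 +
      3 * (p + SearchTree.maxHeight n + 42) + 2 * swapCost n p 1 + 80) * ((n : ℝ) ^ 2 * t 0) := by
    unfold overhead; push_cast; ring
  have e8 : 0 ≤ (n : ℝ) ^ 2 * t 0 := by positivity
  push_cast at h1
  rw [mul_add, e7]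
  linarith

/-- The overhead is at worst a product of the number of levels and the tree height, both
logarithmic; hence the exponent 2. Additive constants are absorbed using log n ≥ log 2 > 0.69. -/
theorem overhead_le {c : ℝ} (hn : 2 ≤ n) (hp : (p : ℝ) ≤ c * Real.log n) :
    (overhead n p : ℝ) ≤ (252 * (|c| + 3) + 916) * Real.log n ^ 2 := by
  have hL2 : Real.log 2 ≤ Real.log n := Real.log_le_log (by norm_num) (by exact_mod_cast hn)
  have hl2 := Real.log_two_gt_d9
  have hn' : (2 : ℝ) ≤ n := by exact_mod_cast hn
  set a := Real.log n with ha
  have ha1 : 0.69 ≤ a := by linarith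
  have hlog : (Nat.log 2 (n + 1) : ℝ) ≤ 3 * a := by
    have h1 : (2 : ℝ) ^ Nat.log 2 (n + 1) ≤ (n : ℝ) ^ 2 := by
      have : 2 ^ Nat.log 2 (n + 1) ≤ n + 1 := Nat.pow_log_le_self 2 (by omega)
      have h2 : (2 : ℝ) ^ Nat.log 2 (n + 1) ≤ n + 1 := by exact_mod_cast this
      nlinarith
    have h2 := Real.log_le_log (by positivity) h1
    rw [Real.log_pow, Real.log_pow, ← ha] at h2
    push_cast at h2
    have h3 : (0 : ℝ) ≤ Nat.log 2 (n + 1) := by positivity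
    nlinarith
  have hH : (SearchTree.maxHeight n : ℝ) ≤ 8 * a := by
    unfold SearchTree.maxHeight; push_cast; linarith
  have hP : (p : ℝ) + 2 ≤ (|c| + 3) * a := by
    have : c * a ≤ |c| * a := mul_le_mul_of_nonneg_right (le_abs_self c) (by linarith)
    linarith
  have hp0 : (0 : ℝ) ≤ p := by positivity
  have hH0 : (0 : ℝ) ≤ SearchTree.maxHeight n := by positivity
  have hc0 : (3 : ℝ) ≤ |c| + 3 := by linarith [abs_nonneg c]
  generalize |c| + 3 = P at *
  have k1 : ((p : ℝ) + 2) * (2 * SearchTree.maxHeight n + 3) ≤ 22 * P * a ^ 2 := by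
    calc ((p : ℝ) + 2) * (2 * SearchTree.maxHeight n + 3) ≤ (P * a) * (22 * a) := by
          apply mul_le_mul hP (by linarith) (by positivity) (by positivity)
      _ = _ := by ring
  have k2 : ((p : ℝ) + 2) * (5 * (2 * SearchTree.maxHeight n + 3) + 1) ≤ 112 * P * a ^ 2 := by
    calc ((p : ℝ) + 2) * (5 * (2 * SearchTree.maxHeight n + 3) + 1) ≤ (P * a) * (112 * a) := by
          apply mul_le_mul hP (by linarith) (by positivity) (by positivity)
      _ = _ := by ring
  have k3 : P * a ≤ 2 * (P * a ^ 2) := by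
    have : 0 ≤ P * a := by positivity
    nlinarith
  have k4 : a ≤ 2 * a ^ 2 := by nlinarith
  have k5 : 1 ≤ 4 * a ^ 2 := by nlinarith
  -- Here 252 = 22 + 3·2 + 2·112 from `k1`, `k3` and `k2`. The height contributes 3·8·2 = 48 through
  -- `k4`, and the constants sum to 217, so that 916 = 48 + 4·217 by `k5`.
  unfold overhead insertCost swapCost levelCost pairCost
  push_cast
  linarith

end Session
end OnlineTopo

/-! ### The main theorem. -/

theorem mainTheorem9 :
    ∃ κ : ℕ, ∀ c : ℝ, ∃ C : ℝ, ∀ (n p : ℕ) (t : ℕ → ℝ),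
      (p : ℝ) ≤ c * Real.log n →
      Real.sqrt n < t 0 →
      (∀ i ≤ p, t i < t (i + 1)) →
      t (p + 1) = n →
      ∀ (E₀ es : List (Fin n × Fin n)) (T₀ : Fin n ≃ Fin n),
        OnlineTopo.IsTopologicalOrder E₀ T₀ →
        (E₀ ++ es).Nodup →
        OnlineTopo.IsAcyclic (E₀ ++ es) →
        ∃ (fuel : ℕ) (s : OnlineTopo.Mem n),
          (OnlineTopo.session p (fun i => ⌊t i⌋₊) fuel E₀ es).run (OnlineTopo.emptyMem T₀)
            = some ((), s) ∧
          (s.clock : ℝ) ≤ C * Real.log n ^ κ *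
            (∑ i ∈ Finset.Icc 1 (p + 1),
                (n : ℝ) ^ 2 * t i ^ (3 / 2 : ℝ) / t (i - 1)
              + (n : ℝ) ^ 2 * t 0) := by
  refine ⟨2, fun c => ⟨252 * (|c| + 3) + 916, ?_⟩⟩
  intro n p t hp ht₀ hlt htn E₀ es T₀ hT₀ hnd hac
  have hmono : ∀ i ≤ p + 1, t 0 ≤ t i := by
    intro i hi
    induction i with
    | zero => exact le_rfl
    | succ i ih => exact (ih (by omega)).trans (hlt i (by omega)).le
  -- The chain of thresholds from √n up to n forces n ≥ 2, so that log n is bounded away from zero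
  -- and all thresholds are at least one.
  have h0 : √(n : ℝ) < n := by
    have := hlt p le_rfl
    have := hmono p (by omega)
    linarith
  have hn : 2 ≤ n := by
    by_contra hn
    have : n = 0 ∨ n = 1 := by omega
    rcases this with rfl | rfl <;> simp at h0
  have ht : ∀ i ≤ p + 1, 1 ≤ t i := by
    intro i hi
    have h1 : 1 ≤ √(n : ℝ) := Real.one_le_sqrt.mpr (by exact_mod_cast (by omega : 1 ≤ n))
    linarith [hmono i hi]
  obtain ⟨fuel, s, hr, hc⟩ := OnlineTopo.session_bound (by omega) ht₀ ht htn hT₀ hnd hac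
  refine ⟨fuel, s, hr, hc.trans ?_⟩
  refine mul_le_mul_of_nonneg_right (OnlineTopo.overhead_le hn hp) ?_
  refine add_nonneg (Finset.sum_nonneg fun i hi => ?_) ?_
  · rw [Finset.mem_Icc] at hi
    have h1 := one_pos.trans_le (ht i (by omega))
    have h2 := one_pos.trans_le (ht (i - 1) (by omega))
    positivity
  · have := one_pos.trans_le (ht 0 (by omega))
    positivity
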